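/- **Notation.** For $m\ge 0$ let $B_{m+1}$ be the Artin braid group on $m+1$ strands, with standard generators $\sigma_1,\dots,\sigma_m$, let $l:B_{m+1}\to\mathbf Z$ be the homomorphism with $l(\sigma_r)=1$, and let $\iota:B_{m+1}\to B_{m+2}$ be the standard inclusion. Let $P=\mathbf C[\alpha_1,\dots,\alpha_m]$, graded with $\deg\alpha_r=1$, where $\alpha_r=X_{r+1}-X_r$; it carries the action of the symmetric group $\mathfrak S_{m+1}$ permuting the $X_i$. For graded $M$ put $M\langle n\rangle_e=M_{n+e}$, and let $P^{\mathrm{en}}=P\otimes_{\mathbf C}P$. For the transposition $s=(r,r+1)$ put $\theta_s=P\otimes_{P^s}P$ and consider the complexes of graded $P^{\mathrm{en}}$-modules $$F_{\sigma_r}=\bigl(0\to\theta_s\langle1\rangle\xrightarrow{\ a\otimes b\mapsto ab\ }P\langle1\rangle\to0\bigr),\qquad F_{\sigma_r^{-1}}=\bigl(0\to P\langle-1\rangle\xrightarrow{\ a\mapsto a\alpha_r\otimes1+a\otimes\alpha_r\ }\theta_s\to0\bigr),$$ with $P\langle1\rangle$ in cohomological degree $1$ and $P\langle-1\rangle$ in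 cohomological degree $-1$. For a word $w$ in the $\sigma_r^{\pm1}$ representing $b\in B_{m+1}$ let $F_w$ be the tensor product over $P$ of the corresponding complexes. Let $\mathrm{HH}_i=\mathrm{Tor}_i^{P^{\mathrm{en}}}(P,-)$ (a graded vector space), applied termwise to $F_w$, so that $\mathrm{HH}_i(F_w)$ is a complex, and put $$X_w=(t_2t_3^{-1})^{(m+l(b))/2}\sum_{d,i,j}\dim H^j(\mathrm{HH}_i(F_w))_d\;t_1^d\,t_2^{-i}\,t_3^j .$$ Let $Y_w$ be $X_w$ specialized at $t_3^{1/2}=\sqrt{-1}$. **Statement.** 1. All the dimensions above are finite, and $X_w$ is a well-defined Laurent series in $t_1$ with coefficients in $\mathbf N[t_2^{\pm1/2},t_3^{\pm1/2}]$ (only finitely many pairs $(i,j)$ contribute). Hence $Y_w$ lies in $\mathbf Z[\sqrt{-1}][t_2^{\pm1/2}]((t_1^{1/2}))$. Moreover $Y_w$ depends only on the braid $b$ represented by $w$; write $Y_b=Y_w$. 2. (Skein relation) For all $m$, all $b,b'\in B_{m+1}$ and all $r\in\{1,\dots,m\}$, $$t_1^{-1/2}t_2^{1/2}\,Y_{b\sigma_r^{-1}b'}+t_1^{1/2}t_2^{-1/2}\,Y_{b\sigma_rb'}=\sqrt{-1}\,(t_1^{-1/2}-t_1^{1/2})\,Y_{bb'}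 .$$ 3. Hence $Y$ is the HOMFLYPT polynomial. That is: $Y$ is an invariant of oriented links, presented as closures of braids ($Y_{bb'}=Y_{b'b}$ for $b,b'\in B_{m+1}$, and $Y_{\iota(b)\sigma_{m+1}^{\pm1}}=Y_b$ for $b\in B_{m+1}$), and $Y_1=1$ for $1\in B_1$ (the unknot). There is exactly one family of functions $Q:B_{m+1}\to\mathbf Z[l^{\pm1},z^{\pm1}]$ ($m\ge0$) that is invariant under these Markov moves, has $Q_1=1$ for $1\in B_1$, and satisfies $l\,Q_{b\sigma_rb'}+l^{-1}Q_{b\sigma_r^{-1}b'}+z\,Q_{bb'}=0$ for all $m,b,b',r$ (the HOMFLYPT polynomial of the closed braid), and for every braid $b$, $Y_b$ is the image of $Q_b$ under the ring homomorphism given by $l=t_1^{1/2}t_2^{-1/2}$, $z=-\sqrt{-1}\,(t_1^{-1/2}-t_1^{1/2})$. -/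

import Mathlib

open scoped TensorProduct LaurentPolynomial

noncomputable section

namespace KR

/-! ## Braid groups -/

/-- The defining relators of the braid group with `m` generators. -/
def braidRels (m : ℕ) : Set (FreeGroup (Fin m)) :=
  {x | (∃ i j : Fin m, i.val + 1 < j.val ∧
          x = FreeGroup.of i * FreeGroup.of j * (FreeGroup.of j * FreeGroup.of i)⁻¹) ∨
       (∃ i j : Fin m, i.val + 1 = j.val ∧
          x = FreeGroup.of i * FreeGroup.of j * FreeGroup.of i *
            (FreeGroup.of j * FreeGroup.of i * FreeGroup.of j)⁻¹)}

/-- `Braid m` is the Artin braid group `B_{m+1}` on `m + 1` strands. -/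
abbrev Braid (m : ℕ) : Type := PresentedGroup (braidRels m)

/-- The standard generator; `σ r` for `r : Fin m` is `σ_{r+1}` in the usual numbering. -/
def σ {m : ℕ} (r : Fin m) : Braid m := PresentedGroup.of r

/-- The standard inclusion `B_{m+1} → B_{m+2}`, adding a strand at the end. -/
def ι (m : ℕ) : Braid m →* Braid (m + 1) :=
  PresentedGroup.toGroup (f := fun i : Fin m => (σ i.castSucc : Braid (m + 1))) (by
    rintro x (⟨i, j, h, rfl⟩ | ⟨i, j, h, rfl⟩)
    · have : (PresentedGroup.mk (braidRels (m + 1))) (FreeGroup.of i.castSucc *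
          FreeGroup.of j.castSucc * (FreeGroup.of j.castSucc * FreeGroup.of i.castSucc)⁻¹) = 1 :=
        PresentedGroup.one_of_mem (Or.inl ⟨_, _, by simpa using h, rfl⟩)
      simpa [σ, PresentedGroup.of] using this
    · have : (PresentedGroup.mk (braidRels (m + 1))) (FreeGroup.of i.castSucc *
          FreeGroup.of j.castSucc * FreeGroup.of i.castSucc * (FreeGroup.of j.castSucc *
            FreeGroup.of i.castSucc * FreeGroup.of j.castSucc)⁻¹) = 1 :=
        PresentedGroup.one_of_mem (Or.inr ⟨_, _, by simpa using h, rfl⟩)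
      simpa [σ, PresentedGroup.of] using this)

/-- Braid words: `(r, true)` stands for `σ_r` and `(r, false)` for `σ_r⁻¹`. -/
abbrev Word (m : ℕ) : Type := List (Fin m × Bool)

/-- The braid represented by a word. -/
def braidOf {m : ℕ} (w : Word m) : Braid m := PresentedGroup.mk (braidRels m) (FreeGroup.mk w)

/-- The length `l(b)` of the braid `b` represented by `w`: the sum of the exponents. -/
def len {m : ℕ} (w : Word m) : ℤ := (w.map fun x => if x.2 then (1 : ℤ) else -1).sum

/-! ## The polynomial ring and its reflections -/

/-- `P = ℂ[α_1, …, α_m]`, the ring of polynomial functions on the reflection representation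
`ℂ^(m+1) / ℂ(1, …, 1)` of the symmetric group; all `α_j` have degree one. -/
abbrev P (m : ℕ) : Type := MvPolynomial (Fin m) ℂ

/-- The simple root `α_r = X_{r+1} - X_r`. -/
abbrev α {m : ℕ} (r : Fin m) : P m := MvPolynomial.X r

/-- The action on `P` of the transposition `s = (r, r+1)`. -/
def refl {m : ℕ} (r : Fin m) : P m →ₐ[ℂ] P m :=
  MvPolynomial.aeval fun j : Fin m =>
    if j = r then -α r
    else if j.val + 1 = r.val ∨ r.val + 1 = j.val then α j + α r
    else α j

/-- The subring of invariants `P^s`. -/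
def Inv {m : ℕ} (r : Fin m) : Subalgebra ℂ (P m) := AlgHom.equalizer (refl r) (AlgHom.id ℂ (P m))

/-- The homogeneous polynomials of degree `e ∈ ℤ` in `P`. -/
def Pgr (m : ℕ) (e : ℤ) : Submodule ℂ (P m) :=
  if 0 ≤ e then MvPolynomial.homogeneousSubmodule (Fin m) ℂ e.toNat else ⊥

theorem α_mem_Pgr {m : ℕ} (r : Fin m) : α r ∈ Pgr m 1 := by
  simpa [Pgr] using MvPolynomial.isHomogeneous_X ℂ r

theorem mul_mem_Pgr {m : ℕ} {p q : P m} {e f : ℤ} (hp : p ∈ Pgr m e) (hq : q ∈ Pgr m f) :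
    p * q ∈ Pgr m (e + f) := by
  unfold Pgr at *
  by_cases he : 0 ≤ e
  · by_cases hf : 0 ≤ f
    · rw [if_pos he, MvPolynomial.mem_homogeneousSubmodule] at hp
      rw [if_pos hf, MvPolynomial.mem_homogeneousSubmodule] at hq
      rw [if_pos (by omega), MvPolynomial.mem_homogeneousSubmodule,
        Int.toNat_add he hf]
      exact hp.mul hq
    · rw [if_neg hf, Submodule.mem_bot] at hq
      simp [hq]
  · rw [if_neg he, Submodule.mem_bot] at hp
    simp [hp]

theorem refl_α {m : ℕ} (r : Fin m) : refl r (α r) = -α r := by simp [refl]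

theorem refl_refl {m : ℕ} (r : Fin m) (p : P m) : refl r (refl r p) = p := by
  have : (refl r).comp (refl r) = AlgHom.id ℂ (P m) := by
    apply MvPolynomial.algHom_ext
    intro j
    by_cases h : j = r
    · subst h; simp [refl]
    · by_cases h' : j.val + 1 = r.val ∨ r.val + 1 = j.val <;> simp [refl, h, h']
  exact congrArg (fun f : P m →ₐ[ℂ] P m => f p) this

/-- `P = P^s ⊕ P^s α_s`. -/
theorem exists_decomp {m : ℕ} (r : Fin m) (p : P m) :
    ∃ a b : Inv r, p = (a : P m) + (b : P m) * α r := by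
  have h1 : (Ideal.Quotient.mkₐ ℂ (Ideal.span {α r})).comp (refl r) =
      Ideal.Quotient.mkₐ ℂ (Ideal.span {α r}) := by
    apply MvPolynomial.algHom_ext
    intro j
    have hr : (Ideal.Quotient.mk (Ideal.span {α r})) (α r) = 0 :=
      Ideal.Quotient.eq_zero_iff_mem.2 (Ideal.subset_span rfl)
    by_cases h : j = r
    · subst h; simp [refl, hr]
    · by_cases h' : j.val + 1 = r.val ∨ r.val + 1 = j.val <;> simp [refl, h, h', hr]
  have h2 : p - refl r p ∈ Ideal.span {α r} := by
    rw [← Ideal.Quotient.eq_zero_iff_mem, map_sub, sub_eq_zero]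
    exact (congrArg (fun f : P m →ₐ[ℂ] _ => f p) h1).symm
  obtain ⟨q, hq⟩ := Ideal.mem_span_singleton'.1 h2
  have hα : (α r : P m) ≠ 0 := MvPolynomial.X_ne_zero r
  have hqs : refl r q = q := by
    have h3 := congrArg (refl r) hq
    rw [map_mul, map_sub, refl_refl, refl_α] at h3
    apply mul_right_cancel₀ hα
    rw [hq]
    linear_combination -h3
  have hC : (MvPolynomial.C (1 / 2 : ℂ) : P m) * 2 = 1 := by
    rw [show (2 : P m) = MvPolynomial.C 2 from rfl, ← MvPolynomial.C_mul]
    norm_num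
  have hCr : refl r (MvPolynomial.C (1 / 2 : ℂ) : P m) = MvPolynomial.C (1 / 2) :=
    (refl r).commutes _
  refine ⟨⟨MvPolynomial.C (1 / 2) * (p + refl r p), ?_⟩, ⟨MvPolynomial.C (1 / 2) * q, ?_⟩, ?_⟩
  · change refl r _ = _
    rw [map_mul, map_add, refl_refl, hCr, AlgHom.id_apply, add_comm]
  · change refl r _ = _
    rw [map_mul, hCr, hqs, AlgHom.id_apply]
  · change p = MvPolynomial.C (1 / 2) * (p + refl r p) + MvPolynomial.C (1 / 2) * q * α r
    rw [mul_assoc, hq]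
    linear_combination -p * hC

/-! ## Complexes of graded bimodules -/

/-- A complex of graded `P^en`-modules, given as a bigraded `P^en`-module with a differential.
A `P^en`-module is a left `P`-module together with a right action of `P` commuting with the left
action. `gr j e` is the part of cohomological degree `j` and internal degree `e`; the
differential is a map of graded `P^en`-modules raising the cohomological degree by one.
(That the pieces `gr j e` form a direct sum decomposition holds for all complexes
constructed below, but is not recorded.) -/
structure BimodComplex (m : ℕ) where
  carrier : Type
  [acg : AddCommGroup carrier]
  [modC : Module ℂ carrier]
  [modP : Module (P m) carrier]
  [tower : IsScalarTower ℂ (P m) carrier]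
  right : P m →+* Module.End (P m) carrier
  right_C : ∀ (c : ℂ) x, right (MvPolynomial.C c) x = c • x
  gr : ℤ → ℤ → Submodule ℂ carrier
  d : carrier →ₗ[P m] carrier
  d_d : ∀ x, d (d x) = 0
  d_right : ∀ p x, d (right p x) = right p (d x)
  d_mem : ∀ {j e x}, x ∈ gr j e → d x ∈ gr (j + 1) e
  smul_mem : ∀ {j e f p x}, p ∈ Pgr m f → x ∈ gr j e → p • x ∈ gr j (f + e)
  right_mem : ∀ {j e f p x}, p ∈ Pgr m f → x ∈ gr j e → right p x ∈ gr j (f + e)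

attribute [instance] BimodComplex.acg BimodComplex.modC BimodComplex.modP BimodComplex.tower

/-- The regular bimodule `P` in cohomological degree `0`. -/
def one (m : ℕ) : BimodComplex m where
  carrier := P m
  right := (Algebra.lsmul ℂ (P m) (P m)).toRingHom
  right_C c x := (MvPolynomial.smul_eq_C_mul x c).symm
  gr j e := if j = 0 then Pgr m e else ⊥
  d := 0
  d_d := by simp
  d_right := by simp
  d_mem := by simp
  smul_mem := by
    intro j e f p x hp hx
    split_ifs at hx ⊢
    · exact mul_mem_Pgr hp hx
    · rw [Submodule.mem_bot] at hx ⊢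
      simp [hx]
  right_mem := by
    intro j e f p x hp hx
    split_ifs at hx ⊢
    · exact mul_mem_Pgr hp hx
    · rw [Submodule.mem_bot] at hx ⊢
      simp [hx]

section Theta

variable {m : ℕ} (r : Fin m) (M : BimodComplex m)

/-- The underlying left module of `θ_s ⊗_P M = P ⊗_{P^s} M`. -/
abbrev Theta : Type := P m ⊗[Inv r] M.carrier

instance : IsScalarTower ℂ (P m) (Theta r M) := TensorProduct.isScalarTower_left

/-- A bimodule endomorphism `f` of `M` induces `id ⊗ f` on `P ⊗_{P^s} M`. -/
def thetaMap (f : M.carrier →ₗ[P m] M.carrier) : Theta r M →ₗ[P m] Theta r M :=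
  TensorProduct.AlgebraTensorModule.map LinearMap.id (f.restrictScalars (Inv r))

@[simp] theorem thetaMap_tmul (f : M.carrier →ₗ[P m] M.carrier) (a : P m) (x : M.carrier) :
    thetaMap r M f (a ⊗ₜ x) = a ⊗ₜ f x := rfl

theorem theta_hom_ext {N : Type} [AddCommMonoid N] {f g : Theta r M →+ N}
    (h : ∀ (a : P m) (x : M.carrier), f (a ⊗ₜ x) = g (a ⊗ₜ x)) (z : Theta r M) : f z = g z := by
  induction z using TensorProduct.induction_on with
  | zero => simp
  | tmul a x => exact h a x
  | add x y hx hy => rw [map_add, map_add, hx, hy]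

/-- The right action on `P ⊗_{P^s} M`, through the second factor. -/
def thetaRight : P m →+* Module.End (P m) (Theta r M) where
  toFun p := thetaMap r M (M.right p)
  map_one' := by
    refine LinearMap.ext fun z => ?_
    exact theta_hom_ext r M (f := (thetaMap r M (M.right 1)).toAddMonoidHom)
      (g := AddMonoidHom.id _) (by simp) z
  map_mul' p q := by
    refine LinearMap.ext fun z => ?_
    exact theta_hom_ext r M (f := (thetaMap r M (M.right (p * q))).toAddMonoidHom)
      (g := (thetaMap r M (M.right p) ∘ₗ thetaMap r M (M.right q)).toAddMonoidHom) (by simp) z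
  map_zero' := by
    refine LinearMap.ext fun z => ?_
    exact theta_hom_ext r M (f := (thetaMap r M (M.right 0)).toAddMonoidHom)
      (g := 0) (by simp) z
  map_add' p q := by
    refine LinearMap.ext fun z => ?_
    exact theta_hom_ext r M (f := (thetaMap r M (M.right (p + q))).toAddMonoidHom)
      (g := (thetaMap r M (M.right p) + thetaMap r M (M.right q)).toAddMonoidHom)
      (by simp [TensorProduct.tmul_add]) z

@[simp] theorem thetaRight_tmul (p a : P m) (x : M.carrier) :
    thetaRight r M p (a ⊗ₜ x) = a ⊗ₜ M.right p x := rfl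

/-- The multiplication `m : P ⊗_{P^s} M → M`. -/
def mulMap : Theta r M →ₗ[P m] M.carrier :=
  TensorProduct.AlgebraTensorModule.lift
    { toFun := fun a =>
        { toFun := fun x => a • x
          map_add' := smul_add a
          map_smul' := fun b x => smul_comm a (b : P m) x }
      map_add' := fun a b => LinearMap.ext fun x => add_smul a b x
      map_smul' := fun a b => LinearMap.ext fun x => mul_smul a b x }

@[simp] theorem mulMap_tmul (a : P m) (x : M.carrier) : mulMap r M (a ⊗ₜ x) = a • x := rfl

/-- The map `M → P ⊗_{P^s} M`, `x ↦ α_s ⊗ x + 1 ⊗ α_s x`: the tensor product over `P` of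
`P → θ_s`, `a ↦ a α_s ⊗ 1 + a ⊗ α_s`, with `M`. -/
def etaMap : M.carrier →ₗ[P m] Theta r M where
  toFun x := α r ⊗ₜ x + 1 ⊗ₜ (α r • x)
  map_add' x y := by
    rw [smul_add, TensorProduct.tmul_add, TensorProduct.tmul_add]; abel
  map_smul' p x := by
    obtain ⟨a, b, rfl⟩ := exists_decomp r p
    have key : ∀ (c : Inv r) (y : M.carrier) (q : P m),
        q ⊗ₜ[Inv r] ((c : P m) • y) = ((c : P m) * q) ⊗ₜ[Inv r] y := fun c y q =>
      (TensorProduct.smul_tmul c q y).symm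
    have hc : α r * α r ∈ Inv r := by
      change refl r _ = _
      simp [refl_α]
    have e1 : α r • (((a : P m) + (b : P m) * α r) • x) =
        (a : P m) • (α r • x) + ((b * ⟨_, hc⟩ : Inv r) : P m) • x := by
      simp only [smul_smul, ← add_smul, MulMemClass.coe_mul]
      congr 1; ring
    have e2 : ((a : P m) + (b : P m) * α r) • x =
        (a : P m) • x + (b : P m) • (α r • x) := by
      simp only [smul_smul, ← add_smul]
    rw [e1, e2]
    simp only [TensorProduct.tmul_add, key]
    simp only [RingHom.id_apply, smul_add, TensorProduct.smul_tmul',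
      smul_eq_mul, add_mul, TensorProduct.add_tmul, mul_one,
      MulMemClass.coe_mul]
    simp only [mul_assoc]
    abel

/-- The bigrading on `P ⊗_{P^s} M`: `a ⊗ x` has bidegree `(j, f + e)` when `a` is homogeneous of
degree `f` and `x` has bidegree `(j, e)`. -/
def thetaGr (j e : ℤ) : Submodule ℂ (Theta r M) :=
  Submodule.span ℂ {z | ∃ f g a x, f + g = e ∧ a ∈ Pgr m f ∧ x ∈ M.gr j g ∧ z = a ⊗ₜ x}

theorem tmul_mem_thetaGr {j f g : ℤ} {a : P m} {x : M.carrier} (ha : a ∈ Pgr m f)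
    (hx : x ∈ M.gr j g) : (a ⊗ₜ x : Theta r M) ∈ thetaGr r M j (f + g) :=
  Submodule.subset_span ⟨f, g, a, x, rfl, ha, hx, rfl⟩

theorem thetaGr_le {j e : ℤ} {N : Type} [AddCommGroup N] [Module ℂ N] [Module (P m) N]
    [IsScalarTower ℂ (P m) N] (F : Theta r M →ₗ[P m] N) (Q : Submodule ℂ N)
    (h : ∀ f g a x, f + g = e → a ∈ Pgr m f → x ∈ M.gr j g → F (a ⊗ₜ x) ∈ Q)
    {z : Theta r M} (hz : z ∈ thetaGr r M j e) : F z ∈ Q := by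
  induction hz using Submodule.span_induction with
  | mem z hz => obtain ⟨f, g, a, x, he, ha, hx, rfl⟩ := hz; exact h f g a x he ha hx
  | zero => rw [map_zero]; exact Q.zero_mem
  | add x y _ _ hx hy => rw [map_add]; exact Q.add_mem hx hy
  | smul c x _ hx =>
    rw [← IsScalarTower.algebraMap_smul (P m) c x, map_smul, IsScalarTower.algebraMap_smul]
    exact Q.smul_mem c hx

theorem thetaMap_mem {j j' e k : ℤ} (F : M.carrier →ₗ[P m] M.carrier)
    (h : ∀ g x, x ∈ M.gr j g → F x ∈ M.gr j' (k + g)) {z : Theta r M} (hz : z ∈ thetaGr r M j e) :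
    thetaMap r M F z ∈ thetaGr r M j' (k + e) := by
  refine thetaGr_le r M _ _ ?_ hz
  rintro f g a x rfl ha hx
  rw [thetaMap_tmul, show k + (f + g) = f + (k + g) by ring]
  exact tmul_mem_thetaGr r M ha (h g x hx)

theorem theta_smul_mem {j e k : ℤ} {p : P m} (hp : p ∈ Pgr m k) {z : Theta r M}
    (hz : z ∈ thetaGr r M j e) : p • z ∈ thetaGr r M j (k + e) := by
  refine thetaGr_le r M (LinearMap.lsmul (P m) (Theta r M) p) _ ?_ hz
  rintro f g a x rfl ha hx
  rw [LinearMap.lsmul_apply, TensorProduct.smul_tmul', ← add_assoc]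
  exact tmul_mem_thetaGr r M (mul_mem_Pgr hp ha) hx

theorem mulMap_mem {j e : ℤ} {z : Theta r M} (hz : z ∈ thetaGr r M j e) :
    mulMap r M z ∈ M.gr j e := by
  refine thetaGr_le r M _ _ ?_ hz
  rintro f g a x rfl ha hx
  exact M.smul_mem ha hx

theorem one_mem_Pgr : (1 : P m) ∈ Pgr m 0 := by
  rw [Pgr, if_pos le_rfl]
  exact MvPolynomial.isHomogeneous_one (Fin m) ℂ

theorem etaMap_mem {j e : ℤ} {x : M.carrier} (hx : x ∈ M.gr j e) :
    etaMap r M x ∈ thetaGr r M j (1 + e) := by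
  refine Submodule.add_mem _ (tmul_mem_thetaGr r M (α_mem_Pgr r) hx) ?_
  have := tmul_mem_thetaGr r M (one_mem_Pgr (m := m)) (M.smul_mem (α_mem_Pgr r) hx)
  rwa [zero_add] at this

theorem thetaMap_comp_eq_zero (F : M.carrier →ₗ[P m] M.carrier) (h : ∀ x, F (F x) = 0)
    (z : Theta r M) : thetaMap r M F (thetaMap r M F z) = 0 :=
  theta_hom_ext r M (f := (thetaMap r M F ∘ₗ thetaMap r M F).toAddMonoidHom) (g := 0)
    (by simp [h]) z

theorem thetaMap_comm (F G : M.carrier →ₗ[P m] M.carrier) (h : ∀ x, F (G x) = G (F x))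
    (z : Theta r M) :
    thetaMap r M F (thetaMap r M G z) = thetaMap r M G (thetaMap r M F z) :=
  theta_hom_ext r M (f := (thetaMap r M F ∘ₗ thetaMap r M G).toAddMonoidHom)
    (g := (thetaMap r M G ∘ₗ thetaMap r M F).toAddMonoidHom) (by simp [h]) z

theorem mulMap_thetaMap (F : M.carrier →ₗ[P m] M.carrier) (z : Theta r M) :
    mulMap r M (thetaMap r M F z) = F (mulMap r M z) :=
  theta_hom_ext r M (f := (mulMap r M ∘ₗ thetaMap r M F).toAddMonoidHom)
    (g := (F ∘ₗ mulMap r M).toAddMonoidHom) (by simp) z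

theorem thetaMap_etaMap (F : M.carrier →ₗ[P m] M.carrier) (x : M.carrier) :
    thetaMap r M F (etaMap r M x) = etaMap r M (F x) := by
  change thetaMap r M F (α r ⊗ₜ x + 1 ⊗ₜ (α r • x)) = α r ⊗ₜ F x + 1 ⊗ₜ (α r • F x)
  rw [map_add, thetaMap_tmul, thetaMap_tmul, map_smul]

theorem thetaRight_C (c : ℂ) (z : Theta r M) : thetaRight r M (MvPolynomial.C c) z = c • z :=
  theta_hom_ext r M (f := (thetaRight r M (MvPolynomial.C c)).toAddMonoidHom)
    (g := DistribSMul.toAddMonoidHom _ c) (by simp [M.right_C]) z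

/-- The complex `F_s ⊗_P M`, where `F_s = (0 → θ_s⟨1⟩ → P⟨1⟩ → 0)` with `P⟨1⟩` in cohomological
degree `1`: the total complex of `θ_s ⊗_P M⟨1⟩ → M⟨1⟩`. -/
def tensorPos : BimodComplex m where
  carrier := Theta r M × M.carrier
  right :=
    { toFun := fun p => (thetaRight r M p).prodMap (M.right p)
      map_one' := by ext1 <;> ext1 <;> simp
      map_mul' := fun p q => by refine LinearMap.ext fun z => ?_; simp
      map_zero' := by refine LinearMap.ext fun z => ?_; simp
      map_add' := fun p q => by refine LinearMap.ext fun z => ?_; simp }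
  right_C c x := Prod.ext (thetaRight_C r M c x.1) (M.right_C c x.2)
  gr j e := (thetaGr r M j (e + 1)).prod (M.gr (j - 1) (e + 1))
  d := ((thetaMap r M M.d) ∘ₗ LinearMap.fst _ _ _).prod
    (mulMap r M ∘ₗ LinearMap.fst _ _ _ - M.d ∘ₗ LinearMap.snd _ _ _)
  d_d x := by
    refine Prod.ext ?_ ?_
    · exact thetaMap_comp_eq_zero r M M.d M.d_d x.1
    · simp [mulMap_thetaMap, M.d_d]
  d_right p x := by
    refine Prod.ext ?_ ?_
    · exact thetaMap_comm r M M.d (M.right p) (M.d_right p) x.1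
    · change mulMap r M (thetaMap r M (M.right p) x.1) - M.d (M.right p x.2) =
        M.right p (mulMap r M x.1 - M.d x.2)
      rw [mulMap_thetaMap, M.d_right, map_sub]
  d_mem := by
    rintro j e x ⟨h1, h2⟩
    refine ⟨?_, ?_⟩
    · simpa using thetaMap_mem r M (k := 0) M.d (fun g y hy => by simpa using M.d_mem hy) h1
    · have h3 := M.d_mem h2
      rw [sub_add_cancel] at h3
      rw [add_sub_cancel_right]
      exact Submodule.sub_mem _ (mulMap_mem r M h1) h3
  smul_mem := by
    rintro j e f p x hp ⟨h1, h2⟩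
    rw [add_assoc]
    exact ⟨theta_smul_mem r M hp h1, M.smul_mem hp h2⟩
  right_mem := by
    rintro j e f p x hp ⟨h1, h2⟩
    rw [add_assoc]
    exact ⟨thetaMap_mem r M (M.right p) (fun g y hy => M.right_mem hp hy) h1, M.right_mem hp h2⟩

/-- The complex `F_s⁻¹ ⊗_P M`, where `F_s⁻¹ = (0 → P⟨-1⟩ → θ_s → 0)` with `P⟨-1⟩` in
cohomological degree `-1`: the total complex of `M⟨-1⟩ → θ_s ⊗_P M`. -/
def tensorNeg : BimodComplex m where
  carrier := M.carrier × Theta r M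
  right :=
    { toFun := fun p => (M.right p).prodMap (thetaRight r M p)
      map_one' := by ext1 <;> ext1 <;> simp
      map_mul' := fun p q => by refine LinearMap.ext fun z => ?_; simp
      map_zero' := by refine LinearMap.ext fun z => ?_; simp
      map_add' := fun p q => by refine LinearMap.ext fun z => ?_; simp }
  right_C c x := Prod.ext (M.right_C c x.1) (thetaRight_C r M c x.2)
  gr j e := (M.gr (j + 1) (e - 1)).prod (thetaGr r M j e)
  d := (-(M.d ∘ₗ LinearMap.fst _ _ _)).prod
    (etaMap r M ∘ₗ LinearMap.fst _ _ _ + thetaMap r M M.d ∘ₗ LinearMap.snd _ _ _)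
  d_d x := by
    refine Prod.ext ?_ ?_
    · simp [M.d_d]
    · simp [thetaMap_etaMap, thetaMap_comp_eq_zero r M M.d M.d_d]
  d_right p x := by
    refine Prod.ext ?_ ?_
    · simp [M.d_right]
    · change etaMap r M (M.right p x.1) + thetaMap r M M.d (thetaMap r M (M.right p) x.2) =
        thetaMap r M (M.right p) (etaMap r M x.1 + thetaMap r M M.d x.2)
      rw [map_add, thetaMap_etaMap, thetaMap_comm r M M.d (M.right p) (M.d_right p)]
  d_mem := by
    rintro j e x ⟨h1, h2⟩
    refine ⟨Submodule.neg_mem _ (M.d_mem h1), Submodule.add_mem _ ?_ ?_⟩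
    · simpa using etaMap_mem r M h1
    · simpa using thetaMap_mem r M (k := 0) M.d (fun g y hy => by simpa using M.d_mem hy) h2
  smul_mem := by
    rintro j e f p x hp ⟨h1, h2⟩
    rw [add_sub_assoc]
    exact ⟨M.smul_mem hp h1, theta_smul_mem r M hp h2⟩
  right_mem := by
    rintro j e f p x hp ⟨h1, h2⟩
    rw [add_sub_assoc]
    exact ⟨M.right_mem hp h1, thetaMap_mem r M (M.right p) (fun g y hy => M.right_mem hp hy) h2⟩

end Theta

/-- The complex of graded bimodules `F_{i_1}^{±1} ⊗_P ⋯ ⊗_P F_{i_k}^{±1}` of a braid word. -/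
def F {m : ℕ} : Word m → BimodComplex m
  | [] => one m
  | (r, true) :: w => tensorPos r (F w)
  | (r, false) :: w => tensorNeg r (F w)

/-! ## Hochschild homology -/

section Hochschild

variable {m : ℕ} (M : BimodComplex m)

/-- The underlying module of the Koszul complex `P ⊗_{P^en} C ⊗ M`, where `C` is the Koszul
resolution of `P` by free graded `P^en`-modules, i.e. of `M ⊗ Λ(V^*)`. The function `f` stands for
`∑_I f(I) e_I`. -/
abbrev Kos : Type := Finset (Fin m) → M.carrier

/-- The action of `α_k ⊗ 1 - 1 ⊗ α_k ∈ P^en`. -/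
def commOp (k : Fin m) : M.carrier →ₗ[P m] M.carrier :=
  LinearMap.lsmul (P m) M.carrier (α k) - M.right (α k)

/-- The Koszul differential; the coefficient at `e_I` is
`∑_{k ∉ I} (-1)^{#{l ∈ I, l < k}} (α_k ⊗ 1 - 1 ⊗ α_k) f(I ∪ {k})`. -/
def kosDiff : Kos M →ₗ[P m] Kos M :=
  LinearMap.pi fun I => ∑ k ∈ Iᶜ,
    ((-1 : ℤ) ^ (I.filter (· < k)).card) • (commOp M k ∘ₗ LinearMap.proj (insert k I))

/-- The differential of the complex `M`, extended to its Koszul complex. -/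
def extDiff : Kos M →ₗ[P m] Kos M := LinearMap.pi fun I => M.d ∘ₗ LinearMap.proj I

/-- The part of Koszul degree `i`, cohomological degree `j` and internal degree `e`; each `e_I`
has internal degree `#I`. -/
def kosGr (i : ℕ) (j e : ℤ) : Submodule ℂ (Kos M) :=
  Submodule.pi Set.univ fun I => if I.card = i then M.gr j (e - i) else ⊥

/-- The Koszul cycles. -/
def hhCycles (i : ℕ) (j e : ℤ) : Submodule ℂ (Kos M) :=
  kosGr M i j e ⊓ LinearMap.ker ((kosDiff M).restrictScalars ℂ)

/-- The Koszul boundaries. -/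
def hhBoundaries (i : ℕ) (j e : ℤ) : Submodule ℂ (Kos M) :=
  (kosGr M (i + 1) j e).map ((kosDiff M).restrictScalars ℂ)

/-- `HH_i(M^j)_e = Tor_i^{P^en}(P, M^j)_e`, the degree `e` part of the `i`-th Hochschild homology
of the term of cohomological degree `j` of `M`. -/
abbrev HH (i : ℕ) (j e : ℤ) : Type :=
  hhCycles M i j e ⧸ (hhBoundaries M i j e).submoduleOf (hhCycles M i j e)

theorem extDiff_kosDiff (f : Kos M) : extDiff M (kosDiff M f) = kosDiff M (extDiff M f) := by
  funext I
  simp [extDiff, kosDiff, commOp, M.d_right]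

theorem extDiff_mem {i : ℕ} {j j' e : ℤ} (h : j + 1 = j') {f : Kos M} (hf : f ∈ kosGr M i j e) :
    extDiff M f ∈ kosGr M i j' e := by
  subst h
  intro I _
  have := hf I trivial
  rw [SetLike.mem_coe] at this ⊢
  dsimp only at this ⊢
  change M.d (f I) ∈ _
  split_ifs at this ⊢
  · exact M.d_mem this
  · rw [Submodule.mem_bot] at this ⊢
    rw [this, map_zero]

/-- The map `HH_i(M^j)_e → HH_i(M^{j+1})_e` induced by the differential of `M`. -/
def hhDiff (i : ℕ) (e : ℤ) {j j' : ℤ} (h : j + 1 = j') : HH M i j e →ₗ[ℂ] HH M i j' e :=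
  Submodule.mapQ _ _
    (((extDiff M).restrictScalars ℂ).restrict (p := hhCycles M i j e) (q := hhCycles M i j' e)
      fun f hf => ⟨extDiff_mem M h hf.1, by
        have h1 : kosDiff M f = 0 := hf.2
        change kosDiff M (extDiff M f) = 0
        rw [← extDiff_kosDiff, h1, map_zero]⟩)
    (by
      rintro f ⟨g, hg, hgf⟩
      exact ⟨extDiff M g, extDiff_mem M h hg,
        (extDiff_kosDiff M g).symm.trans (congrArg (extDiff M) hgf)⟩)

/-- `H^j(HH_i(M))_e`. -/
abbrev HHH (i : ℕ) (j e : ℤ) : Type :=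
  LinearMap.ker (hhDiff M i e (rfl : j + 1 = j + 1)) ⧸
    (LinearMap.range (hhDiff M i e (sub_add_cancel j 1))).submoduleOf
      (LinearMap.ker (hhDiff M i e (rfl : j + 1 = j + 1)))

end Hochschild

/-! ## The invariants -/

/-- `dim H^j(HH_i(F_w))_e`. -/
def dimH {m : ℕ} (w : Word m) (i : ℕ) (j e : ℤ) : ℕ := Module.finrank ℂ (HHH (F w) i j e)

theorem thetaGr_eq_bot {m : ℕ} (r : Fin m) (M : BimodComplex m) {c : ℤ}
    (h : ∀ j e, e < c → M.gr j e = ⊥) {j e : ℤ} (he : e < c) : thetaGr r M j e = ⊥ := by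
  rw [thetaGr, Submodule.span_eq_bot]
  rintro z ⟨f, g, a, x, hfg, ha, hx, rfl⟩
  by_cases hf : 0 ≤ f
  · rw [h j g (by omega), Submodule.mem_bot] at hx
    rw [hx, TensorProduct.tmul_zero]
  · rw [Pgr, if_neg hf, Submodule.mem_bot] at ha
    rw [ha, TensorProduct.zero_tmul]

theorem gr_eq_bot {m : ℕ} (w : Word m) :
    ∀ j e : ℤ, e < -(w.length : ℤ) → (F w).gr j e = ⊥ := by
  induction w with
  | nil =>
    intro j e he
    have : ¬ 0 ≤ e := by simpa using he
    change (if j = 0 then Pgr m e else ⊥) = ⊥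
    rw [Pgr, if_neg this, ite_self]
  | cons a w ih =>
    obtain ⟨r, b⟩ := a
    intro j e he
    rw [List.length_cons] at he
    push_cast at he
    cases b with
    | true =>
      change (thetaGr r (F w) j (e + 1)).prod ((F w).gr (j - 1) (e + 1)) = ⊥
      rw [thetaGr_eq_bot r (F w) ih (by omega), ih _ _ (by omega), Submodule.prod_bot]
    | false =>
      change ((F w).gr (j + 1) (e - 1)).prod (thetaGr r (F w) j e) = ⊥
      rw [thetaGr_eq_bot r (F w) ih (by omega), ih _ _ (by omega), Submodule.prod_bot]

theorem dimH_eq_zero {m : ℕ} (w : Word m) (i : ℕ) (j e : ℤ) (he : e < -(w.length : ℤ)) :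
    dimH w i j e = 0 := by
  have h0 : kosGr (F w) i j e = ⊥ := by
    rw [Submodule.eq_bot_iff]
    intro f hf
    funext I
    have := hf I trivial
    rw [SetLike.mem_coe] at this
    dsimp only at this
    rw [gr_eq_bot w j _ (by omega), ite_self, Submodule.mem_bot] at this
    exact this
  have h1 : Subsingleton (hhCycles (F w) i j e) := by
    rw [hhCycles, h0, bot_inf_eq]
    infer_instance
  have h2 : Subsingleton (HH (F w) i j e) := inferInstance
  have h3 : Subsingleton (HHH (F w) i j e) := inferInstance
  exact Module.finrank_zero_of_subsingleton

/-- The coefficient semiring `ℕ[t_2^{±1/2}, t_3^{±1/2}]`. -/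
abbrev Coeff : Type := ℕ[T;T⁻¹][T;T⁻¹]

/-- The monomial `t_2^{a/2} t_3^{b/2}`. -/
def mono (a b : ℤ) : Coeff := LaurentPolynomial.C (LaurentPolynomial.T a) * LaurentPolynomial.T b

/-- The Hilbert series `∑_e dim H^j(HH_i(F_w))_e t_1^e`, as a Laurent series in `t_1^{1/2}`. -/
def hilb {m : ℕ} (w : Word m) (i : ℕ) (j : ℤ) : LaurentSeries Coeff :=
  HahnSeries.ofSuppBddBelow (fun a : ℤ => if Even a then (dimH w i j (a / 2) : Coeff) else 0)
    ⟨-2 * w.length, by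
      intro a ha
      by_contra h
      apply ha
      beta_reduce
      split_ifs with hev
      · rw [dimH_eq_zero w i j _ (by omega), Nat.cast_zero]
      · rfl⟩

/-- The series `X_b`, computed from a word `w` representing the braid `b ∈ B_{m+1}`:
`(t_2 t_3⁻¹)^{(m + l(b))/2} ∑_{e,i,j} dim H^j(HH_i(F_w))_e t_1^e t_2^{-i} t_3^j`, with
`HH_i = Tor_i`. It is a Laurent series in `t_1^{1/2}` over `ℕ[t_2^{±1/2}, t_3^{±1/2}]`. -/
def X {m : ℕ} (w : Word m) : LaurentSeries Coeff :=
  HahnSeries.C (mono (m + len w) (-(m + len w))) *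
    ∑ᶠ p : ℕ × ℤ, HahnSeries.C (mono (-2 * p.1) (2 * p.2)) * hilb w p.1 p.2

/-- The ring `ℤ[√-1][t_2^{±1/2}]((t_1^{1/2}))`. -/
abbrev R : Type := LaurentSeries GaussianInt[T;T⁻¹]

/-- `√-1`. -/
def I : GaussianInt := ⟨0, 1⟩

/-- `√-1` as a unit of `ℤ[√-1][t_2^{±1/2}]`. -/
def unitI : GaussianInt[T;T⁻¹]ˣ where
  val := LaurentPolynomial.C I
  inv := LaurentPolynomial.C (-I)
  val_inv := by rw [← map_mul, ← map_one LaurentPolynomial.C]; rfl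
  inv_val := by rw [← map_mul, ← map_one LaurentPolynomial.C]; rfl

/-- The specialization `t_2^{1/2} ↦ t_2^{1/2}`, `t_3^{1/2} ↦ √-1` of the coefficients. -/
def spec : Coeff →+* GaussianInt[T;T⁻¹] :=
  LaurentPolynomial.eval₂
    (LaurentPolynomial.eval₂ (Nat.castRingHom _) (LaurentPolynomial.isUnit_T 1).unit) unitI

/-- `X_w` specialized at `t_3^{1/2} = √-1`. -/
def Yword {m : ℕ} (w : Word m) : R := (X w).map spec

/-- A word representing a given braid. -/
def wordOf {m : ℕ} (b : Braid m) : Word m :=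
  (Classical.choose (PresentedGroup.mk_surjective (braidRels m) b)).toWord

theorem braidOf_wordOf {m : ℕ} (b : Braid m) : braidOf (wordOf b) = b := by
  rw [braidOf, wordOf, FreeGroup.mk_toWord]
  exact Classical.choose_spec (PresentedGroup.mk_surjective (braidRels m) b)

/-- `Y_b`, for `b ∈ B_{m+1}`. -/
def Y {m : ℕ} (b : Braid m) : R := Yword (wordOf b)

/-- `t_1^{a/2}`. -/
def t₁half (a : ℤ) : R := HahnSeries.single a 1

/-- `t_2^{a/2}`. -/
def t₂half (a : ℤ) : R := HahnSeries.C (LaurentPolynomial.T a)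

/-- `√-1`. -/
def iR : R := HahnSeries.C (LaurentPolynomial.C I)

/-! ## The HOMFLYPT polynomial -/

/-- The ring `ℤ[l^{±1}, z^{±1}]`. -/
abbrev HRing : Type := ℤ[T;T⁻¹][T;T⁻¹]

/-- `l^a`. -/
def lPow (a : ℤ) : HRing := LaurentPolynomial.C (LaurentPolynomial.T a)

/-- `z`. -/
def zVar : HRing := LaurentPolynomial.T 1

/-- A family of functions on the braid groups `B_{m+1}`, `m ≥ 0`, defines an invariant of
oriented links (by closing braids) when it is unchanged under the Markov moves. -/
structure IsLinkInvariant {A : Type} (Q : (m : ℕ) → Braid m → A) : Prop where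
  conj : ∀ m (b b' : Braid m), Q m (b * b') = Q m (b' * b)
  stab_pos : ∀ m (b : Braid m), Q (m + 1) (ι m b * σ (Fin.last m)) = Q m b
  stab_neg : ∀ m (b : Braid m), Q (m + 1) (ι m b * (σ (Fin.last m))⁻¹) = Q m b

/-- The HOMFLYPT polynomial of closed braids: the `ℤ[l^{±1}, z^{±1}]`-valued invariant of oriented
links that equals `1` on the unknot and satisfies the skein relation
`l Q(L₊) + l⁻¹ Q(L₋) + z Q(L₀) = 0`. -/
structure IsHOMFLYPT (Q : (m : ℕ) → Braid m → HRing) : Prop where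
  inv : IsLinkInvariant Q
  unknot : Q 0 1 = 1
  skein : ∀ m (r : Fin m) (b b' : Braid m),
    lPow 1 * Q m (b * σ r * b') + lPow (-1) * Q m (b * (σ r)⁻¹ * b') + zVar * Q m (b * b') = 0

end KR

end

/-! At `t_3^{1/2} = √-1` one has `t_3 = -1`, so the sum over `j` becomes an Euler characteristic,
and the cohomology of the complex `HH_i(F_w)` may be replaced by its terms. Each term of `F_w` is,
up to isomorphism, a direct sum of shifts of Bott-Samelson bimodules `θ_{r_1} ⊗ ⋯ ⊗ θ_{r_k}`. With
`bs v` the Hilbert series of the Hochschild homology of the bimodule of the word `v`, and `c = -√-1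
t_2^{1/2}` the value of `(t_2/t_3)^{1/2}`, the series `Y_w` is `c^m` times what `bs` gives on the
noncommutative polynomial obtained from `w` by `σ_r ↦ c t_1⁻¹ (θ_r - 1)` and `σ_r⁻¹ ↦ c⁻¹ (θ_r -
t_1)`. No homotopy equivalence between complexes `F_w` of different words is needed; everything
follows from properties of `bs`.

The functional `bs` is a trace, `HH(M ⊗ N) = HH(N ⊗ M)` (`bs_append_comm`). The isomorphisms `θ_s
θ_s = θ_s ⊕ θ_s⟨-1⟩`, `θ_s θ_t = θ_t θ_s` for distant reflections, and `θ_s θ_t θ_s ⊕ θ_t⟨-1⟩ = θ_t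
θ_s θ_t ⊕ θ_s⟨-1⟩` for adjacent ones give the Hecke relations under the trace (`bs_sq`, `bs_comm`,
`bs_braid`). In the quotient of the free algebra by the radical of the trace the relations hold as
identities, so the braid group maps to its units. Hence `Y` depends only on the braid and is
invariant under conjugation, and the skein relation is linear algebra in `θ_r` and `1`.

For stabilization (`bs_castSucc`), a word in the first `m` reflections is viewed over one more
variable. The last fundamental weight then acts centrally, so one Koszul operator becomes redundant.
If `g = bs v / (1 - t_1)`, the word gives `(1 + t_2⁻¹ t_1) g` and the word with `θ_{m+1}` added
gives `(1 + t_2⁻¹ t_1²) g`; both Markov stabilizations follow.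

Hochschild homology is computed by iterated mapping cones of the commutators with the simple roots
(`OpComplex.K`). They may be permuted and altered by multiples of one another, and they respect
deformation retracts that commute strictly with the operators.

For the HOMFLYPT polynomial, the key is `isLinkInvariant_eq_zero`: a module-valued Markov invariant
that satisfies a skein relation with unit coefficients and vanishes on the unknot is zero, because
in a quotient with the quadratic relation the images of `B_{m+2}` are spanned by those of `B_{m+1}`
and `B_{m+1} σ_{m+1} B_{m+1}`. Applied to a difference it gives uniqueness. Applied to `Y` modulo
the image of `ℤ[l^{±1}, z^{±1}]` it shows that `Y` lies in that image; as the specialization is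
injective (`specH_injective`), existence follows as well. -/

noncomputable section

namespace KR

/-! ## Complexes with operators -/

/-- A bigraded complex of vector spaces with a family of operators; the first grading is the
homological one. -/
structure OpComplex (J : Type) where
  V : Type
  [acg : AddCommGroup V]
  [mod : Module ℂ V]
  gr : ℤ → ℤ → Submodule ℂ V
  d : V →ₗ[ℂ] V
  op : J → V →ₗ[ℂ] V

attribute [instance] OpComplex.acg OpComplex.mod

namespace OpComplex

variable {J J' : Type}

/-- Cycles of bidegree `(i, e)`. -/
def cycles (C : OpComplex J) (i e : ℤ) : Submodule ℂ C.V := C.gr i e ⊓ LinearMap.ker C.d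

/-- Boundaries of bidegree `(i, e)`. -/
def boundaries (C : OpComplex J) (i e : ℤ) : Submodule ℂ C.V := (C.gr (i + 1) e).map C.d

/-- Homology in bidegree `(i, e)`. -/
abbrev Homology (C : OpComplex J) (i e : ℤ) : Type :=
  C.cycles i e ⧸ (C.boundaries i e).submoduleOf (C.cycles i e)

/-- The dimension of the homology in bidegree `(i, e)`. -/
def hd (C : OpComplex J) (i e : ℤ) : ℕ := Module.finrank ℂ (C.Homology i e)

/-- The graded pieces have finite dimension. -/
def LocFin (C : OpComplex J) : Prop := ∀ i e, FiniteDimensional ℂ (C.gr i e)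

/-- A deformation retract compatible with the operators. -/
structure Retr (C D : OpComplex J) where
  φ : C.V →ₗ[ℂ] D.V
  ψ : D.V →ₗ[ℂ] C.V
  h : C.V →ₗ[ℂ] C.V
  φ_mem : ∀ {i e x}, x ∈ C.gr i e → φ x ∈ D.gr i e
  ψ_mem : ∀ {i e x}, x ∈ D.gr i e → ψ x ∈ C.gr i e
  h_mem : ∀ {i e x}, x ∈ C.gr i e → h x ∈ C.gr (i + 1) e
  φ_d : ∀ x, φ (C.d x) = D.d (φ x)
  ψ_d : ∀ x, ψ (D.d x) = C.d (ψ x)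
  φ_ψ : ∀ x, φ (ψ x) = x
  ψ_φ : ∀ x, ψ (φ x) = x + C.d (h x) + h (C.d x)
  φ_op : ∀ j x, φ (C.op j x) = D.op j (φ x)
  ψ_op : ∀ j x, ψ (D.op j x) = C.op j (ψ x)
  h_op : ∀ j x, h (C.op j x) = C.op j (h x)

/-- An isomorphism, as a deformation retract. -/
def Retr.ofEquiv {C D : OpComplex J} (Φ : C.V ≃ₗ[ℂ] D.V)
    (mem : ∀ {i e x}, x ∈ C.gr i e → Φ x ∈ D.gr i e)
    (mem' : ∀ {i e x}, x ∈ D.gr i e → Φ.symm x ∈ C.gr i e)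
    (hd : ∀ x, Φ (C.d x) = D.d (Φ x)) (hop : ∀ j x, Φ (C.op j x) = D.op j (Φ x)) :
    Retr C D where
  φ := Φ
  ψ := Φ.symm
  h := 0
  φ_mem := mem
  ψ_mem := mem'
  h_mem _ := Submodule.zero_mem _
  φ_d := hd
  ψ_d x := by
    apply Φ.injective
    change Φ (Φ.symm _) = Φ (C.d (Φ.symm x))
    rw [hd, Φ.apply_symm_apply, Φ.apply_symm_apply]
  φ_ψ := Φ.apply_symm_apply
  ψ_φ x := by simp
  φ_op := hop
  ψ_op j x := by
    apply Φ.injective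
    change Φ (Φ.symm _) = Φ (C.op j (Φ.symm x))
    rw [hop, Φ.apply_symm_apply, Φ.apply_symm_apply]
  h_op := by simp

theorem Retr.mem_cycles {C D : OpComplex J} (r : Retr C D) {i e : ℤ} {x : C.V}
    (hx : x ∈ C.cycles i e) : r.φ x ∈ D.cycles i e :=
  ⟨r.φ_mem hx.1, by
    have h : C.d x = 0 := hx.2
    change D.d (r.φ x) = 0
    rw [← r.φ_d, h, map_zero]⟩

theorem Retr.mem_cycles' {C D : OpComplex J} (r : Retr C D) {i e : ℤ} {x : D.V}
    (hx : x ∈ D.cycles i e) : r.ψ x ∈ C.cycles i e :=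
  ⟨r.ψ_mem hx.1, by
    have h : D.d x = 0 := hx.2
    change C.d (r.ψ x) = 0
    rw [← r.ψ_d, h, map_zero]⟩

/-- The identity `d² = 0` is never needed: homology is the quotient of the cycles by the boundaries
that are cycles, and the homotopy formula alone shows that `φ` is bijective on it. -/
theorem Retr.hd_eq {C D : OpComplex J} (r : Retr C D) (i e : ℤ) : C.hd i e = D.hd i e := by
  let f : C.Homology i e →ₗ[ℂ] D.Homology i e :=
    Submodule.mapQ _ _ (r.φ.restrict (p := C.cycles i e) (q := D.cycles i e)
      fun x hx => r.mem_cycles hx) (by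
        rintro x ⟨y, hy, hyx⟩
        exact ⟨r.φ y, r.φ_mem hy, (r.φ_d y).symm.trans (congrArg r.φ hyx)⟩)
  refine LinearEquiv.finrank_eq (LinearEquiv.ofBijective f ⟨?_, ?_⟩)
  · rw [← LinearMap.ker_eq_bot, Submodule.eq_bot_iff]
    intro z hz
    induction z using Submodule.Quotient.induction_on with
    | H z =>
      obtain ⟨y, hy, hyz⟩ := (Submodule.Quotient.mk_eq_zero _).1 (LinearMap.mem_ker.1 hz)
      refine (Submodule.Quotient.mk_eq_zero _).2 ⟨r.ψ y - r.h z, ?_, ?_⟩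
      · exact Submodule.sub_mem _ (r.ψ_mem hy) (r.h_mem z.2.1)
      · have h1 : D.d y = r.φ z := hyz
        have h2 : C.d z = 0 := z.2.2
        -- For a cycle `z` with `φ z = d y`, the homotopy formula reads `d (ψ y) = z + d (h z)`, so
        -- `z` bounds `ψ y - h z`.
        have h3 := r.ψ_φ z
        rw [h2, map_zero, add_zero, ← h1, r.ψ_d] at h3
        change C.d (r.ψ y - r.h z) = z
        rw [map_sub, h3, add_sub_cancel_right]
  · intro z
    induction z using Submodule.Quotient.induction_on with
    | H z =>
      refine ⟨Submodule.Quotient.mk ⟨r.ψ z, r.mem_cycles' z.2⟩, ?_⟩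
      refine congrArg Submodule.Quotient.mk (Subtype.ext ?_)
      exact r.φ_ψ z

/-- The cone of an endomorphism of internal degree `k`. -/
abbrev cone (k : ℤ) (C : OpComplex J) (f : C.V →ₗ[ℂ] C.V) : OpComplex J where
  V := C.V × C.V
  gr i e := (C.gr i e).prod (C.gr (i - 1) (e - k))
  d := (C.d ∘ₗ LinearMap.fst _ _ _ + f ∘ₗ LinearMap.snd _ _ _).prod (-(C.d ∘ₗ LinearMap.snd _ _ _))
  op j := (C.op j).prodMap (C.op j)


end OpComplex
end KR

/-! ### Iterated cones: invariance, sums and shifts -/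

namespace KR
namespace OpComplex

variable {J J' : Type}

theorem finiteDimensional_prod {V W : Type} [AddCommGroup V] [Module ℂ V] [AddCommGroup W]
    [Module ℂ W] (p : Submodule ℂ V) (q : Submodule ℂ W) [hp : FiniteDimensional ℂ p]
    [hq : FiniteDimensional ℂ q] : FiniteDimensional ℂ (p.prod q) :=
  Module.Finite.iff_fg.2 ((Module.Finite.iff_fg.1 hp).prod (Module.Finite.iff_fg.1 hq))

theorem LocFin.cone {C : OpComplex J} (hC : C.LocFin) (k : ℤ) (f : C.V →ₗ[ℂ] C.V) :
    (cone k C f).LocFin := fun i e =>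
  finiteDimensional_prod (hp := hC i e) (hq := hC (i - 1) (e - k))

/-- Cones preserve deformation retracts. -/
def Retr.cone {C D : OpComplex J} (r : Retr C D) (k : ℤ) (f : C.V →ₗ[ℂ] C.V)
    (g : D.V →ₗ[ℂ] D.V) (hφ : ∀ x, r.φ (f x) = g (r.φ x)) (hψ : ∀ x, r.ψ (g x) = f (r.ψ x))
    (hh : ∀ x, r.h (f x) = f (r.h x)) : Retr (cone k C f) (cone k D g) where
  φ := r.φ.prodMap r.φ
  ψ := r.ψ.prodMap r.ψ
  h := r.h.prodMap (-r.h)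
  φ_mem hx := ⟨r.φ_mem hx.1, r.φ_mem hx.2⟩
  ψ_mem hx := ⟨r.ψ_mem hx.1, r.ψ_mem hx.2⟩
  h_mem {i e x} hx := ⟨r.h_mem hx.1, Submodule.neg_mem _ (by
    have := r.h_mem hx.2
    rwa [sub_add_cancel, ← add_sub_cancel_right i 1] at this)⟩
  φ_d x := by ext <;> simp [r.φ_d, hφ]
  ψ_d x := by ext <;> simp [r.ψ_d, hψ]
  φ_ψ x := by ext <;> simp [r.φ_ψ]
  ψ_φ x := by
    ext
    · simp [r.ψ_φ x.1, hh]; abel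
    · simp [r.ψ_φ x.2]
  φ_op j x := by ext <;> simp [r.φ_op]
  ψ_op j x := by ext <;> simp [r.ψ_op]
  h_op j x := by ext <;> simp [r.h_op]

/-- The iterated cone of a list of operators of degree one. -/
def K : List J → OpComplex J → OpComplex J
  | [], C => C
  | j :: L, C => K L (cone 1 C (C.op j))

theorem K_cons (j : J) (L : List J) (C : OpComplex J) :
    K (j :: L) C = K L (cone 1 C (C.op j)) := rfl

/-- Iterated cones preserve deformation retracts. -/
def Retr.K {C D : OpComplex J} (r : Retr C D) : (L : List J) → Retr (K L C) (K L D)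
  | [] => r
  | j :: L => Retr.K (r.cone 1 (C.op j) (D.op j) (r.φ_op j) (r.ψ_op j) (r.h_op j)) L

theorem Retr.hd_K {C D : OpComplex J} (r : Retr C D) (L : List J) : (OpComplex.K L C).hd = (OpComplex.K L D).hd :=
  funext fun i => funext fun e => (r.K L).hd_eq i e

/-- Two cones may be taken in either order. -/
def coneSwap (C : OpComplex J) (k l : ℤ) (f g : C.V →ₗ[ℂ] C.V) :
    Retr (cone k (cone l C f) (g.prodMap g)) (cone l (cone k C g) (f.prodMap f)) :=
  Retr.ofEquiv
    -- The sign on the last coordinate makes up for the sign `-d` in the second half of a cone.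
    { toFun := fun x => ((x.1.1, x.2.1), (x.1.2, -x.2.2))
      invFun := fun x => ((x.1.1, x.2.1), (x.1.2, -x.2.2))
      map_add' := fun x y => by ext <;> simp [add_comm]
      map_smul' := fun c x => by ext <;> simp
      left_inv := fun x => by simp
      right_inv := fun x => by simp }
    (fun {i e x} hx => ⟨⟨hx.1.1, hx.2.1⟩, hx.1.2, Submodule.neg_mem _ (by
      have := hx.2.2; rwa [sub_right_comm e k l] at this)⟩)
    (fun {i e x} hx => ⟨⟨hx.1.1, hx.2.1⟩, hx.1.2, Submodule.neg_mem _ (by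
      have := hx.2.2; rwa [sub_right_comm e l k] at this)⟩)
    (fun x => by ext <;> simp <;> abel)
    (fun j x => by ext <;> simp)

/-- Adjacent transpositions suffice, and these are `coneSwap`. -/
theorem hd_K_perm {L L' : List J} (h : L.Perm L') (C : OpComplex J) : (K L C).hd = (K L' C).hd := by
  induction h generalizing C with
  | nil => rfl
  | cons j _ ih => exact ih _
  | swap j k L => exact (coneSwap C 1 1 (C.op k) (C.op j)).hd_K L
  | trans _ _ ih ih' => exact (ih C).trans (ih' C)

/-- Adding a multiple of `b` to the operator of the first of two cones. -/
def coneAdd (C : OpComplex J) (k l : ℤ) (f g b : C.V →ₗ[ℂ] C.V)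
    (hg : ∀ i e x, x ∈ C.gr i e → g x ∈ C.gr i (e + k - l)) (hgd : ∀ x, g (C.d x) = C.d (g x))
    (hgo : ∀ j x, g (C.op j x) = C.op j (g x)) (hgb : ∀ x, g (b x) = b (g x)) :
    Retr (cone l (cone k C f) (b.prodMap b)) (cone l (cone k C (f + g ∘ₗ b)) (b.prodMap b)) :=
  have mem : ∀ {i e y}, y ∈ C.gr (i - 1) (e - k) → g y ∈ C.gr (i - 1) (e - l) :=
    fun {i e y} hy => by
      have := hg _ _ _ hy
      rwa [sub_add_cancel] at this
  Retr.ofEquiv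
    -- A shear: applying `b` to the correction `-g x.1.2` cancels the extra summand `g ∘ b` of the
    -- differential.
    { toFun := fun x => (x.1, (x.2.1 - g x.1.2, x.2.2))
      invFun := fun x => (x.1, (x.2.1 + g x.1.2, x.2.2))
      map_add' := fun x y => by ext <;> simp; abel
      map_smul' := fun c x => by ext <;> simp [smul_sub]
      left_inv := fun x => by simp
      right_inv := fun x => by simp }
    (fun {i e x} hx => ⟨hx.1, Submodule.sub_mem _ hx.2.1 (mem hx.1.2), hx.2.2⟩)
    (fun {i e x} hx => ⟨hx.1, Submodule.add_mem _ hx.2.1 (mem hx.1.2), hx.2.2⟩)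
    (fun x => by
      ext
      · simp [hgb]; abel
      · simp
      · simp [hgd, hgb]; abel
      · simp)
    (fun j x => by ext <;> simp [hgo])

/-- Multiples of `C.op v` do not matter once the cone of `v` is also taken: that cone is permuted to
the front and `coneAdd` applies. -/
theorem hd_K_cone_add {L : List J} {v : J} (hv : v ∈ L) (C : OpComplex J) (k : ℤ)
    (f g : C.V →ₗ[ℂ] C.V)
    (hg : ∀ i e x, x ∈ C.gr i e → g x ∈ C.gr i (e + k - 1)) (hgd : ∀ x, g (C.d x) = C.d (g x))
    (hgo : ∀ j x, g (C.op j x) = C.op j (g x)) :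
    (K L (cone k C (f + g ∘ₗ C.op v))).hd = (K L (cone k C f)).hd := by
  obtain ⟨L', hL⟩ : ∃ L', L.Perm (v :: L') := by
    classical exact ⟨_, List.perm_cons_erase hv⟩
  rw [hd_K_perm hL, hd_K_perm hL, K_cons, K_cons]
  exact ((coneAdd C k 1 f g (C.op v) hg hgd hgo (hgo v)).hd_K L').symm

theorem hd_K_cone_add_smul {L : List J} {v : J} (hv : v ∈ L) (C : OpComplex J)
    (f : C.V →ₗ[ℂ] C.V) (c : ℂ) :
    (K L (cone 1 C (f + c • C.op v))).hd = (K L (cone 1 C f)).hd := by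
  have e : c • C.op v = (c • LinearMap.id) ∘ₗ C.op v := by ext; simp
  rw [e]
  refine hd_K_cone_add hv C 1 f (c • LinearMap.id) ?_ (by simp) (by simp)
  intro i e x hx
  rw [add_sub_cancel_right]
  exact Submodule.smul_mem _ _ hx

/-- Adding multiples of the operators of `L` to the operator of a cone. -/
theorem hd_K_cone_add_sum {L : List J} {ι : Type} (s : Finset ι) (C : OpComplex J) (k : ℤ)
    (v : ι → J) (g : ι → C.V →ₗ[ℂ] C.V) (hv : ∀ n ∈ s, v n ∈ L) (f : C.V →ₗ[ℂ] C.V)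
    (hg : ∀ n i e x, x ∈ C.gr i e → g n x ∈ C.gr i (e + k - 1))
    (hgd : ∀ n x, g n (C.d x) = C.d (g n x))
    (hgo : ∀ n j x, g n (C.op j x) = C.op j (g n x)) :
    (K L (cone k C (f + ∑ n ∈ s, g n ∘ₗ C.op (v n)))).hd = (K L (cone k C f)).hd := by
  classical
  induction s using Finset.induction_on with
  | empty => rw [Finset.sum_empty, add_zero]
  | insert a s ha ih =>
    rw [Finset.sum_insert ha, add_comm (g a ∘ₗ _), ← add_assoc,
      hd_K_cone_add (hv a (Finset.mem_insert_self _ _)) C k _ _ (hg a) (hgd a) (hgo a)]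
    exact ih fun n hn => hv n (Finset.mem_insert_of_mem hn)

/-- In an iterated cone, operators may be changed by multiples of an operator occurring in it. -/
theorem hd_K_cons_map {ι : Type} (L : List ι) (u : J) (f g : ι → J) (C : OpComplex J) (c : ι → ℂ)
    (h : ∀ n ∈ L, C.op (g n) = C.op (f n) + c n • C.op u) :
    (K (u :: L.map f) C).hd = (K (u :: L.map g) C).hd := by
  induction L generalizing C with
  | nil => rfl
  | cons n L ih =>
    rw [List.map_cons, List.map_cons, hd_K_perm (List.Perm.swap _ _ _)]
    have h1 := ih (cone 1 C (C.op (f n))) (fun a ha => by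
      have := h a (List.mem_cons_of_mem _ ha)
      refine LinearMap.ext fun x => ?_
      simp [this])
    refine Eq.trans h1 ?_
    rw [hd_K_perm (List.Perm.swap (g n) u (L.map g)),
      ← hd_K_cone_add_smul (List.mem_cons_self (a := u)) C (C.op (f n)) (c n),
      ← h n (List.mem_cons_self)]
    rfl

/-- Restriction of the family of operators. -/
abbrev res (C : OpComplex J) (f : J' → J) : OpComplex J' where
  V := C.V
  gr := C.gr
  d := C.d
  op j := C.op (f j)

/-- Restricting the family of operators allows a retract to be compatible with only some of them, as
for `Bim.thetaRetr`. -/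
theorem K_res (C : OpComplex J) (f : J' → J) (L : List J') :
    K L (C.res f) = (K (L.map f) C).res f := by
  induction L generalizing C with
  | nil => rfl
  | cons j L ih => exact ih (cone 1 C (C.op (f j)))

theorem hd_K_map (C : OpComplex J) (f : J' → J) (L : List J') :
    (K (L.map f) C).hd = (K L (C.res f)).hd :=
  (congrArg hd (K_res C f L)).symm

/-- Direct sums. -/
abbrev sum (C D : OpComplex J) : OpComplex J where
  V := C.V × D.V
  gr i e := (C.gr i e).prod (D.gr i e)
  d := C.d.prodMap D.d
  op j := (C.op j).prodMap (D.op j)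

theorem hd_sum {C D : OpComplex J} (hC : C.LocFin) (hD : D.LocFin) :
    (sum C D).hd = C.hd + D.hd := by
  funext i e
  have := hC i e
  have := hD i e
  have f1 : FiniteDimensional ℂ (C.cycles i e) := Submodule.finiteDimensional_inf_left _ _
  have f2 : FiniteDimensional ℂ (D.cycles i e) := Submodule.finiteDimensional_inf_left _ _
  have m1 : ∀ {x : C.V × D.V}, x ∈ (sum C D).cycles i e →
      x.1 ∈ C.cycles i e ∧ x.2 ∈ D.cycles i e := fun {x} hx =>
    ⟨⟨hx.1.1, congrArg Prod.fst hx.2⟩, ⟨hx.1.2, congrArg Prod.snd hx.2⟩⟩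
  let f : (sum C D).cycles i e →ₗ[ℂ] C.Homology i e × D.Homology i e :=
    (Submodule.mkQ _ ∘ₗ (LinearMap.fst ℂ C.V D.V).restrict fun x hx => (m1 hx).1).prod
      (Submodule.mkQ _ ∘ₗ (LinearMap.snd ℂ C.V D.V).restrict fun x hx => (m1 hx).2)
  have hsurj : Function.Surjective f := by
    rintro ⟨x, y⟩
    induction x using Submodule.Quotient.induction_on with
    | H x =>
    induction y using Submodule.Quotient.induction_on with
    | H y =>
      exact ⟨⟨(x.1, y.1), ⟨x.2.1, y.2.1⟩, Prod.ext x.2.2 y.2.2⟩, rfl⟩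
  have hker : LinearMap.ker f = ((sum C D).boundaries i e).submoduleOf ((sum C D).cycles i e) := by
    ext ⟨x, hx⟩
    constructor
    · intro h
      obtain ⟨y, hy, hy'⟩ := (Submodule.Quotient.mk_eq_zero _).1 (congrArg Prod.fst h)
      obtain ⟨z, hz, hz'⟩ := (Submodule.Quotient.mk_eq_zero _).1 (congrArg Prod.snd h)
      exact ⟨(y, z), ⟨hy, hz⟩, Prod.ext hy' hz'⟩
    · rintro ⟨y, hy, hy'⟩
      refine Prod.ext ((Submodule.Quotient.mk_eq_zero _).2 ⟨y.1, hy.1, ?_⟩)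
        ((Submodule.Quotient.mk_eq_zero _).2 ⟨y.2, hy.2, ?_⟩)
      · exact congrArg Prod.fst hy'
      · exact congrArg Prod.snd hy'
  rw [hd, Pi.add_apply, Pi.add_apply, hd, hd, ← Module.finrank_prod]
  exact LinearEquiv.finrank_eq
    ((Submodule.quotEquivOfEq _ _ hker.symm).trans (f.quotKerEquivOfSurjective hsurj))

/-- Cones commute with direct sums. -/
def coneSum (C D : OpComplex J) (k : ℤ) (f : C.V →ₗ[ℂ] C.V) (g : D.V →ₗ[ℂ] D.V) :
    Retr (cone k (sum C D) (f.prodMap g)) (sum (cone k C f) (cone k D g)) :=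
  Retr.ofEquiv (LinearEquiv.prodProdProdComm ℂ C.V D.V C.V D.V)
    (fun hx => ⟨⟨hx.1.1, hx.2.1⟩, hx.1.2, hx.2.2⟩)
    (fun hx => ⟨⟨hx.1.1, hx.2.1⟩, hx.1.2, hx.2.2⟩)
    (fun x => by ext <;> simp)
    (fun j x => by ext <;> simp)

theorem hd_K_sum {C D : OpComplex J} (hC : C.LocFin) (hD : D.LocFin) (L : List J) :
    (K L (sum C D)).hd = (K L C).hd + (K L D).hd := by
  induction L generalizing C D with
  | nil => exact hd_sum hC hD
  | cons j L ih =>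
    exact ((coneSum C D 1 (C.op j) (D.op j)).hd_K L).trans (ih (hC.cone 1 _) (hD.cone 1 _))

/-- The shift of bidegree `(a, b)`, with the opposite differential. -/
abbrev shift (a b : ℤ) (C : OpComplex J) : OpComplex J where
  V := C.V
  gr i e := C.gr (i - a) (e - b)
  d := -C.d
  op := C.op

theorem LocFin.shift {C : OpComplex J} (hC : C.LocFin) (a b : ℤ) : (shift a b C).LocFin :=
  fun _ _ => hC _ _

theorem finrank_quotient_congr {V : Type} [AddCommGroup V] [Module ℂ V] {p p' q q' : Submodule ℂ V}
    (hp : p = p') (hq : q = q') :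
    Module.finrank ℂ (p ⧸ q.submoduleOf p) = Module.finrank ℂ (p' ⧸ q'.submoduleOf p') := by
  subst hp hq; rfl

theorem hd_shift (a b : ℤ) (C : OpComplex J) (i e : ℤ) :
    (shift a b C).hd i e = C.hd (i - a) (e - b) := by
  have h1 : (shift a b C).cycles i e = C.cycles (i - a) (e - b) := by
    ext x; simp [cycles]
  have h2 : (shift a b C).boundaries i e = C.boundaries (i - a) (e - b) := by
    ext x
    simp only [boundaries, add_sub_right_comm, Submodule.mem_map]
    constructor
    · rintro ⟨y, hy, rfl⟩; exact ⟨-y, Submodule.neg_mem _ hy, by simp⟩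
    · rintro ⟨y, hy, rfl⟩; exact ⟨-y, Submodule.neg_mem _ hy, by simp⟩
  exact finrank_quotient_congr h1 h2

/-- Cones commute with shifts. -/
def coneShift (a b k : ℤ) (C : OpComplex J) (f : C.V →ₗ[ℂ] C.V) :
    Retr (cone k (shift a b C) f) (shift a b (cone k C f)) :=
  Retr.ofEquiv ((LinearEquiv.refl ℂ C.V).prodCongr (LinearEquiv.neg ℂ))
    (fun {i e x} hx => ⟨hx.1, Submodule.neg_mem _ (by
      have h : x.2 ∈ C.gr (i - 1 - a) (e - k - b) := hx.2
      rwa [sub_right_comm i 1 a, sub_right_comm e k b] at h)⟩)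
    (fun {i e x} hx => ⟨hx.1, by
      have h : -x.2 ∈ C.gr (i - a - 1) (e - b - k) := Submodule.neg_mem _ hx.2
      rwa [sub_right_comm i a 1, sub_right_comm e b k] at h⟩)
    (fun x => by ext <;> simp; abel)
    (fun j x => by ext <;> simp)

theorem hd_K_shift (a b : ℤ) (C : OpComplex J) (L : List J) (i e : ℤ) :
    (K L (shift a b C)).hd i e = (K L C).hd (i - a) (e - b) := by
  induction L generalizing C with
  | nil => exact hd_shift a b C i e
  | cons j L ih =>
    rw [K, K, ← ih]
    exact congrFun (congrFun ((coneShift a b 1 C (C.op j)).hd_K L) i) e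

/-- The cone of zero is the direct sum of the complex and its shift. This is how all splittings of
Hochschild homology arise below. -/
theorem hd_K_cone_zero {C : OpComplex J} (hC : C.LocFin) (k : ℤ) (L : List J) (i e : ℤ) :
    (K L (cone k C 0)).hd i e = (K L C).hd i e + (K L C).hd (i - 1) (e - k) := by
  rw [← hd_K_shift 1 k C L, ← Pi.add_apply, ← Pi.add_apply, ← hd_K_sum hC (hC.shift 1 k)]
  refine congrFun (congrFun (Retr.hd_K (Retr.ofEquiv (LinearEquiv.refl ℂ (C.V × C.V))
    (fun hx => hx) (fun hx => hx) (fun x => ?_) (fun j x => rfl)) L) i) e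
  ext <;> simp

/-- The same complex with the opposite operators. -/
abbrev neg (C : OpComplex J) : OpComplex J where
  V := C.V
  gr := C.gr
  d := C.d
  op j := -C.op j

/-- Changing the sign of the operators. -/
def coneNeg (C : OpComplex J) (k : ℤ) (f : C.V →ₗ[ℂ] C.V) :
    Retr (cone k (neg C) (-f)) (neg (cone k C f)) :=
  Retr.ofEquiv ((LinearEquiv.refl ℂ C.V).prodCongr (LinearEquiv.neg ℂ))
    (fun hx => ⟨hx.1, Submodule.neg_mem _ hx.2⟩)
    (fun hx => ⟨hx.1, Submodule.neg_mem _ hx.2⟩)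
    (fun x => by ext <;> simp)
    (fun j x => by ext <;> simp)

/-- Exchanging left and right actions changes the sign of every commutator; this shows that the
dimensions do not notice. -/
theorem hd_K_neg (C : OpComplex J) (L : List J) : (K L (neg C)).hd = (K L C).hd := by
  induction L generalizing C with
  | nil => rfl
  | cons j L ih =>
    exact ((coneNeg C 1 (C.op j)).hd_K L).trans (ih _)

end OpComplex
end KR

namespace KR

/-! ## Graded bimodules over a symmetric algebra -/

/-- A graded bimodule over the symmetric algebra of `U`, given by the actions of `U`. -/
structure Bim (U : Type) [AddCommGroup U] [Module ℂ U] where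
  V : Type
  [acg : AddCommGroup V]
  [mod : Module ℂ V]
  gr : ℤ → Submodule ℂ V
  L : U →ₗ[ℂ] V →ₗ[ℂ] V
  R : U →ₗ[ℂ] V →ₗ[ℂ] V
  L_L : ∀ u v x, L u (L v x) = L v (L u x)
  R_R : ∀ u v x, R u (R v x) = R v (R u x)
  L_R : ∀ u v x, L u (R v x) = R v (L u x)
  L_mem : ∀ u {e x}, x ∈ gr e → L u x ∈ gr (e + 1)
  R_mem : ∀ u {e x}, x ∈ gr e → R u x ∈ gr (e + 1)
  fin : ∀ e, FiniteDimensional ℂ (gr e)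
  bdd : ∃ n, ∀ e < n, gr e = ⊥

attribute [instance] Bim.acg Bim.mod Bim.fin

/-- A reflection of `U`, given by a root and a coroot. -/
structure Root (U : Type) [AddCommGroup U] [Module ℂ U] where
  α : U
  c : U →ₗ[ℂ] ℂ
  hc : c α = 2

namespace Root

variable {U : Type} [AddCommGroup U] [Module ℂ U] (ρ : Root U)

/-- The projection to the invariants of the reflection, along the root. -/
def proj : U →ₗ[ℂ] U := LinearMap.id - (LinearMap.toSpanSingleton ℂ U ρ.α) ∘ₗ ((1 / 2 : ℂ) • ρ.c)

theorem proj_apply (u : U) : ρ.proj u = u - (ρ.c u / 2) • ρ.α := by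
  simp [proj, div_eq_inv_mul]

theorem proj_of_c_eq_zero {u : U} (h : ρ.c u = 0) : ρ.proj u = u := by
  simp [proj_apply, h]

theorem c_proj (u : U) : ρ.c (ρ.proj u) = 0 := by
  simp [proj_apply, ρ.hc]

theorem proj_α : ρ.proj ρ.α = 0 := by
  simp [proj_apply, ρ.hc]

end Root

namespace Bim

variable {U : Type} [AddCommGroup U] [Module ℂ U]

/-- Isomorphisms of graded bimodules. -/
structure Iso (M N : Bim U) where
  e : M.V ≃ₗ[ℂ] N.V
  mem : ∀ {k x}, x ∈ M.gr k → e x ∈ N.gr k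
  mem' : ∀ {k x}, x ∈ N.gr k → e.symm x ∈ M.gr k
  e_L : ∀ u x, e (M.L u x) = N.L u (e x)
  e_R : ∀ u x, e (M.R u x) = N.R u (e x)

/-- The identity. -/
def Iso.refl (M : Bim U) : Iso M M where
  e := LinearEquiv.refl ℂ _
  mem h := h
  mem' h := h
  e_L _ _ := rfl
  e_R _ _ := rfl

/-- Composition of isomorphisms. -/
def Iso.trans {M N Q : Bim U} (f : Iso M N) (g : Iso N Q) : Iso M Q where
  e := f.e.trans g.e
  mem h := g.mem (f.mem h)
  mem' h := f.mem' (g.mem' h)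
  e_L u x := by simp [f.e_L, g.e_L]
  e_R u x := by simp [f.e_R, g.e_R]

/-- The inverse isomorphism. -/
def Iso.symm {M N : Bim U} (f : Iso M N) : Iso N M where
  e := f.e.symm
  mem h := f.mem' h
  mem' h := f.mem h
  e_L u x := by rw [LinearEquiv.symm_apply_eq, f.e_L, f.e.apply_symm_apply]
  e_R u x := by rw [LinearEquiv.symm_apply_eq, f.e_R, f.e.apply_symm_apply]

/-- The internal shift `N⟨-b⟩`. -/
abbrev shift (b : ℤ) (N : Bim U) : Bim U where
  V := N.V
  gr e := N.gr (e - b)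
  L := N.L
  R := N.R
  L_L := N.L_L
  R_R := N.R_R
  L_R := N.L_R
  L_mem u e x h := by rw [add_sub_right_comm]; exact N.L_mem u h
  R_mem u e x h := by rw [add_sub_right_comm]; exact N.R_mem u h
  fin _ := N.fin _
  bdd := N.bdd.imp' (· + b) fun n hn e he => hn _ (by omega)

/-- The diagonal action on a direct sum. -/
def prodAct {V W : Type} [AddCommGroup V] [Module ℂ V] [AddCommGroup W] [Module ℂ W]
    (f : U →ₗ[ℂ] V →ₗ[ℂ] V) (g : U →ₗ[ℂ] W →ₗ[ℂ] W) : U →ₗ[ℂ] V × W →ₗ[ℂ] V × W :=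
  LinearMap.mk₂ ℂ (fun u z => (f u z.1, g u z.2)) (by simp) (by simp) (by simp) (by simp)

@[simp] theorem prodAct_apply {V W : Type} [AddCommGroup V] [Module ℂ V] [AddCommGroup W]
    [Module ℂ W] (f : U →ₗ[ℂ] V →ₗ[ℂ] V) (g : U →ₗ[ℂ] W →ₗ[ℂ] W) (u : U) (z : V × W) :
    prodAct f g u z = (f u z.1, g u z.2) := rfl

/-- Direct sums. -/
abbrev sum (M N : Bim U) : Bim U where
  V := M.V × N.V
  gr e := (M.gr e).prod (N.gr e)
  L := prodAct M.L N.L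
  R := prodAct M.R N.R
  L_L u v x := Prod.ext (M.L_L u v x.1) (N.L_L u v x.2)
  R_R u v x := Prod.ext (M.R_R u v x.1) (N.R_R u v x.2)
  L_R u v x := Prod.ext (M.L_R u v x.1) (N.L_R u v x.2)
  L_mem u _ _ h := ⟨M.L_mem u h.1, N.L_mem u h.2⟩
  R_mem u _ _ h := ⟨M.R_mem u h.1, N.R_mem u h.2⟩
  fin e := OpComplex.finiteDimensional_prod _ _
  bdd := by
    obtain ⟨a, ha⟩ := M.bdd
    obtain ⟨b, hb⟩ := N.bdd
    exact ⟨min a b, fun e he => by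
      rw [ha e (by omega), hb e (by omega), Submodule.prod_bot]⟩

/-- The bimodule with left and right actions exchanged. -/
abbrev op (N : Bim U) : Bim U where
  V := N.V
  gr := N.gr
  L := N.R
  R := N.L
  L_L := N.R_R
  R_R := N.L_L
  L_R u v x := (N.L_R v u x).symm
  L_mem := N.R_mem
  R_mem := N.L_mem
  fin := N.fin
  bdd := N.bdd

section thetaL

variable {V : Type} [AddCommGroup V] [Module ℂ V] (ρ : Root U) (f : U →ₗ[ℂ] V →ₗ[ℂ] V)

/-- The left action on `S ⊗_{S^s} V`, where `(x, y)` stands for `1 ⊗ x + α ⊗ y`. -/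
def thetaL : U →ₗ[ℂ] V × V →ₗ[ℂ] V × V :=
  LinearMap.mk₂ ℂ (fun u z =>
      (f (ρ.proj u) z.1 + (ρ.c u / 2) • f ρ.α (f ρ.α z.2),
        f (ρ.proj u) z.2 + (ρ.c u / 2) • z.1))
    (fun u v z => by ext <;> simp [add_div, add_smul] <;> abel)
    (fun c u z => by ext <;> simp [mul_div_assoc, mul_smul])
    (fun u z z' => by ext <;> simp <;> abel)
    (fun c u z => by ext <;> simp [smul_comm _ c])

@[simp] theorem thetaL_apply (u : U) (z : V × V) :
    thetaL ρ f u z = (f (ρ.proj u) z.1 + (ρ.c u / 2) • f ρ.α (f ρ.α z.2),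
        f (ρ.proj u) z.2 + (ρ.c u / 2) • z.1) := rfl

theorem thetaL_of_c_eq_zero {u : U} (hu : ρ.c u = 0) (z : V × V) :
    thetaL ρ f u z = (f u z.1, f u z.2) := by
  simp [hu, ρ.proj_of_c_eq_zero hu]

theorem thetaL_α (z : V × V) : thetaL ρ f ρ.α z = (f ρ.α (f ρ.α z.2), z.1) := by
  simp [ρ.hc, ρ.proj_α]

end thetaL

/-- The bimodule `S ⊗_{S^s} N`, for the symmetric algebra `S` of `U` and a reflection `s`; the pair
`(x, y)` stands for `1 ⊗ x + α ⊗ y`. -/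
abbrev theta (ρ : Root U) (N : Bim U) : Bim U where
  V := N.V × N.V
  gr e := (N.gr e).prod (N.gr (e - 1))
  L := thetaL ρ N.L
  R := prodAct N.R N.R
  L_L u v z := by
    ext <;> simp [N.L_L (ρ.proj v) ρ.α, N.L_L (ρ.proj u) ρ.α, N.L_L (ρ.proj u) (ρ.proj v)] <;> module
  R_R u v x := Prod.ext (N.R_R u v x.1) (N.R_R u v x.2)
  L_R u v z := by ext <;> simp [N.L_R]
  L_mem u {e x} h := by
    refine ⟨Submodule.add_mem _ (N.L_mem _ h.1) (Submodule.smul_mem _ _ ?_),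
      Submodule.add_mem _ ?_ (Submodule.smul_mem _ _ ?_)⟩
    · have := N.L_mem ρ.α (N.L_mem ρ.α h.2)
      rwa [sub_add_cancel] at this
    · rw [add_sub_right_comm]; exact N.L_mem _ h.2
    · rw [add_sub_cancel_right]; exact h.1
  R_mem u {e x} h := ⟨N.R_mem u h.1, by rw [add_sub_right_comm]; exact N.R_mem u h.2⟩
  fin e := OpComplex.finiteDimensional_prod _ _
  bdd := N.bdd.imp fun n hn e he => by
    rw [hn e he, hn _ (by omega), Submodule.prod_bot]

/-- `theta` is functorial. -/
def Iso.theta {M N : Bim U} (f : Iso M N) (ρ : Root U) : Iso (theta ρ M) (theta ρ N) where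
  e := f.e.prodCongr f.e
  mem h := ⟨f.mem h.1, f.mem h.2⟩
  mem' h := ⟨f.mem' h.1, f.mem' h.2⟩
  e_L u x := by ext <;> simp [f.e_L]
  e_R u x := by ext <;> simp [f.e_R]

/-- `theta` commutes with direct sums. -/
def thetaSum (ρ : Root U) (M N : Bim U) :
    Iso (Bim.theta ρ (sum M N)) (sum (Bim.theta ρ M) (Bim.theta ρ N)) where
  e := LinearEquiv.prodProdProdComm ℂ M.V N.V M.V N.V
  mem h := ⟨⟨h.1.1, h.2.1⟩, h.1.2, h.2.2⟩
  mem' h := ⟨⟨h.1.1, h.2.1⟩, h.1.2, h.2.2⟩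
  e_L u x := by ext <;> simp
  e_R u x := by ext <;> simp

/-- `theta` commutes with shifts. -/
def thetaShift (ρ : Root U) (b : ℤ) (N : Bim U) :
    Iso (Bim.theta ρ (shift b N)) (shift b (Bim.theta ρ N)) where
  e := LinearEquiv.refl ℂ _
  mem {k x} h := ⟨h.1, by
    have h2 : x.2 ∈ N.gr (k - 1 - b) := h.2
    rwa [sub_right_comm k 1 b] at h2⟩
  mem' {k x} h := ⟨h.1, by
    have h2 : x.2 ∈ N.gr (k - b - 1) := h.2
    rwa [sub_right_comm k b 1] at h2⟩
  e_L u x := rfl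
  e_R u x := rfl

/-- The bimodule as a complex, with the commutators as operators. -/
abbrev toCx (N : Bim U) : OpComplex U where
  V := N.V
  gr i e := if i = 0 then N.gr e else ⊥
  d := 0
  op u := N.L u - N.R u

theorem toCx_locFin (N : Bim U) : N.toCx.LocFin := fun i e => by
  by_cases h : i = 0
  · rw [show N.toCx.gr i e = N.gr e from if_pos h]; exact N.fin e
  · rw [show N.toCx.gr i e = ⊥ from if_neg h]; infer_instance

/-- Isomorphisms of bimodules give isomorphisms of complexes. -/
def Iso.toCx {M N : Bim U} (f : Iso M N) : OpComplex.Retr M.toCx N.toCx :=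
  OpComplex.Retr.ofEquiv f.e
    (fun {i e x} h => by
      dsimp only at h ⊢
      split_ifs at h ⊢
      · exact f.mem h
      · rw [Submodule.mem_bot] at h ⊢; rw [h, map_zero])
    (fun {i e x} h => by
      dsimp only at h ⊢
      split_ifs at h ⊢
      · exact f.mem' h
      · rw [Submodule.mem_bot] at h ⊢; rw [h, map_zero])
    (by simp) (fun j x => by simp [f.e_L, f.e_R])

open OpComplex

theorem hd_K_op (N : Bim U) (l : List U) : (K l N.op.toCx).hd = (K l N.toCx).hd := by
  rw [← hd_K_neg N.toCx]
  exact Retr.hd_K (Retr.ofEquiv (LinearEquiv.refl ℂ N.V) (fun h => h) (fun h => h)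
    (by simp) (fun j x => by simp)) l

theorem hd_K_sum (M N : Bim U) (l : List U) :
    (K l (sum M N).toCx).hd = (K l M.toCx).hd + (K l N.toCx).hd := by
  rw [← OpComplex.hd_K_sum M.toCx_locFin N.toCx_locFin]
  refine Retr.hd_K (Retr.ofEquiv (LinearEquiv.refl ℂ (M.V × N.V)) (fun {i e x} h => ?_)
    (fun {i e x} h => ?_) (fun x => by ext <;> simp) (fun j x => by ext <;> simp)) l
  · change _ ∈ (if i = 0 then M.gr e else ⊥).prod (if i = 0 then N.gr e else ⊥)
    dsimp only at h
    split_ifs at h ⊢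
    · exact h
    · rwa [Submodule.prod_bot]
  · change _ ∈ if i = 0 then (M.gr e).prod (N.gr e) else ⊥
    have h' : x ∈ (if i = 0 then M.gr e else ⊥).prod (if i = 0 then N.gr e else ⊥) := h
    split_ifs at h' ⊢
    · exact h'
    · rwa [Submodule.prod_bot] at h'

theorem hd_K_shift (b : ℤ) (N : Bim U) (l : List U) (i e : ℤ) :
    (K l (shift b N).toCx).hd i e = (K l N.toCx).hd i (e - b) := by
  rw [← sub_zero i, ← OpComplex.hd_K_shift 0 b, sub_zero]
  refine congrFun (congrFun (Retr.hd_K (Retr.ofEquiv (LinearEquiv.refl ℂ N.V) (fun {i e x} h => ?_)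
    (fun {i e x} h => ?_) (by simp) (fun j x => rfl)) l) i) e
  · simpa using h
  · simpa using h

/-- The cone of `α ⊗ 1 - 1 ⊗ α` on `S ⊗_{S^s} N` retracts to that of `α² ⊗ 1 - 1 ⊗ α²` on `N`. -/
def thetaRetr (ρ : Root U) (N : Bim U) :
    Retr (cone 1 ((theta ρ N).toCx.res (Subtype.val : {u // ρ.c u = 0} → U))
        ((theta ρ N).toCx.op ρ.α))
      (cone 2 (N.toCx.res (Subtype.val : {u // ρ.c u = 0} → U))
        (N.L ρ.α ∘ₗ N.L ρ.α - N.R ρ.α ∘ₗ N.R ρ.α)) where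
  -- Gaussian elimination. On `((x, y), (x', y'))` the differential produces `(α² y' - x' α, x' - y'
  -- α)` from `(x', y')`, so `x'` cancels against `y`. What survives is `x + y α` and `y'`, and on
  -- `(y' α, y')` the differential is `α² y' - y' α²`.
  φ := (LinearMap.fst _ _ _ ∘ₗ LinearMap.fst _ _ _ +
    N.R ρ.α ∘ₗ LinearMap.snd _ _ _ ∘ₗ LinearMap.fst _ _ _).prod
      (LinearMap.snd _ _ _ ∘ₗ LinearMap.snd _ _ _)
  ψ := ((LinearMap.fst _ _ _).prod 0).prod
    ((N.R ρ.α ∘ₗ LinearMap.snd _ _ _).prod (LinearMap.snd _ _ _))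
  h := LinearMap.prod 0 ((-(LinearMap.snd _ _ _ ∘ₗ LinearMap.fst _ _ _)).prod 0)
  φ_mem {i e x} h := by
    obtain ⟨h1, h2⟩ := h
    dsimp only at h1 h2
    refine ⟨?_, ?_⟩
    · dsimp only
      split_ifs at h1 ⊢
      · have := N.R_mem ρ.α h1.2
        rw [sub_add_cancel] at this
        exact Submodule.add_mem _ h1.1 this
      · rw [SetLike.mem_coe, Submodule.mem_bot] at h1 ⊢
        simp [h1]
    · dsimp only
      split_ifs at h2 ⊢
      · rw [show e - 2 = e - 1 - 1 by ring]
        exact h2.2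
      · rw [SetLike.mem_coe, Submodule.mem_bot] at h2 ⊢
        simp [h2]
  ψ_mem {i e x} h := by
    obtain ⟨h1, h2⟩ := h
    dsimp only at h1 h2
    refine ⟨?_, ?_⟩
    · dsimp only
      split_ifs at h1 ⊢
      · exact ⟨h1, Submodule.zero_mem _⟩
      · rw [SetLike.mem_coe, Submodule.mem_bot] at h1 ⊢
        simp [h1]
    · dsimp only
      split_ifs at h2 ⊢
      · rw [show e - 2 = e - 1 - 1 by ring] at h2
        have := N.R_mem ρ.α h2
        rw [sub_add_cancel] at this
        exact ⟨this, h2⟩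
      · rw [SetLike.mem_coe, Submodule.mem_bot] at h2 ⊢
        simp [h2]
  h_mem {i e x} h := by
    obtain ⟨h1, h2⟩ := h
    dsimp only at h1 h2
    refine ⟨Submodule.zero_mem _, ?_⟩
    dsimp only
    rw [add_sub_cancel_right]
    split_ifs at h1 ⊢
    · exact ⟨Submodule.neg_mem _ h1.2, Submodule.zero_mem _⟩
    · rw [SetLike.mem_coe, Submodule.mem_bot] at h1 ⊢
      simp [h1]
  φ_d x := by
    ext
    · simp [ρ.hc, ρ.proj_α]
    · simp
  ψ_d x := by
    ext <;> simp [ρ.hc, ρ.proj_α]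
  φ_ψ x := by ext <;> simp
  ψ_φ x := by ext <;> simp [ρ.hc, ρ.proj_α]
  φ_op j x := by
    ext
    · simp [ρ.proj_of_c_eq_zero j.2, j.2, N.L_R, N.R_R ρ.α]; abel
    · simp [ρ.proj_of_c_eq_zero j.2, j.2]
  ψ_op j x := by
    ext <;> simp [ρ.proj_of_c_eq_zero j.2, j.2, N.L_R, N.R_R ρ.α]
  h_op j x := by
    ext <;> simp [ρ.proj_of_c_eq_zero j.2, j.2]
    abel

/-- In the presence of `α`, the other vectors may be replaced by their projections along `α`. These
are invariant under the reflection, hence act coordinatewise on `S ⊗_{S^s} N`, and `thetaRetr`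
applies. -/
theorem hd_K_theta (ρ : Root U) (N : Bim U) (l : List U) :
    (K (ρ.α :: l) (theta ρ N).toCx).hd =
      (K (l.map ρ.proj) (cone 2 N.toCx (N.L ρ.α ∘ₗ N.L ρ.α - N.R ρ.α ∘ₗ N.R ρ.α))).hd := by
  let p : U → {u // ρ.c u = 0} := fun u => ⟨ρ.proj u, ρ.c_proj u⟩
  have h1 := hd_K_cons_map l ρ.α id ρ.proj (theta ρ N).toCx (fun u => -(ρ.c u / 2))
    (fun u _ => by rw [ρ.proj_apply]; simp only [map_sub, map_smul, id]; module)
  rw [List.map_id] at h1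
  have h2 : l.map ρ.proj = (l.map p).map Subtype.val := by simp [p]
  rw [h1, h2, K_cons, hd_K_map _ _ (l.map p), hd_K_map _ _ (l.map p)]
  exact (thetaRetr ρ N).hd_K (l.map p)

/-- The bimodule `N ⊗_{S^s} S`. -/
abbrev thetaR (ρ : Root U) (N : Bim U) : Bim U := (theta ρ N.op).op

/-- The source of the trace property. By `hd_K_theta` the homology of `S ⊗_{S^s} N` is a cone of `α²
⊗ 1 - 1 ⊗ α²` on `N`, a description symmetric in left and right up to sign. -/
theorem hd_K_thetaR (ρ : Root U) (N : Bim U) (l : List U) :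
    (K (ρ.α :: l) (thetaR ρ N).toCx).hd = (K (ρ.α :: l) (theta ρ N).toCx).hd := by
  rw [hd_K_op, hd_K_theta, hd_K_theta, ← hd_K_neg (cone 2 N.toCx _)]
  rw [← (coneNeg N.toCx 2 _).hd_K]
  refine (Retr.cone (Retr.ofEquiv (C := N.op.toCx) (D := N.toCx.neg) (LinearEquiv.refl ℂ N.V)
    (fun h => h) (fun h => h) (by simp) (fun j x => by simp)) 2 _ _ ?_ ?_ ?_).hd_K _
  · intro x; simp [Retr.ofEquiv]
  · intro x; simp [Retr.ofEquiv]
  · intro x; simp [Retr.ofEquiv]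

/-- `theta` commutes with `thetaR`. -/
def thetaThetaR (ρ τ : Root U) (N : Bim U) :
    Iso (theta ρ (thetaR τ N)) (thetaR τ (theta ρ N)) where
  e := LinearEquiv.prodProdProdComm ℂ N.V N.V N.V N.V
  mem h := ⟨⟨h.1.1, h.2.1⟩, h.1.2, h.2.2⟩
  mem' h := ⟨⟨h.1.1, h.2.1⟩, h.1.2, h.2.2⟩
  e_L u x := by ext <;> simp
  e_R u x := by ext <;> simp

end Bim
end KR

/-! ### Bimodule isomorphisms behind the Hecke relations -/

namespace KR
namespace Bim

variable {U : Type} [AddCommGroup U] [Module ℂ U]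

/-- `θ_s θ_s = θ_s ⊕ θ_s⟨-1⟩`. -/
def thetaTheta (ρ : Root U) (N : Bim U) :
    Iso (theta ρ (theta ρ N)) (sum (theta ρ N) (shift 1 (theta ρ N))) where
  -- In `S ⊗_{S^s} S ⊗_{S^s} N` the middle factor splits as `S^s ⊕ α S^s`; exchanging the two inner
  -- coordinates brings this splitting to the outside.
  e := LinearEquiv.prodProdProdComm ℂ N.V N.V N.V N.V
  mem h := ⟨⟨h.1.1, h.2.1⟩, h.1.2, h.2.2⟩
  mem' h := ⟨⟨h.1.1, h.2.1⟩, h.1.2, h.2.2⟩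
  e_L u x := by ext <;> simp [ρ.hc, ρ.proj_α, ρ.c_proj, ρ.proj_of_c_eq_zero]
  e_R u x := by ext <;> simp

/-- `θ_s θ_t = θ_t θ_s` for commuting reflections. -/
def thetaComm (ρ τ : Root U) (h : ρ.c τ.α = 0) (h' : τ.c ρ.α = 0) (N : Bim U) :
    Iso (theta ρ (theta τ N)) (theta τ (theta ρ N)) where
  e := LinearEquiv.prodProdProdComm ℂ N.V N.V N.V N.V
  mem h := ⟨⟨h.1.1, h.2.1⟩, h.1.2, h.2.2⟩
  mem' h := ⟨⟨h.1.1, h.2.1⟩, h.1.2, h.2.2⟩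
  e_L u x := by
    have h1 : τ.proj (ρ.proj u) = ρ.proj (τ.proj u) := by
      simp only [Root.proj_apply, map_sub, map_smul, h, h']; module
    have h2 : τ.c (ρ.proj u) = τ.c u := by simp [Root.proj_apply, h']
    have h3 : ρ.c (τ.proj u) = ρ.c u := by simp [Root.proj_apply, h]
    have h4 : τ.proj ρ.α = ρ.α := τ.proj_of_c_eq_zero h'
    have h5 : ρ.proj τ.α = τ.α := ρ.proj_of_c_eq_zero h
    ext <;> simp [h, h', h1, h2, h3, h4, h5] <;> module
  e_R u x := by ext <;> simp

section Braid

variable (ρ τ : Root U) (N : Bim U)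

/-- The map `θ_s θ_t θ_s ⊕ θ_t⟨-1⟩ → θ_t θ_s θ_t ⊕ θ_s⟨-1⟩`. -/
def braidMap : (sum (theta ρ (theta τ (theta ρ N))) (shift 1 (theta τ N))).V →ₗ[ℂ]
    (sum (theta τ (theta ρ (theta τ N))) (shift 1 (theta ρ N))).V :=
  -- In `x.1.a.b.c` the projections `a, b, c` are `1` or `2` according as the outer, middle and
  -- inner tensor factor is `1` or the root. The motive for the isomorphism is that both sides are
  -- sums of the bimodule induced from the invariants of the two reflections, of `θ_s⟨-1⟩` and of
  -- `θ_t⟨-1⟩`; an explicit formula avoids treating the first of these.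
  let A := N.L ρ.α
  let B := N.L τ.α
  { toFun := fun x =>
      ((((x.1.1.1.1 + (3/4 : ℂ) • B x.1.1.1.2 + (1/2 : ℂ) • A x.1.1.1.2 - (5/8 : ℂ) • B x.1.1.2.1
        - (1/4 : ℂ) • A x.1.1.2.1 + (3/4 : ℂ) • B (B x.1.1.2.2) + (5/8 : ℂ) • A (B x.1.1.2.2)
        + (1/4 : ℂ) • A (A x.1.1.2.2) + (1/8 : ℂ) • B x.1.2.1.1 + (1/4 : ℂ) • A x.1.2.1.1
        + (3/8 : ℂ) • A (B x.1.2.1.2) + (1/4 : ℂ) • A (A x.1.2.1.2) - (1/8 : ℂ) • B (B x.1.2.2.1)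
        - (1/8 : ℂ) • A (B x.1.2.2.1) + (1/8 : ℂ) • A (B (B x.1.2.2.2))
        + (1/8 : ℂ) • A (A (B x.1.2.2.2)) + (1/2 : ℂ) • B x.2.1 + A x.2.1,
        (1/4 : ℂ) • x.1.1.1.2 + (1/8 : ℂ) • x.1.1.2.1 + (1/4 : ℂ) • B x.1.1.2.2
        + (3/8 : ℂ) • A x.1.1.2.2 + (3/8 : ℂ) • x.1.2.1.1 - (3/8 : ℂ) • A x.1.2.1.2
        - (3/8 : ℂ) • B x.1.2.2.1 - (3/8 : ℂ) • A x.1.2.2.1 - (1/8 : ℂ) • A (B x.1.2.2.2)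
        - (1/8 : ℂ) • A (A x.1.2.2.2) - (1/2 : ℂ) • x.2.1),
        ((1/2 : ℂ) • x.1.1.1.2 + (1/4 : ℂ) • x.1.1.2.1 - (1/4 : ℂ) • A x.1.1.2.2
        + (3/4 : ℂ) • x.1.2.1.1 + (3/4 : ℂ) • B x.1.2.1.2 + (3/4 : ℂ) • A x.1.2.1.2
        - (3/8 : ℂ) • B x.1.2.2.1 + (1/4 : ℂ) • B (B x.1.2.2.2) + (3/8 : ℂ) • A (B x.1.2.2.2)
        + x.2.1,
        (3/4 : ℂ) • x.1.2.1.2 - (1/2 : ℂ) • x.1.1.2.2 + (3/8 : ℂ) • x.1.2.2.1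
        + (1/4 : ℂ) • B x.1.2.2.2 + (1/8 : ℂ) • A x.1.2.2.2)),
        ((x.1.1.1.2 + (1/2 : ℂ) • x.1.1.2.1 + (1/2 : ℂ) • B x.1.1.2.2 + (1/2 : ℂ) • A x.1.1.2.2
        - (1/2 : ℂ) • x.1.2.1.1 - (1/4 : ℂ) • B x.1.2.1.2 + (3/8 : ℂ) • B x.1.2.2.1
        + (1/4 : ℂ) • A x.1.2.2.1 + (1/4 : ℂ) • B (B x.1.2.2.2) + (5/8 : ℂ) • A (B x.1.2.2.2)
        + (3/4 : ℂ) • A (A x.1.2.2.2) + (1/2 : ℂ) • B x.2.2 + A x.2.2,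
        (1/2 : ℂ) • x.1.1.2.2 + (1/4 : ℂ) • x.1.2.1.2 + (1/8 : ℂ) • x.1.2.2.1
        - (1/4 : ℂ) • B x.1.2.2.2 - (5/8 : ℂ) • A x.1.2.2.2 - (1/2 : ℂ) • x.2.2),
        (x.1.1.2.2 + (1/2 : ℂ) • x.1.2.1.2 + (1/4 : ℂ) • x.1.2.2.1 + (1/2 : ℂ) • B x.1.2.2.2
        + (3/4 : ℂ) • A x.1.2.2.2 + x.2.2,
        x.1.2.2.2))),
        ((1/2 : ℂ) • x.1.1.2.1 - x.1.1.1.2 - B x.1.1.2.2 - (1/2 : ℂ) • A x.1.1.2.2,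
        (1/2 : ℂ) • x.1.2.2.1 - x.1.2.1.2 - B x.1.2.2.2 - (1/2 : ℂ) • A x.1.2.2.2))
    map_add' := fun x y => by
      ext <;> simp only [Prod.fst_add, Prod.snd_add, map_add] <;> module
    map_smul' := fun c x => by
      ext <;> simp only [Prod.smul_fst, Prod.smul_snd, map_smul, RingHom.id_apply] <;> module }

/-- The formula is chosen so that exchanging the two roots gives the inverse map. Only the
commutation of the two root actions on `N` enters, not the Cartan integers. -/
theorem braidMap_braidMap (x) : braidMap τ ρ N (braidMap ρ τ N x) = x := by
  have h := N.L_L τ.α ρ.α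
  ext <;> simp only [braidMap, LinearMap.coe_mk, AddHom.coe_mk, map_add, map_sub, map_smul, h] <;>
    module

theorem braidMap_mem {k : ℤ} {x}
    (hx : x ∈ (sum (theta ρ (theta τ (theta ρ N))) (shift 1 (theta τ N))).gr k) :
    braidMap ρ τ N x ∈ (sum (theta τ (theta ρ (theta τ N))) (shift 1 (theta ρ N))).gr k := by
  obtain ⟨⟨⟨⟨h1, h2⟩, h3, h4⟩, ⟨h5, h6⟩, h7, h8⟩, h9, h10⟩ := hx
  have hL : ∀ {u k x}, x ∈ N.gr (k - 1) → N.L u x ∈ N.gr k := fun {u k x} h => by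
    have := N.L_mem u h
    rwa [sub_add_cancel] at this
  refine ⟨⟨⟨⟨?_, ?_⟩, ?_, ?_⟩, ⟨?_, ?_⟩, ?_, ?_⟩, ?_, ?_⟩ <;>
    simp only [braidMap, LinearMap.coe_mk, AddHom.coe_mk] <;>
    repeat' first
      | assumption
      | apply Submodule.add_mem
      | apply Submodule.sub_mem
      | apply Submodule.smul_mem
      | apply hL

variable {ρ τ}

theorem braidMap_R (u : U) (x) :
    braidMap ρ τ N ((sum (theta ρ (theta τ (theta ρ N))) (shift 1 (theta τ N))).R u x) =
      (sum (theta τ (theta ρ (theta τ N))) (shift 1 (theta ρ N))).R u (braidMap ρ τ N x) := by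
  have h := N.L_R ρ.α u
  have h' := N.L_R τ.α u
  ext <;> simp [braidMap, h, h']

/-- A vector invariant under both reflections acts coordinatewise on all the induced modules, and it
commutes with the two roots. -/
theorem braidMap_L_invariant {v : U} (h1 : ρ.c v = 0) (h2 : τ.c v = 0) (x) :
    braidMap ρ τ N ((sum (theta ρ (theta τ (theta ρ N))) (shift 1 (theta τ N))).L v x) =
      (sum (theta τ (theta ρ (theta τ N))) (shift 1 (theta ρ N))).L v (braidMap ρ τ N x) := by
  simp only [prodAct_apply, thetaL_of_c_eq_zero _ _ h1, thetaL_of_c_eq_zero _ _ h2]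
  ext <;> simp only [braidMap, LinearMap.coe_mk, AddHom.coe_mk, map_add, map_sub, map_smul,
    N.L_L ρ.α v, N.L_L τ.α v]

theorem thetaL_adjacent {V : Type} [AddCommGroup V] [Module ℂ V] (f : U →ₗ[ℂ] V →ₗ[ℂ] V)
    (hρ : ρ.c τ.α = -1) (z : V × V) : thetaL ρ f τ.α z =
      (f τ.α z.1 + (1 / 2 : ℂ) • f ρ.α z.1 - (1 / 2 : ℂ) • f ρ.α (f ρ.α z.2),
        f τ.α z.2 + (1 / 2 : ℂ) • f ρ.α z.2 - (1 / 2 : ℂ) • z.1) := by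
  have p1 : ρ.proj τ.α = τ.α + (1 / 2 : ℂ) • ρ.α := by rw [ρ.proj_apply, hρ]; module
  rw [thetaL_apply, p1, hρ]
  ext <;> simp only [map_add, map_smul, LinearMap.add_apply, LinearMap.smul_apply] <;> module

set_option maxHeartbeats 1000000 in
theorem braidMap_L_left (hρ : ρ.c τ.α = -1) (hτ : τ.c ρ.α = -1) (x) :
    braidMap ρ τ N ((sum (theta ρ (theta τ (theta ρ N))) (shift 1 (theta τ N))).L ρ.α x) =
      (sum (theta τ (theta ρ (theta τ N))) (shift 1 (theta ρ N))).L ρ.α (braidMap ρ τ N x) := by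
  have h := N.L_L τ.α ρ.α
  obtain ⟨⟨⟨⟨x1, x2⟩, x3, x4⟩, ⟨x5, x6⟩, x7, x8⟩, x9, x0⟩ := x
  simp only [prodAct_apply, thetaL_α, thetaL_adjacent _ hρ, thetaL_adjacent _ hτ, braidMap,
    LinearMap.coe_mk, AddHom.coe_mk, Prod.fst_add, Prod.snd_add, Prod.smul_fst, Prod.smul_snd,
    Prod.fst_sub, Prod.snd_sub, map_add, map_sub, map_smul, h]
  ext <;> simp only [Prod.fst_add, Prod.snd_add, Prod.smul_fst, Prod.smul_snd,
    Prod.fst_sub, Prod.snd_sub] <;> module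

/-- Follows from the case of the other root, since the inverse of the map has the same form with the
roots exchanged. -/
theorem braidMap_L_right (hρ : ρ.c τ.α = -1) (hτ : τ.c ρ.α = -1) (x) :
    braidMap ρ τ N ((sum (theta ρ (theta τ (theta ρ N))) (shift 1 (theta τ N))).L τ.α x) =
      (sum (theta τ (theta ρ (theta τ N))) (shift 1 (theta ρ N))).L τ.α (braidMap ρ τ N x) := by
  have h := braidMap_L_left (ρ := τ) (τ := ρ) N hτ hρ (braidMap ρ τ N x)
  rw [braidMap_braidMap] at h
  rw [← h, braidMap_braidMap]

theorem braidMap_L (hρ : ρ.c τ.α = -1) (hτ : τ.c ρ.α = -1) (u : U) (x) :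
    braidMap ρ τ N ((sum (theta ρ (theta τ (theta ρ N))) (shift 1 (theta τ N))).L u x) =
      (sum (theta τ (theta ρ (theta τ N))) (shift 1 (theta ρ N))).L u (braidMap ρ τ N x) := by
  -- Inverse of the Cartan matrix of type `A_2`: these coefficients make both coroots vanish on `u -
  -- a • ρ.α - b • τ.α`.
  set a : ℂ := (2 * ρ.c u + τ.c u) / 3 with ha
  set b : ℂ := (ρ.c u + 2 * τ.c u) / 3 with hb
  have hu : u = (u - a • ρ.α - b • τ.α) + a • ρ.α + b • τ.α := by module
  have k0 := braidMap_L_invariant N (ρ := ρ) (τ := τ) (v := u - a • ρ.α - b • τ.α)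
    (by simp only [map_sub, map_smul, ρ.hc, hρ, smul_eq_mul, ha, hb]; ring)
    (by simp only [map_sub, map_smul, τ.hc, hτ, smul_eq_mul, ha, hb]; ring) x
  rw [hu]
  generalize u - a • ρ.α - b • τ.α = v at k0 ⊢
  rw [map_add, map_add, map_smul, map_smul, map_add, map_add, map_smul, map_smul]
  simp only [LinearMap.add_apply, LinearMap.smul_apply]
  rw [map_add, map_add, map_smul, map_smul, k0, braidMap_L_left N hρ hτ, braidMap_L_right N hρ hτ]

/-- `θ_s θ_t θ_s ⊕ θ_t⟨-1⟩ = θ_t θ_s θ_t ⊕ θ_s⟨-1⟩`. -/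
def thetaBraid (hρ : ρ.c τ.α = -1) (hτ : τ.c ρ.α = -1) :
    Iso (sum (theta ρ (theta τ (theta ρ N))) (shift 1 (theta τ N)))
      (sum (theta τ (theta ρ (theta τ N))) (shift 1 (theta ρ N))) where
  e := LinearEquiv.ofLinearMap (braidMap ρ τ N) (braidMap τ ρ N)
    (LinearMap.ext fun x => braidMap_braidMap τ ρ N x)
    (LinearMap.ext fun x => braidMap_braidMap ρ τ N x)
  mem := braidMap_mem ρ τ N
  mem' := braidMap_mem τ ρ N
  e_L := braidMap_L N hρ hτ
  e_R := braidMap_R N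

end Braid

end Bim
end KR

namespace KR

/-! ## Homogeneous polynomials -/

theorem finiteDimensional_Pgr (m : ℕ) (e : ℤ) : FiniteDimensional ℂ (Pgr m e) := by
  by_cases h : 0 ≤ e
  · rw [Pgr, if_pos h]
    exact Module.Finite.iff_fg.2 (MvPolynomial.homogeneousSubmodule_fg (Fin m) ℂ _)
  · rw [Pgr, if_neg h]; infer_instance

theorem homogeneousComponent_mul_left {m : ℕ} {l : P m}
    (hl : l ∈ MvPolynomial.homogeneousSubmodule (Fin m) ℂ 1) (q : P m) (j : ℕ) :
    MvPolynomial.homogeneousComponent (1 + j) (l * q) =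
      l * MvPolynomial.homogeneousComponent j q := by
  let _ := MvPolynomial.gradedAlgebra (σ := Fin m) (R := ℂ)
  rw [← MvPolynomial.decomposition.decompose'_apply, ← MvPolynomial.decomposition.decompose'_apply]
  have h := DirectSum.coe_decompose_mul_add_of_left_mem
    (MvPolynomial.homogeneousSubmodule (Fin m) ℂ) (j := j) (b := q) hl
  exact h

/-- Multiplication by a linear form carries the component of degree `j` to that of degree `j + 1`,
injectively because `P` is a domain. -/
theorem mem_Pgr_of_mul_mem {m : ℕ} {l q : P m} {e : ℤ} (hl : l ∈ Pgr m 1) (h0 : l ≠ 0)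
    (h : l * q ∈ Pgr m e) : q ∈ Pgr m (e - 1) := by
  have hl' : l ∈ MvPolynomial.homogeneousSubmodule (Fin m) ℂ 1 := by
    rwa [Pgr, if_pos zero_le_one] at hl
  have h1 : ∀ j : ℕ, (1 + j : ℤ) ≠ e → MvPolynomial.homogeneousComponent j q = 0 := by
    intro j hj
    have h2 := homogeneousComponent_mul_left hl' q j
    have h3 : MvPolynomial.homogeneousComponent (1 + j) (l * q) = 0 := by
      rw [Pgr] at h
      split_ifs at h with he
      · rw [MvPolynomial.homogeneousComponent_of_mem h, if_neg (by omega)]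
      · rw [(Submodule.mem_bot ℂ).1 h, map_zero]
    rw [h3] at h2
    exact (mul_eq_zero.1 h2.symm).resolve_left h0
  have hq := MvPolynomial.sum_homogeneousComponent q
  rw [← hq]
  refine Submodule.sum_mem _ fun j _ => ?_
  by_cases hj : (1 + j : ℤ) = e
  · rw [Pgr, if_pos (by omega), show (e - 1).toNat = j by omega]
    exact MvPolynomial.homogeneousComponent_mem _ _
  · rw [h1 j hj]; exact Submodule.zero_mem _

/-- The linear polynomial with given coefficients. -/
def lin {m : ℕ} : (Fin m → ℂ) →ₗ[ℂ] P m := Fintype.linearCombination ℂ (fun r => α r)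

theorem lin_apply {m : ℕ} (u : Fin m → ℂ) : lin u = ∑ r, u r • α r :=
  Fintype.linearCombination_apply _ _ _

theorem lin_single {m : ℕ} (r : Fin m) : lin (Pi.single r 1) = (α r : P m) := by
  simp [lin]

theorem lin_mem {m : ℕ} (u : Fin m → ℂ) : lin u ∈ Pgr m 1 := by
  rw [lin_apply]
  exact Submodule.sum_mem _ fun r _ => Submodule.smul_mem _ _ (α_mem_Pgr r)

theorem refl_mem {m : ℕ} (r : Fin m) {p : P m} {e : ℤ} (hp : p ∈ Pgr m e) :
    refl r p ∈ Pgr m e := by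
  rw [Pgr] at hp ⊢
  split_ifs at hp ⊢
  · rw [← one_mul e.toNat]
    refine MvPolynomial.IsHomogeneous.aeval hp _ fun j => ?_
    split_ifs
    · exact (MvPolynomial.isHomogeneous_X ℂ r).neg
    · exact (MvPolynomial.isHomogeneous_X ℂ j).add (MvPolynomial.isHomogeneous_X ℂ r)
    · exact MvPolynomial.isHomogeneous_X ℂ j
  · rw [(Submodule.mem_bot ℂ).1 hp, map_zero]; exact Submodule.zero_mem _

/-- The Cartan integers. -/
def cartan {m : ℕ} (r j : Fin m) : ℂ :=
  if j = r then 2 else if j.val + 1 = r.val ∨ r.val + 1 = j.val then -1 else 0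

/-- The simple roots and coroots. -/
def simpleRoot {m : ℕ} (r : Fin m) : Root (Fin m → ℂ) where
  α := Pi.single r 1
  c := Fintype.linearCombination ℂ (cartan r)
  hc := by simp [cartan]

theorem simpleRoot_c_single {m : ℕ} (r j : Fin m) :
    (simpleRoot r).c (Pi.single j 1) = cartan r j := by
  simp [simpleRoot]

theorem lin_α {m : ℕ} (r : Fin m) : lin (simpleRoot r).α = (α r : P m) := lin_single r

theorem refl_lin {m : ℕ} (r : Fin m) (u : Fin m → ℂ) :
    refl r (lin u) = lin u - (simpleRoot r).c u • α r := by
  have : (refl r).toLinearMap ∘ₗ lin =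
      lin - (LinearMap.toSpanSingleton ℂ (P m) (α r)) ∘ₗ (simpleRoot r).c := by
    refine LinearMap.pi_ext' fun j => LinearMap.ext_ring ?_
    simp only [LinearMap.comp_apply, LinearMap.single_apply, LinearMap.sub_apply, lin_single,
      simpleRoot_c_single, LinearMap.toSpanSingleton_apply, AlgHom.toLinearMap_apply]
    simp only [refl, MvPolynomial.aeval_X, cartan]
    split_ifs with h
    · subst h; module
    · module
    · module
  exact congrArg (fun f => f u) this

theorem lin_proj_mem {m : ℕ} (r : Fin m) (u : Fin m → ℂ) :
    lin ((simpleRoot r).proj u) ∈ Inv r := by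
  change refl r _ = _
  rw [refl_lin, (simpleRoot r).c_proj, zero_smul, sub_zero]; rfl

/-! ## The decomposition `P = P^s ⊕ α P^s` -/

/-- The isomorphism `P^s × P^s → P`. -/
def invProd {m : ℕ} (r : Fin m) : (Inv r × Inv r) ≃ₗ[Inv r] P m :=
  LinearEquiv.ofBijective
    { toFun := fun z => (z.1 : P m) + (z.2 : P m) * α r
      map_add' := fun x y => by
        simp only [Prod.fst_add, Prod.snd_add, AddMemClass.coe_add]; ring
      map_smul' := fun c x => by
        change (c : P m) * x.1 + ((c : P m) * x.2) * α r = (c : P m) * (x.1 + x.2 * α r)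
        ring } (by
    constructor
    · rw [← LinearMap.ker_eq_bot, Submodule.eq_bot_iff]
      rintro ⟨a, b⟩ h
      have h1 : (a : P m) + (b : P m) * α r = 0 := h
      have ha : refl r a = a := a.2
      have hb : refl r b = b := b.2
      have h2 := congrArg (refl r) h1
      rw [map_add, map_mul, refl_α, map_zero, ha, hb] at h2
      have h3 : (2 : P m) * a = 0 := by linear_combination h1 + h2
      have h4 : (a : P m) = 0 := (mul_eq_zero.1 h3).resolve_left two_ne_zero
      rw [h4, zero_add] at h1
      have h5 := (mul_eq_zero.1 h1).resolve_right (MvPolynomial.X_ne_zero r)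
      exact Prod.ext (Subtype.ext h4) (Subtype.ext h5)
    · intro p
      obtain ⟨a, b, h⟩ := exists_decomp r p
      exact ⟨(a, b), h.symm⟩)

theorem invProd_apply {m : ℕ} (r : Fin m) (a b : Inv r) :
    invProd r (a, b) = (a : P m) + (b : P m) * α r := rfl

theorem invProd_symm {m : ℕ} (r : Fin m) (p : P m) :
    p = ((invProd r).symm p).1 + ((invProd r).symm p).2 * α r :=
  ((invProd r).apply_symm_apply p).symm

/-- The two coordinates are `(p + s p) / 2` and `(p - s p) / (2 α)`; the reflection preserves
degrees. -/
theorem invProd_symm_mem {m : ℕ} (r : Fin m) {p : P m} {e : ℤ} (hp : p ∈ Pgr m e) :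
    (((invProd r).symm p).1 : P m) ∈ Pgr m e ∧ (((invProd r).symm p).2 : P m) ∈ Pgr m (e - 1) := by
  have h := invProd_symm r p
  have h' := refl_mem r hp
  set a := ((invProd r).symm p).1
  set b := ((invProd r).symm p).2
  have ha : refl r a = a := a.2
  have hb : refl r b = b := b.2
  have h2 := congrArg (refl r) h
  rw [map_add, map_mul, refl_α, ha, hb] at h2
  have hC : (MvPolynomial.C (1 / 2 : ℂ) : P m) * 2 = 1 := by
    rw [show (2 : P m) = MvPolynomial.C 2 from rfl, ← MvPolynomial.C_mul]
    norm_num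
  constructor
  · have : (a : P m) = (1 / 2 : ℂ) • (p + refl r p) := by
      rw [MvPolynomial.smul_eq_C_mul]
      linear_combination (-(a : P m)) * hC - MvPolynomial.C (1 / 2 : ℂ) * h -
        MvPolynomial.C (1 / 2 : ℂ) * h2
    rw [this]
    exact Submodule.smul_mem _ _ (Submodule.add_mem _ hp h')
  · apply mem_Pgr_of_mul_mem (α_mem_Pgr r) (MvPolynomial.X_ne_zero r)
    have : α r * (b : P m) = (1 / 2 : ℂ) • (p - refl r p) := by
      rw [MvPolynomial.smul_eq_C_mul]
      linear_combination (-((b : P m) * α r)) * hC - MvPolynomial.C (1 / 2 : ℂ) * h +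
        MvPolynomial.C (1 / 2 : ℂ) * h2
    rw [this]
    exact Submodule.smul_mem _ _ (Submodule.sub_mem _ hp h')

/-! ### The tensor product `P ⊗_{P^s} M` in coordinates -/

section ThetaEquiv

variable {m : ℕ} (r : Fin m) (M : BimodComplex m)

/-- The map `(x, y) ↦ 1 ⊗ x + α ⊗ y`. -/
def thetaOf : M.carrier × M.carrier →ₗ[ℂ] Theta r M where
  toFun z := 1 ⊗ₜ z.1 + α r ⊗ₜ z.2
  map_add' x y := by
    simp only [Prod.fst_add, Prod.snd_add, TensorProduct.tmul_add]; abel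
  map_smul' c x := by
    simp only [Prod.smul_fst, Prod.smul_snd, TensorProduct.tmul_smul, smul_add, RingHom.id_apply]

theorem thetaOf_apply (z : M.carrier × M.carrier) :
    thetaOf r M z = 1 ⊗ₜ z.1 + α r ⊗ₜ z.2 := rfl

theorem inv_smul_tmul (c : Inv r) (q : P m) (y : M.carrier) :
    q ⊗ₜ[Inv r] ((c : P m) • y) = ((c : P m) * q) ⊗ₜ[Inv r] y :=
  (TensorProduct.smul_tmul c q y).symm

theorem tmul_eq_thetaOf (p : P m) (x : M.carrier) : (p ⊗ₜ x : Theta r M) =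
    thetaOf r M ((((invProd r).symm p).1 : P m) • x, (((invProd r).symm p).2 : P m) • x) := by
  rw [thetaOf_apply, inv_smul_tmul, inv_smul_tmul, mul_one, ← TensorProduct.add_tmul,
    ← invProd_symm]

/-- The inverse of `thetaOf`. -/
def thetaTo : Theta r M →ₗ[Inv r] M.carrier × M.carrier :=
  TensorProduct.lift
    { toFun := fun p =>
        (LinearMap.lsmul (Inv r) M.carrier ((invProd r).symm p).1).prod
          (LinearMap.lsmul (Inv r) M.carrier ((invProd r).symm p).2)
      map_add' := fun p q => by ext <;> simp
      map_smul' := fun c p => by ext <;> simp [mul_smul] }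

theorem thetaTo_tmul (p : P m) (x : M.carrier) : thetaTo r M (p ⊗ₜ x) =
    ((((invProd r).symm p).1 : P m) • x, (((invProd r).symm p).2 : P m) • x) := rfl

theorem thetaTo_thetaOf (z : M.carrier × M.carrier) : thetaTo r M (thetaOf r M z) = z := by
  have h1 : (invProd r).symm 1 = (1, 0) := by
    rw [LinearEquiv.symm_apply_eq, invProd_apply]; simp
  have h2 : (invProd r).symm (α r) = (0, 1) := by
    rw [LinearEquiv.symm_apply_eq, invProd_apply]; simp
  rw [thetaOf_apply, map_add, thetaTo_tmul, thetaTo_tmul, h1, h2]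
  ext <;> simp

theorem thetaOf_thetaTo (z : Theta r M) : thetaOf r M (thetaTo r M z) = z := by
  induction z using TensorProduct.induction_on with
  | zero => simp
  | tmul p x => rw [thetaTo_tmul, ← tmul_eq_thetaOf]
  | add x y hx hy => rw [map_add, map_add, hx, hy]

/-- The isomorphism `M × M ≃ P ⊗_{P^s} M`. -/
def thetaEquiv : (M.carrier × M.carrier) ≃ₗ[ℂ] Theta r M where
  __ := thetaOf r M
  invFun := thetaTo r M
  left_inv := thetaTo_thetaOf r M
  right_inv := thetaOf_thetaTo r M

theorem thetaEquiv_apply (z : M.carrier × M.carrier) :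
    thetaEquiv r M z = 1 ⊗ₜ z.1 + α r ⊗ₜ z.2 := rfl

theorem thetaEquiv_mem {j e : ℤ} {z : M.carrier × M.carrier} (h1 : z.1 ∈ M.gr j e)
    (h2 : z.2 ∈ M.gr j (e - 1)) : thetaEquiv r M z ∈ thetaGr r M j e := by
  rw [thetaEquiv_apply]
  refine Submodule.add_mem _ ?_ ?_
  · have := tmul_mem_thetaGr r M (one_mem_Pgr (m := m)) h1
    rwa [zero_add] at this
  · have := tmul_mem_thetaGr r M (α_mem_Pgr r) h2
    rwa [add_sub_cancel] at this

theorem thetaEquiv_symm_mem {j e : ℤ} {z : Theta r M} (hz : z ∈ thetaGr r M j e) :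
    (thetaEquiv r M).symm z ∈ (M.gr j e).prod (M.gr j (e - 1)) := by
  induction hz using Submodule.span_induction with
  | mem z hz =>
    obtain ⟨f, g, a, x, rfl, ha, hx, rfl⟩ := hz
    change thetaTo r M _ ∈ _
    rw [thetaTo_tmul]
    refine ⟨M.smul_mem (invProd_symm_mem r ha).1 hx, ?_⟩
    rw [add_sub_right_comm]
    exact M.smul_mem (invProd_symm_mem r ha).2 hx
  | zero => rw [map_zero]; exact Submodule.zero_mem _
  | add x y _ _ hx hy => rw [map_add]; exact Submodule.add_mem _ hx hy
  | smul c x _ hx => rw [map_smul]; exact Submodule.smul_mem _ _ hx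

theorem finiteDimensional_thetaGr (h : ∀ j e, FiniteDimensional ℂ (M.gr j e)) (j e : ℤ) :
    FiniteDimensional ℂ (thetaGr r M j e) := by
  have h1 : (((M.gr j e).prod (M.gr j (e - 1))).map (thetaEquiv r M).toLinearMap).FG :=
    (Module.Finite.iff_fg.1 (OpComplex.finiteDimensional_prod (hp := h j e)
      (hq := h j (e - 1)))).map _
  have h2 : thetaGr r M j e =
      ((M.gr j e).prod (M.gr j (e - 1))).map (thetaEquiv r M).toLinearMap := by
    ext z
    constructor
    · intro hz
      exact ⟨_, thetaEquiv_symm_mem r M hz, (thetaEquiv r M).apply_symm_apply z⟩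
    · rintro ⟨y, hy, rfl⟩
      exact thetaEquiv_mem r M hy.1 hy.2
  rw [h2]
  exact Module.Finite.iff_fg.2 h1

end ThetaEquiv

theorem finiteDimensional_gr {m : ℕ} (w : Word m) :
    ∀ j e, FiniteDimensional ℂ ((F w).gr j e) := by
  induction w with
  | nil =>
    intro j e
    change FiniteDimensional ℂ (if j = 0 then Pgr m e else ⊥ : Submodule ℂ (P m))
    by_cases h : j = 0
    · rw [if_pos h]; exact finiteDimensional_Pgr m e
    · rw [if_neg h]; infer_instance
  | cons a w ih =>
    obtain ⟨r, b⟩ := a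
    intro j e
    cases b with
    | true =>
      exact OpComplex.finiteDimensional_prod (thetaGr r (F w) j (e + 1)) _
        (hp := finiteDimensional_thetaGr r (F w) ih j (e + 1)) (hq := ih _ _)
    | false =>
      exact OpComplex.finiteDimensional_prod _ (thetaGr r (F w) j e)
        (hp := ih _ _) (hq := finiteDimensional_thetaGr r (F w) ih j e)

/-- The term of cohomological degree `j` of a complex of bimodules. -/
def BimodComplex.term {m : ℕ} (M : BimodComplex m) (j : ℤ)
    (hf : ∀ e, FiniteDimensional ℂ (M.gr j e)) (hb : ∃ n, ∀ e < n, M.gr j e = ⊥) :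
    Bim (Fin m → ℂ) where
  V := M.carrier
  gr := M.gr j
  L := LinearMap.mk₂ ℂ (fun u x => lin u • x) (fun u v x => by rw [map_add, add_smul])
    (fun c u x => by rw [map_smul, smul_assoc]) (fun u x y => smul_add _ x y)
    (fun c u x => smul_comm _ c x)
  R := LinearMap.mk₂ ℂ (fun u x => M.right (lin u) x) (fun u v x => by rw [map_add, map_add]; rfl)
    (fun c u x => by
      rw [map_smul, MvPolynomial.smul_eq_C_mul, map_mul, Module.End.mul_apply, M.right_C])
    (fun u x y => map_add _ x y)
    (fun c u x => LinearMap.map_smul_of_tower _ c x)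
  L_L u v x := smul_comm _ _ x
  R_R u v x := by
    change (M.right _ * M.right _) x = (M.right _ * M.right _) x
    rw [← map_mul M.right, ← map_mul M.right, mul_comm]
  L_R u v x := (map_smul (M.right (lin v)) (lin u) x).symm
  L_mem u e x h := by rw [add_comm]; exact M.smul_mem (lin_mem u) h
  R_mem u e x h := by rw [add_comm]; exact M.right_mem (lin_mem u) h
  fin := hf
  bdd := hb

/-- The term of cohomological degree `j` of `F_w`. -/
def Fterm {m : ℕ} (w : Word m) (j : ℤ) : Bim (Fin m → ℂ) :=
  (F w).term j (finiteDimensional_gr w j) ⟨_, gr_eq_bot w j⟩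

/-- A linear form is the sum of an invariant one and a multiple of `α`. The invariant part crosses
the tensor sign; `α` exchanges `1` and `α` up to the invariant `α²`. This is the formula defining
`Bim.thetaL`. -/
theorem thetaEquiv_L {m : ℕ} (r : Fin m) (w : Word m) (j : ℤ) (u : Fin m → ℂ)
    (z : (F w).carrier × (F w).carrier) :
    thetaEquiv r (F w) ((Bim.theta (simpleRoot r) (Fterm w j)).L u z) =
      lin u • thetaEquiv r (F w) z := by
  have h1 : lin u = lin ((simpleRoot r).proj u) + ((simpleRoot r).c u / 2) • (α r : P m) := by
    rw [(simpleRoot r).proj_apply, map_sub, map_smul, lin_α]; module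
  have h2 : ∀ (q : P m) (y : (F w).carrier),
      q ⊗ₜ[Inv r] (lin ((simpleRoot r).proj u) • y) = (lin ((simpleRoot r).proj u) * q) ⊗ₜ y :=
    fun q y => inv_smul_tmul r (F w) ⟨_, lin_proj_mem r u⟩ q y
  have hc : α r * α r ∈ Inv r := by
    change refl r _ = _
    simp [refl_α]
  have h3 : ∀ (q : P m) (y : (F w).carrier),
      q ⊗ₜ[Inv r] (α r • α r • y) = (α r * α r * q) ⊗ₜ y := fun q y => by
    rw [← inv_smul_tmul r (F w) ⟨_, hc⟩ q y, mul_smul]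
  change 1 ⊗ₜ (lin ((simpleRoot r).proj u) • z.1 + ((simpleRoot r).c u / 2) •
      (lin (simpleRoot r).α • lin (simpleRoot r).α • z.2)) +
    α r ⊗ₜ (lin ((simpleRoot r).proj u) • z.2 + ((simpleRoot r).c u / 2) • z.1) =
      lin u • (1 ⊗ₜ z.1 + α r ⊗ₜ z.2)
  rw [lin_α, h1]
  simp only [TensorProduct.tmul_add, TensorProduct.tmul_smul, h2, h3, smul_add, add_smul,
    TensorProduct.smul_tmul', smul_eq_mul, mul_one, smul_assoc]
  abel

/-- `F_σ F_w` in cohomological degree `j`. -/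
def FtermPos {m : ℕ} (r : Fin m) (w : Word m) (j : ℤ) :
    Bim.Iso (Bim.sum (Bim.shift (-1) (Bim.theta (simpleRoot r) (Fterm w j)))
      (Bim.shift (-1) (Fterm w (j - 1)))) (Fterm ((r, true) :: w) j) where
  e := (thetaEquiv r (F w)).prodCongr (LinearEquiv.refl ℂ _)
  mem {k x} h := by
    have h1 : x.1.1 ∈ (F w).gr j (k - -1) := h.1.1
    have h2 : x.1.2 ∈ (F w).gr j (k - -1 - 1) := h.1.2
    have h3 : x.2 ∈ (F w).gr (j - 1) (k - -1) := h.2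
    rw [sub_neg_eq_add] at h1 h2 h3
    exact ⟨thetaEquiv_mem r (F w) h1 h2, h3⟩
  mem' {k x} h := by
    obtain ⟨h1, h2⟩ := h
    have h3 := thetaEquiv_symm_mem r (F w) h1
    rw [← sub_neg_eq_add] at h2 h3
    exact ⟨h3, h2⟩
  e_L u x := Prod.ext (thetaEquiv_L r w j u x.1) rfl
  e_R u x := Prod.ext rfl rfl

/-- `F_{σ⁻¹} F_w` in cohomological degree `j`. -/
def FtermNeg {m : ℕ} (r : Fin m) (w : Word m) (j : ℤ) :
    Bim.Iso (Bim.sum (Bim.shift 1 (Fterm w (j + 1))) (Bim.theta (simpleRoot r) (Fterm w j)))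
      (Fterm ((r, false) :: w) j) where
  e := (LinearEquiv.refl ℂ _).prodCongr (thetaEquiv r (F w))
  mem {k x} h := ⟨h.1, thetaEquiv_mem r (F w) h.2.1 h.2.2⟩
  mem' {k x} h := ⟨h.1, thetaEquiv_symm_mem r (F w) h.2⟩
  e_L u x := Prod.ext rfl (thetaEquiv_L r w j u x.2)
  e_R u x := Prod.ext rfl rfl

end KR

namespace KR
namespace OpComplex

variable {J : Type}

/-! ## Koszul complexes -/

/-- The Koszul complex of the operators `c 0, …, c (n - 1)`, in exterior algebra form. -/
abbrev kos (n : ℕ) (c : Fin n → J) (C : OpComplex J) : OpComplex J where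
  V := Finset (Fin n) → C.V
  gr i e := Submodule.pi Set.univ fun I => C.gr (i - I.card) (e - I.card)
  d := LinearMap.pi fun I => ((-1 : ℤ) ^ I.card) • (C.d ∘ₗ LinearMap.proj I) +
    ∑ k ∈ Iᶜ, ((-1 : ℤ) ^ (I.filter (· < k)).card) • (C.op (c k) ∘ₗ LinearMap.proj (insert k I))
  op j := LinearMap.pi fun I => C.op j ∘ₗ LinearMap.proj I

theorem kos_d_apply (n : ℕ) (c : Fin n → J) (C : OpComplex J) (f : Finset (Fin n) → C.V)
    (I : Finset (Fin n)) : (kos n c C).d f I = ((-1 : ℤ) ^ I.card) • C.d (f I) +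
      ∑ k ∈ Iᶜ, ((-1 : ℤ) ^ (I.filter (· < k)).card) • C.op (c k) (f (insert k I)) := by
  simp [kos]

/-- The subset of `{0, …, n - 1}` as a subset of `{0, …, n}`. -/
abbrev up {n : ℕ} (I : Finset (Fin n)) : Finset (Fin (n + 1)) := I.map Fin.castSuccEmb

/-- The intersection of a subset of `{0, …, n}` with `{0, …, n - 1}`. -/
abbrev down {n : ℕ} (I : Finset (Fin (n + 1))) : Finset (Fin n) :=
  Finset.univ.filter fun k => k.castSucc ∈ I

theorem last_notMem_up {n : ℕ} (I : Finset (Fin n)) : Fin.last n ∉ up I := by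
  simp [up, Fin.castSucc_ne_last]

theorem down_up {n : ℕ} (I : Finset (Fin n)) : down (up I) = I := by
  ext k; simp

theorem down_insert_up {n : ℕ} (I : Finset (Fin n)) : down (insert (Fin.last n) (up I)) = I := by
  ext k; simp [Fin.castSucc_ne_last]

theorem up_down {n : ℕ} {I : Finset (Fin (n + 1))} (h : Fin.last n ∉ I) : up (down I) = I := by
  ext k
  induction k using Fin.lastCases with
  | last => simp [h, Fin.castSucc_ne_last]
  | cast k => simp

theorem insert_up_down {n : ℕ} {I : Finset (Fin (n + 1))} (h : Fin.last n ∈ I) :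
    insert (Fin.last n) (up (down I)) = I := by
  ext k
  induction k using Fin.lastCases with
  | last => simp [h]
  | cast k => simp [Fin.castSucc_ne_last]

theorem compl_up {n : ℕ} (I : Finset (Fin n)) : (up I)ᶜ = insert (Fin.last n) (up Iᶜ) := by
  ext k
  induction k using Fin.lastCases with
  | last => simp [Fin.castSucc_ne_last]
  | cast k => simp [Fin.castSucc_ne_last]

theorem compl_insert_up {n : ℕ} (I : Finset (Fin n)) :
    (insert (Fin.last n) (up I))ᶜ = up Iᶜ := by
  ext k
  induction k using Fin.lastCases with
  | last => simp [Fin.castSucc_ne_last]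
  | cast k => simp [Fin.castSucc_ne_last]

theorem card_filter_up {n : ℕ} (I : Finset (Fin n)) (k : Fin n) :
    ((up I).filter (· < k.castSucc)).card = (I.filter (· < k)).card := by
  rw [up, Finset.filter_map, Finset.card_map]
  rfl

theorem card_filter_up_last {n : ℕ} (I : Finset (Fin n)) :
    ((up I).filter (· < Fin.last n)).card = I.card := by
  rw [Finset.filter_true_of_mem, Finset.card_map]
  intro k hk
  obtain ⟨k, _, rfl⟩ := Finset.mem_map.1 hk
  exact Fin.castSucc_lt_last k

theorem card_filter_insert_up {n : ℕ} (I : Finset (Fin n)) (k : Fin n) :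
    ((insert (Fin.last n) (up I)).filter (· < k.castSucc)).card = (I.filter (· < k)).card := by
  rw [Finset.filter_insert, if_neg (by simp [Fin.le_last]), card_filter_up]

/-- The last operator of a Koszul complex may be split off. -/
def kosPeel (n : ℕ) (c : Fin (n + 1) → J) (C : OpComplex J) :
    Retr (kos (n + 1) c C)
      (kos n (fun k => c k.castSucc) (cone 1 C (C.op (c (Fin.last n))))) :=
  Retr.ofEquiv
    { toFun := fun f I => (f (up I), f (insert (Fin.last n) (up I)))
      map_add' := fun f g => rfl
      map_smul' := fun a f => rfl
      invFun := fun g I => if Fin.last n ∈ I then (g (down I)).2 else (g (down I)).1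
      left_inv := fun f => by
        funext I
        dsimp only
        split_ifs with h
        · rw [insert_up_down h]
        · rw [up_down h]
      right_inv := fun g => by
        funext I
        dsimp only
        rw [if_neg (last_notMem_up I), if_pos (Finset.mem_insert_self _ _), down_up,
          down_insert_up] }
    (fun {i e f} hf I _ => by
      have h1 := hf (up I) trivial
      have h2 := hf (insert (Fin.last n) (up I)) trivial
      simp only [SetLike.mem_coe] at h1 h2
      rw [Finset.card_insert_of_notMem (last_notMem_up I)] at h2
      rw [Finset.card_map] at h1 h2
      push_cast at h2
      rw [← sub_sub, ← sub_sub] at h2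
      exact ⟨h1, h2⟩)
    (fun {i e g} hg I _ => by
      obtain ⟨h1, h2⟩ := hg (down I) trivial
      rw [SetLike.mem_coe] at h1 h2
      change (if Fin.last n ∈ I then (g (down I)).2 else (g (down I)).1) ∈
        C.gr (i - I.card) (e - I.card)
      split_ifs with h
      · have h3 : I.card = (down I).card + 1 := by
          conv_lhs => rw [← insert_up_down h]
          rw [Finset.card_insert_of_notMem (last_notMem_up _), Finset.card_map]
        rw [h3]
        push_cast
        rwa [← sub_sub, ← sub_sub]
      · have h3 : I.card = (down I).card := by
          conv_lhs => rw [← up_down h]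
          rw [Finset.card_map]
        rw [h3]
        exact h1)
    (fun f => by
      funext I
      change ((kos (n + 1) c C).d f (up I), (kos (n + 1) c C).d f (insert (Fin.last n) (up I))) =
        (kos n (fun k => c k.castSucc) (cone 1 C (C.op (c (Fin.last n))))).d
          (fun I => (f (up I), f (insert (Fin.last n) (up I)))) I
      -- The last index exceeds every element of `I`, so its operator carries the sign `(-1)^#I`. In
      -- the components at `I` and `I ∪ {n}` the differential of `C` carries the signs `(-1)^#I` and
      -- `(-1)^(#I + 1)`. Together this is `(-1)^#I` times the differential of the cone.
      rw [kos_d_apply, kos_d_apply, kos_d_apply, compl_up, compl_insert_up,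
        Finset.sum_insert (last_notMem_up _), Finset.sum_map, Finset.sum_map,
        Finset.card_insert_of_notMem (last_notMem_up I), Finset.card_map, card_filter_up_last]
      have hup : ∀ k, insert (Fin.castSuccEmb k) (up I) = up (insert k I) := fun k =>
        (Finset.map_insert _ _ _).symm
      have hc1 : ∀ k, ((up I).filter (· < Fin.castSuccEmb k)).card = (I.filter (· < k)).card :=
        card_filter_up I
      have hc2 : ∀ k, ((insert (Fin.last n) (up I)).filter (· < Fin.castSuccEmb k)).card =
          (I.filter (· < k)).card := card_filter_insert_up I
      ext
      · simp only [hc1, hup]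
        simp [Prod.fst_sum]
        abel
      · simp only [hc2, Finset.insert_comm (Fin.castSuccEmb _), hup]
        simp [Prod.snd_sum, pow_succ])
    (fun j f => rfl)

/-- The Koszul complex without operators. -/
def kosZero (c : Fin 0 → J) (C : OpComplex J) : Retr (kos 0 c C) C :=
  Retr.ofEquiv (LinearEquiv.funUnique (Finset (Fin 0)) ℂ C.V)
    (fun {i e f} hf => by
      have h : f ∅ ∈ C.gr (i - (0 : ℕ)) (e - (0 : ℕ)) := hf ∅ trivial
      rw [Nat.cast_zero, sub_zero, sub_zero] at h
      exact h)
    (fun {i e x} hx I _ => by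
      have : I = ∅ := Subsingleton.elim _ _
      subst this
      change x ∈ C.gr (i - (0 : ℕ)) (e - (0 : ℕ))
      rwa [Nat.cast_zero, sub_zero, sub_zero])
    (fun f => by
      change (kos 0 c C).d f ∅ = C.d (f ∅)
      rw [kos_d_apply, Finset.card_empty, pow_zero, one_smul, Subsingleton.elim (∅ᶜ : Finset (Fin 0)) ∅,
        Finset.sum_empty, add_zero])
    (fun j f => rfl)

/-- Operators are peeled off from the last one, whence the reversed list. -/
theorem hd_kos (n : ℕ) (c : Fin n → J) (C : OpComplex J) :
    (kos n c C).hd = (K (List.ofFn c).reverse C).hd := by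
  induction n generalizing C with
  | zero => exact (kosZero c C).hd_K []
  | succ n ih =>
    have h : (List.ofFn c).reverse =
        c (Fin.last n) :: (List.ofFn fun k : Fin n => c k.castSucc).reverse := by
      rw [List.ofFn_succ', List.concat_eq_append, List.reverse_append]; rfl
    rw [h, K_cons, ← ih]
    exact (kosPeel n c C).hd_K []

end OpComplex

/-! ### Hochschild homology as an iterated cone -/

open OpComplex

/-- The simple roots, as a list. -/
def roots (m : ℕ) : List (Fin m → ℂ) := (List.ofFn fun r : Fin m => Pi.single r (1 : ℂ)).reverse

/-- The dimensions of the Hochschild homology of a bimodule. -/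
def hh {m : ℕ} (N : Bim (Fin m → ℂ)) : ℤ → ℤ → ℕ := (K (roots m) N.toCx).hd

theorem kosDiff_apply {m : ℕ} (M : BimodComplex m) (f : Kos M) (I : Finset (Fin m)) :
    kosDiff M f I = ∑ k ∈ Iᶜ, ((-1 : ℤ) ^ (I.filter (· < k)).card) •
      (α k • f (insert k I) - M.right (α k) (f (insert k I))) := by
  simp [kosDiff, commOp]

theorem Fterm_op {m : ℕ} (w : Word m) (j : ℤ) (k : Fin m) (x : (F w).carrier) :
    (Fterm w j).toCx.op (Pi.single k (1 : ℂ)) x = α k • x - (F w).right (α k) x := by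
  change lin (Pi.single k (1 : ℂ)) • x - (F w).right (lin (Pi.single k (1 : ℂ))) x = _
  rw [lin_single]

theorem kosDiff_eq {m : ℕ} (w : Word m) (j : ℤ) :
    (kos m (fun r : Fin m => Pi.single r (1 : ℂ)) (Fterm w j).toCx).d =
      (kosDiff (F w)).restrictScalars ℂ := by
  refine LinearMap.ext fun f => funext fun I => ?_
  rw [kos_d_apply]
  change _ = kosDiff (F w) f I
  have h0 : ((-1 : ℤ) ^ I.card) • (Fterm w j).toCx.d (f I) = 0 := smul_zero _
  rw [h0, zero_add]
  refine Eq.trans (Finset.sum_congr rfl fun k _ => ?_) (kosDiff_apply (F w) f I).symm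
  congr 1
  exact Fterm_op w j k (f (insert k I))

/-- The complex of a bimodule sits in degree `0`, so only the subsets of cardinality `i` contribute
in degree `i`. -/
theorem kosGr_eq {m : ℕ} (w : Word m) (i : ℕ) (j e : ℤ) :
    (kos m (fun r : Fin m => Pi.single r (1 : ℂ)) (Fterm w j).toCx).gr i e =
      kosGr (F w) i j e := by
  refine congrArg (Submodule.pi Set.univ) (funext fun I => ?_)
  change (if (i : ℤ) - I.card = 0 then (F w).gr j (e - I.card) else ⊥) = _
  by_cases h : I.card = i
  · subst h; rw [if_pos (sub_self _), if_pos rfl]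
  · rw [if_neg (by omega), if_neg h]

/-- The bridge from the Koszul definition of `HH` to iterated cones, after which only bimodules up
to isomorphism matter. -/
theorem finrank_HH {m : ℕ} (w : Word m) (i : ℕ) (j e : ℤ) :
    Module.finrank ℂ (HH (F w) i j e) = hh (Fterm w j) i e := by
  rw [hh, roots, ← hd_kos]
  refine (finrank_quotient_congr (V := Finset (Fin m) → (F w).carrier) ?_ ?_).symm
  · rw [cycles, hhCycles, kosDiff_eq, kosGr_eq]
    rfl
  · rw [boundaries, hhBoundaries, kosDiff_eq, ← Nat.cast_succ, kosGr_eq]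
    rfl

theorem finiteDimensional_hhCycles {m : ℕ} (w : Word m) (i : ℕ) (j e : ℤ) :
    FiniteDimensional ℂ (hhCycles (F w) i j e) := by
  have h1 : FiniteDimensional ℂ (kosGr (F w) i j e) := by
    have h2 : ∀ I : Finset (Fin m), FiniteDimensional ℂ
        (if I.card = i then (F w).gr j (e - i) else ⊥ : Submodule ℂ (F w).carrier) := by
      intro I
      by_cases h : I.card = i
      · rw [if_pos h]; exact finiteDimensional_gr w _ _
      · rw [if_neg h]; infer_instance
    let f : kosGr (F w) i j e →ₗ[ℂ] ((I : Finset (Fin m)) →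
        (if I.card = i then (F w).gr j (e - i) else ⊥ : Submodule ℂ (F w).carrier)) :=
      { toFun := fun x I => ⟨x.1 I, x.2 I trivial⟩
        map_add' := fun _ _ => rfl
        map_smul' := fun _ _ => rfl }
    refine Module.Finite.of_injective f fun x y h => Subtype.ext (funext fun I => ?_)
    exact congrArg Subtype.val (congrFun h I)
  exact Submodule.finiteDimensional_of_le inf_le_left

instance {m : ℕ} (w : Word m) (i : ℕ) (j e : ℤ) : FiniteDimensional ℂ (HH (F w) i j e) :=
  have := finiteDimensional_hhCycles w i j e
  inferInstance

end KR

/-! ### Supports of iterated cones -/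

namespace KR
namespace OpComplex

variable {J : Type}

theorem hd_eq_zero_of_gr_eq_bot {C : OpComplex J} {i e : ℤ} (h : C.gr i e = ⊥) : C.hd i e = 0 := by
  have h1 : Subsingleton (C.cycles i e) := by rw [cycles, h, bot_inf_eq]; infer_instance
  have h2 : Subsingleton (C.Homology i e) := inferInstance
  exact Module.finrank_zero_of_subsingleton

/-- Each cone adds one to the largest homological degree and leaves the lower bounds unchanged. -/
theorem K_gr_ne_bot (L : List J) (C : OpComplex J) (a b n : ℤ)
    (h : ∀ i e, C.gr i e ≠ ⊥ → a ≤ i ∧ i ≤ b ∧ n ≤ e) (i e : ℤ) (hK : (K L C).gr i e ≠ ⊥) :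
    a ≤ i ∧ i ≤ b + L.length ∧ n ≤ e := by
  induction L generalizing C b with
  | nil => simpa using h i e hK
  | cons j L ih =>
    have := ih (cone 1 C (C.op j)) (b + 1) (fun i e h1 => by
      have h1 : (C.gr i e).prod (C.gr (i - 1) (e - 1)) ≠ ⊥ := h1
      by_cases h2 : C.gr i e = ⊥
      · by_cases h3 : C.gr (i - 1) (e - 1) = ⊥
        · exact absurd (by rw [h2, h3, Submodule.prod_bot]) h1
        · have := h _ _ h3; omega
      · have := h _ _ h2; omega) hK
    rw [List.length_cons]
    push_cast
    omega

end OpComplex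

open OpComplex

namespace Bim

variable {U : Type} [AddCommGroup U] [Module ℂ U]

theorem hd_K_ne_zero (N : Bim U) : ∃ n : ℤ, ∀ (L : List U) (i e : ℤ), (K L N.toCx).hd i e ≠ 0 →
    0 ≤ i ∧ i ≤ L.length ∧ n ≤ e := by
  obtain ⟨n, hn⟩ := N.bdd
  refine ⟨n, fun L i e h => ?_⟩
  have := K_gr_ne_bot L N.toCx 0 0 n (fun i e h => by
    change (if i = 0 then N.gr e else ⊥) ≠ ⊥ at h
    split_ifs at h with hi
    · refine ⟨hi.ge, hi.le, ?_⟩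
      by_contra hlt
      exact h (hn e (not_le.1 hlt))
    · exact absurd rfl h) i e fun hK => h (hd_eq_zero_of_gr_eq_bot hK)
  simpa using this

end Bim

/-! ## Bott-Samelson bimodules -/

/-- The regular bimodule. -/
abbrev triv (m : ℕ) : Bim (Fin m → ℂ) where
  V := P m
  gr := Pgr m
  L := LinearMap.mul ℂ (P m) ∘ₗ lin
  R := LinearMap.mul ℂ (P m) ∘ₗ lin
  L_L _ _ _ := mul_left_comm _ _ _
  R_R _ _ _ := mul_left_comm _ _ _
  L_R _ _ _ := mul_left_comm _ _ _
  L_mem u e x h := by rw [add_comm]; exact mul_mem_Pgr (lin_mem u) h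
  R_mem u e x h := by rw [add_comm]; exact mul_mem_Pgr (lin_mem u) h
  fin := finiteDimensional_Pgr m
  bdd := ⟨0, fun e he => if_neg (not_le.2 he)⟩

/-- The bimodule `θ_{r_1} ⊗_P ⋯ ⊗_P θ_{r_k} ⊗_P N`. -/
def thetas {m : ℕ} (v : List (Fin m)) (N : Bim (Fin m → ℂ)) : Bim (Fin m → ℂ) :=
  v.foldr (fun r M => Bim.theta (simpleRoot r) M) N

theorem thetas_cons {m : ℕ} (r : Fin m) (v : List (Fin m)) (N : Bim (Fin m → ℂ)) :
    thetas (r :: v) N = Bim.theta (simpleRoot r) (thetas v N) := rfl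

theorem thetas_append {m : ℕ} (v v' : List (Fin m)) (N : Bim (Fin m → ℂ)) :
    thetas (v ++ v') N = thetas v (thetas v' N) := by
  rw [thetas, List.foldr_append]; rfl

/-- `thetas` is functorial. -/
def thetasIso {m : ℕ} {M N : Bim (Fin m → ℂ)} (f : Bim.Iso M N) :
    (v : List (Fin m)) → Bim.Iso (thetas v M) (thetas v N)
  | [] => f
  | r :: v => (thetasIso f v).theta (simpleRoot r)

/-- `thetas` commutes with direct sums. -/
def thetasSum {m : ℕ} (M N : Bim (Fin m → ℂ)) :
    (v : List (Fin m)) → Bim.Iso (thetas v (Bim.sum M N)) (Bim.sum (thetas v M) (thetas v N))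
  | [] => Bim.Iso.refl _
  | r :: v => ((thetasSum M N v).theta (simpleRoot r)).trans (Bim.thetaSum _ _ _)

/-- `thetas` commutes with shifts. -/
def thetasShift {m : ℕ} (b : ℤ) (N : Bim (Fin m → ℂ)) :
    (v : List (Fin m)) → Bim.Iso (thetas v (Bim.shift b N)) (Bim.shift b (thetas v N))
  | [] => Bim.Iso.refl _
  | r :: v => ((thetasShift b N v).theta (simpleRoot r)).trans (Bim.thetaShift _ _ _)

/-- `thetas` commutes with `thetaR`. -/
def thetasThetaR {m : ℕ} (τ : Root (Fin m → ℂ)) (N : Bim (Fin m → ℂ)) :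
    (v : List (Fin m)) → Bim.Iso (thetas v (Bim.thetaR τ N)) (Bim.thetaR τ (thetas v N))
  | [] => Bim.Iso.refl _
  | r :: v => ((thetasThetaR τ N v).theta (simpleRoot r)).trans (Bim.thetaThetaR _ _ _)

/-- The linear map exchanging the factors of `P ⊗_{P^s} P`. -/
def flipMap {m : ℕ} (r : Fin m) : (P m × P m) ≃ₗ[ℂ] P m × P m :=
  let f := ((invProd r).prodCongr (invProd r)).restrictScalars ℂ
  f.symm.trans ((LinearEquiv.prodProdProdComm ℂ (Inv r) (Inv r) (Inv r) (Inv r)).trans f)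

theorem flipMap_apply {m : ℕ} (r : Fin m) (a b a' b' : Inv r) :
    flipMap r (invProd r (a, b), invProd r (a', b')) = (invProd r (a, a'), invProd r (b, b')) := by
  simp [flipMap]

theorem flipMap_flipMap {m : ℕ} (r : Fin m) (z : P m × P m) : flipMap r (flipMap r z) = z := by
  obtain ⟨x, y⟩ := z
  obtain ⟨⟨a, b⟩, rfl⟩ := (invProd r).surjective x
  obtain ⟨⟨a', b'⟩, rfl⟩ := (invProd r).surjective y
  rw [flipMap_apply, flipMap_apply]

theorem flipMap_mem {m : ℕ} (r : Fin m) {z : P m × P m} {k : ℤ} (h1 : z.1 ∈ Pgr m k)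
    (h2 : z.2 ∈ Pgr m (k - 1)) : (flipMap r z).1 ∈ Pgr m k ∧ (flipMap r z).2 ∈ Pgr m (k - 1) := by
  obtain ⟨x, y⟩ := z
  have h3 := invProd_symm_mem r h1
  have h4 := invProd_symm_mem r h2
  obtain ⟨⟨a, b⟩, rfl⟩ := (invProd r).surjective x
  obtain ⟨⟨a', b'⟩, rfl⟩ := (invProd r).surjective y
  dsimp only at h3 h4
  rw [LinearEquiv.symm_apply_apply] at h3 h4
  rw [flipMap_apply, invProd_apply, invProd_apply]
  have h5 := mul_mem_Pgr h4.1 (α_mem_Pgr r)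
  have h6 := mul_mem_Pgr h4.2 (α_mem_Pgr r)
  rw [sub_add_cancel] at h5 h6
  exact ⟨Submodule.add_mem _ h3.1 h5, Submodule.add_mem _ h3.2 h6⟩

/-- For `x = a + b α` and `y = a' + b' α` with invariant coefficients, `1 ⊗ x + α ⊗ y` equals `(a +
a' α) ⊗ 1 + (b + b' α) ⊗ α`. So `flipMap` transposes the array of coefficients, and in the new
coordinates the left action is plain multiplication. -/
theorem flipMap_thetaL {m : ℕ} (r : Fin m) (u : Fin m → ℂ) (z : P m × P m) :
    flipMap r (Bim.thetaL (simpleRoot r) (triv m).L u z) =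
      (lin u * (flipMap r z).1, lin u * (flipMap r z).2) := by
  obtain ⟨x, y⟩ := z
  obtain ⟨⟨a, b⟩, rfl⟩ := (invProd r).surjective x
  obtain ⟨⟨a', b'⟩, rfl⟩ := (invProd r).surjective y
  have h1 : lin u = lin ((simpleRoot r).proj u) +
      MvPolynomial.C ((simpleRoot r).c u / 2) * (α r : P m) := by
    rw [(simpleRoot r).proj_apply, map_sub, map_smul, lin_α, MvPolynomial.smul_eq_C_mul]; ring
  have hc : α r * α r ∈ Inv r := by
    change refl r _ = _
    simp [refl_α]
  have hC : MvPolynomial.C ((simpleRoot r).c u / 2) ∈ Inv r := (refl r).commutes _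
  let p : Inv r := ⟨_, lin_proj_mem r u⟩
  let s : Inv r := ⟨_, hC⟩
  let q : Inv r := ⟨_, hc⟩
  have h2 : Bim.thetaL (simpleRoot r) (triv m).L u (invProd r (a, b), invProd r (a', b')) =
      (invProd r (p * a + s * q * a', p * b + s * q * b'),
        invProd r (p * a' + s * a, p * b' + s * b)) := by
    change (lin ((simpleRoot r).proj u) * _ + ((simpleRoot r).c u / 2) •
      (lin (simpleRoot r).α * (lin (simpleRoot r).α * _)), lin ((simpleRoot r).proj u) * _ +
        ((simpleRoot r).c u / 2) • _) = _
    rw [lin_α]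
    simp only [invProd_apply, MvPolynomial.smul_eq_C_mul]
    refine Prod.ext ?_ ?_
    · change _ = ((p : P m) * a + s * q * a') + ((p : P m) * b + s * q * b') * α r
      simp only [p, s, q]; ring
    · change _ = ((p : P m) * a' + s * a) + ((p : P m) * b' + s * b) * α r
      simp only [p, s]; ring
  rw [h2, flipMap_apply, flipMap_apply, h1]
  simp only [invProd_apply]
  refine Prod.ext ?_ ?_
  · change ((p : P m) * a + s * q * a') + ((p : P m) * a' + s * a) * α r = _
    simp only [p, s, q]; ring
  · change ((p : P m) * b + s * q * b') + ((p : P m) * b' + s * b) * α r = _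
    simp only [p, s, q]; ring

/-- `P ⊗_{P^s} P` as a left and as a right induced bimodule. -/
def thetaTriv {m : ℕ} (r : Fin m) :
    Bim.Iso (Bim.theta (simpleRoot r) (triv m)) (Bim.thetaR (simpleRoot r) (triv m)) where
  e := flipMap r
  mem h := flipMap_mem r h.1 h.2
  mem' {k x} h := by
    have h1 : (flipMap r).symm x = flipMap r x :=
      (LinearEquiv.symm_apply_eq _).2 (flipMap_flipMap r x).symm
    rw [h1]
    exact flipMap_mem r h.1 h.2
  e_L u x := flipMap_thetaL r u x
  e_R u x := by
    change flipMap r (lin u * x.1, lin u * x.2) =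
      Bim.thetaL (simpleRoot r) (triv m).L u (flipMap r x)
    rw [← flipMap_flipMap r (Bim.thetaL (simpleRoot r) (triv m).L u (flipMap r x)),
      flipMap_thetaL, flipMap_flipMap]

/-! ### Cyclic invariance -/

theorem hh_congr {m : ℕ} {M N : Bim (Fin m → ℂ)} (f : Bim.Iso M N) : hh M = hh N :=
  f.toCx.hd_K _

theorem roots_perm {m : ℕ} (r : Fin m) :
    ∃ l, (roots m).Perm ((simpleRoot r).α :: l) := by
  classical
  refine ⟨_, List.perm_cons_erase ?_⟩
  simp only [roots, List.mem_reverse, List.mem_ofFn]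
  exact ⟨r, rfl⟩

theorem hh_thetaR {m : ℕ} (r : Fin m) (N : Bim (Fin m → ℂ)) :
    hh (Bim.thetaR (simpleRoot r) N) = hh (Bim.theta (simpleRoot r) N) := by
  obtain ⟨l, hl⟩ := roots_perm r
  rw [hh, hh, hd_K_perm hl, hd_K_perm hl, Bim.hd_K_thetaR]

/-- The last factor `θ_r ⊗ P` is also `P ⊗ θ_r`, and inducing on the right commutes with all
inductions on the left. So `θ_r` becomes a right induction of the whole bimodule, which `hh_thetaR`
turns into a left one. -/
theorem hh_rotate_one {m : ℕ} (r : Fin m) (v : List (Fin m)) :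
    hh (thetas (v ++ [r]) (triv m)) = hh (thetas (r :: v) (triv m)) := by
  rw [thetas_append, thetas_cons r v, ← hh_thetaR]
  exact hh_congr ((thetasIso (thetaTriv r) v).trans (thetasThetaR _ _ v))

theorem hh_append_comm {m : ℕ} (v v' : List (Fin m)) :
    hh (thetas (v ++ v') (triv m)) = hh (thetas (v' ++ v) (triv m)) := by
  induction v generalizing v' with
  | nil => rw [List.append_nil, List.nil_append]
  | cons r v ih =>
    rw [List.cons_append, ← hh_rotate_one, List.append_assoc, ih, List.append_assoc]
    rfl

end KR

/-! ### Restriction of actions and central vectors -/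

namespace KR

open OpComplex

namespace Bim

variable {U U' : Type} [AddCommGroup U] [Module ℂ U] [AddCommGroup U'] [Module ℂ U']

/-- Restriction of the actions along a linear map. -/
abbrev res (f : U →ₗ[ℂ] U') (N : Bim U') : Bim U where
  V := N.V
  gr := N.gr
  L := N.L ∘ₗ f
  R := N.R ∘ₗ f
  L_L _ _ := N.L_L _ _
  R_R _ _ := N.R_R _ _
  L_R _ _ := N.L_R _ _
  L_mem _ _ _ := N.L_mem _
  R_mem _ _ _ := N.R_mem _
  fin := N.fin
  bdd := N.bdd

theorem hd_K_map (f : U →ₗ[ℂ] U') (N : Bim U') (l : List U) :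
    (K (l.map f) N.toCx).hd = (K l (res f N).toCx).hd := by
  rw [OpComplex.hd_K_map]
  exact Retr.hd_K (Retr.ofEquiv (LinearEquiv.refl ℂ N.V) (fun h => h) (fun h => h)
    (fun x => rfl) (fun j x => rfl)) l

/-- A cone splits when its map factors through the commutator with a combination of the listed
vectors and of a vector acting centrally. -/
theorem hd_K_cone_central (N : Bim U) {γ u : U} (hγ : N.L γ = N.R γ) {ι : Type} [Fintype ι]
    (v : ι → U) (x : ι → ℂ) (c : ℂ) (hu : u = c • γ + ∑ n, x n • v n) (l : List U)
    (hv : ∀ n, v n ∈ l) (k : ℤ) (h : N.V →ₗ[ℂ] N.V)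
    (hmem : ∀ e y, y ∈ N.gr e → h y ∈ N.gr (e + k - 1))
    (hcomm : ∀ w y, h (N.toCx.op w y) = N.toCx.op w (h y)) (i e : ℤ) :
    (K l (cone k N.toCx (h ∘ₗ N.toCx.op u))).hd i e =
      (K l N.toCx).hd i e + (K l N.toCx).hd (i - 1) (e - k) := by
  -- The commutator with the central vector `γ` is zero, so the map is a combination of operators
  -- already coned off and may be replaced by zero.
  have h1 : h ∘ₗ N.toCx.op u = 0 + ∑ n, (x n • h) ∘ₗ N.toCx.op (v n) := by
    refine LinearMap.ext fun y => ?_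
    simp only [hu, map_add, map_sum, map_smul, hγ, LinearMap.comp_apply, LinearMap.sub_apply,
      LinearMap.add_apply, LinearMap.smul_apply, LinearMap.sum_apply, zero_add, map_sub,
      Finset.sum_sub_distrib]
    abel
  rw [h1, hd_K_cone_add_sum Finset.univ N.toCx k v (fun n => x n • h) (fun n _ => hv n),
    hd_K_cone_zero N.toCx_locFin]
  · intro n i e y hy
    refine Submodule.smul_mem _ _ ?_
    dsimp only at hy ⊢
    split_ifs at hy ⊢
    · exact hmem e y hy
    · rw [(Submodule.mem_bot ℂ).1 hy, map_zero]; exact Submodule.zero_mem _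
  · intro n y; simp
  · intro n w y
    rw [LinearMap.smul_apply, hcomm, LinearMap.smul_apply, map_smul]

theorem op_comm (N : Bim U) (u w : U) (y : N.V) :
    (N.L u + N.R u) (N.toCx.op w y) = N.toCx.op w ((N.L u + N.R u) y) := by
  simp only [LinearMap.sub_apply, LinearMap.add_apply, map_sub, map_add, N.L_L w u, N.R_R w u,
    N.L_R]
  abel

end Bim

/-! ## Adding a strand -/

/-- The inclusion of the reflection representations. -/
def inc {m : ℕ} : (Fin m → ℂ) →ₗ[ℂ] Fin (m + 1) → ℂ :=
  Fintype.linearCombination ℂ fun k => Pi.single k.castSucc 1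

theorem inc_single {m : ℕ} (k : Fin m) : inc (Pi.single k 1) = Pi.single k.castSucc 1 := by
  simp [inc]

theorem simpleRoot_castSucc_α {m : ℕ} (k : Fin m) :
    (simpleRoot k.castSucc).α = inc (simpleRoot k).α := (inc_single k).symm

theorem simpleRoot_castSucc_c {m : ℕ} (k : Fin m) (u : Fin m → ℂ) :
    (simpleRoot k.castSucc).c (inc u) = (simpleRoot k).c u := by
  have : (simpleRoot k.castSucc).c ∘ₗ inc = (simpleRoot k).c := by
    refine LinearMap.pi_ext' fun j => LinearMap.ext_ring ?_
    simp only [LinearMap.comp_apply, LinearMap.single_apply, inc_single, simpleRoot_c_single]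
    simp [cartan]
  exact congrArg (fun f => f u) this

theorem simpleRoot_castSucc_proj {m : ℕ} (k : Fin m) (u : Fin m → ℂ) :
    (simpleRoot k.castSucc).proj (inc u) = inc ((simpleRoot k).proj u) := by
  rw [Root.proj_apply, Root.proj_apply, simpleRoot_castSucc_c, simpleRoot_castSucc_α, map_sub,
    map_smul]

/-- `theta` commutes with restriction. -/
def resTheta {m : ℕ} (k : Fin m) (N : Bim (Fin (m + 1) → ℂ)) :
    Bim.Iso (Bim.theta (simpleRoot k) (Bim.res inc N))
      (Bim.res inc (Bim.theta (simpleRoot k.castSucc) N)) where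
  e := LinearEquiv.refl ℂ _
  mem h := h
  mem' h := h
  e_L u x := by
    ext <;> simp [simpleRoot_castSucc_c, simpleRoot_castSucc_α, simpleRoot_castSucc_proj]
  e_R u x := rfl

/-- `thetas` commutes with restriction. -/
def resThetas {m : ℕ} (N : Bim (Fin (m + 1) → ℂ)) : (v : List (Fin m)) →
    Bim.Iso (thetas v (Bim.res inc N)) (Bim.res inc (thetas (v.map Fin.castSucc) N))
  | [] => Bim.Iso.refl _
  | r :: v => ((resThetas N v).theta (simpleRoot r)).trans (resTheta r _)

/-- A multiple of the last fundamental weight. -/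
def wt (m : ℕ) : Fin (m + 1) → ℂ := fun k => k.val + 1

/-- The coordinates `k + 1` are linear in `k`, so their second differences vanish except at the end,
where `2 (m + 1) - m = m + 2`. -/
theorem simpleRoot_c_wt {m : ℕ} (r : Fin (m + 1)) :
    (simpleRoot r).c (wt m) = if r = Fin.last m then (m + 2 : ℂ) else 0 := by
  have h1 : ∀ j : Fin (m + 1), wt m j * cartan r j = (fun k : ℕ => ((k : ℂ) + 1) *
      ((if k = r.val then 2 else 0) - (if k + 1 = r.val then 1 else 0) -
        (if k = r.val + 1 then 1 else 0))) j.val := by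
    intro j
    simp only [wt, cartan, Fin.ext_iff, eq_comm (a := j.val) (b := r.val + 1)]
    congr 1
    split_ifs <;> first | omega | norm_num
  have h2 : (simpleRoot r).c (wt m) = ∑ j, wt m j * cartan r j := rfl
  rw [h2, Finset.sum_congr rfl fun j _ => h1 j, Fin.sum_univ_eq_sum_range (fun k : ℕ =>
    ((k : ℂ) + 1) * ((if k = r.val then 2 else 0) - (if k + 1 = r.val then 1 else 0) -
        (if k = r.val + 1 then 1 else 0)))]
  simp only [mul_sub, Finset.sum_sub_distrib, mul_ite, mul_zero, mul_one]
  rw [Finset.sum_ite_eq', Finset.sum_ite_eq', if_pos (Finset.mem_range.2 r.2)]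
  have h3 : (∑ k ∈ Finset.range (m + 1), if k + 1 = r.val then (k : ℂ) + 1 else 0) = r.val := by
    obtain ⟨r, hr⟩ := r
    cases r with
    | zero => simp
    | succ r =>
      simp only [Nat.add_right_cancel_iff]
      rw [Finset.sum_ite_eq', if_pos (Finset.mem_range.2 (by omega))]
      push_cast; rfl
  rw [h3]
  have h4 := r.2
  by_cases h : r = Fin.last m
  · rw [if_pos h, if_neg (by simp [h]), h, Fin.val_last]; ring
  · have : r.val ≠ m := fun h' => h (Fin.ext h')
    rw [if_neg h, if_pos (Finset.mem_range.2 (by omega))]; push_cast; ring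

/-- The weight is invariant under the first `m` reflections, so it crosses every tensor sign. -/
theorem thetas_L_wt {m : ℕ} (N : Bim (Fin (m + 1) → ℂ)) (h : N.L (wt m) = N.R (wt m))
    (v : List (Fin m)) : (thetas (v.map Fin.castSucc) N).L (wt m) =
      (thetas (v.map Fin.castSucc) N).R (wt m) := by
  induction v with
  | nil => exact h
  | cons r v ih =>
    refine LinearMap.ext fun z => ?_
    refine (Bim.thetaL_of_c_eq_zero _ _ (?_ : (simpleRoot r.castSucc).c (wt m) = 0) z).trans ?_
    · rw [simpleRoot_c_wt, if_neg (Fin.castSucc_ne_last r)]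
    · exact congrArg (fun f => (f z.1, f z.2)) ih

theorem wt_eq (m : ℕ) : wt m = (m + 1 : ℂ) • Pi.single (Fin.last m) 1 +
    ∑ k : Fin m, (k.val + 1 : ℂ) • inc (Pi.single k 1) := by
  have : wt m = ∑ j, wt m j • Pi.single j (1 : ℂ) := (pi_eq_sum_univ' (wt m)).trans (by
    refine Finset.sum_congr rfl fun j _ => congrArg _ ?_
    ext k; simp [Pi.single_apply, eq_comm])
  refine this.trans ((Fin.sum_univ_castSucc _).trans ((add_comm _ _).trans ?_))
  simp [wt, inc_single]

theorem roots_succ (m : ℕ) :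
    roots (m + 1) = (simpleRoot (Fin.last m)).α :: (roots m).map inc := by
  rw [roots, List.ofFn_succ', List.concat_eq_append, List.reverse_append, roots, List.map_reverse,
    List.map_ofFn]
  refine congrArg₂ _ rfl (congrArg _ (congrArg _ (funext fun k => ?_)))
  exact (inc_single k).symm

theorem mem_roots {m : ℕ} (k : Fin m) : Pi.single k 1 ∈ roots m := by
  simp only [roots, List.mem_reverse, List.mem_ofFn]
  exact ⟨k, rfl⟩

/-- The last root is a combination of the central weight and of the other roots, so its cone splits
as the cone of zero. -/
theorem hd_K_last {m : ℕ} {N : Bim (Fin (m + 1) → ℂ)} (h : N.L (wt m) = N.R (wt m))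
    (i e : ℤ) : (K (roots (m + 1)) N.toCx).hd i e =
    (K (roots m) (Bim.res inc N).toCx).hd i e +
      (K (roots m) (Bim.res inc N).toCx).hd (i - 1) (e - 1) := by
  rw [roots_succ, K_cons, ← Bim.hd_K_map]
  have hm : (m + 1 : ℂ) ≠ 0 := Nat.cast_add_one_ne_zero m
  refine Bim.hd_K_cone_central N h (fun k : Fin m => inc (Pi.single k 1))
    (fun k => -((k.val + 1) / (m + 1))) (1 / (m + 1)) ?_ _
    (fun k => List.mem_map_of_mem (mem_roots k)) 1 LinearMap.id ?_ (fun _ _ => rfl) i e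
  · rw [wt_eq, smul_add, smul_smul, one_div_mul_cancel hm, one_smul, Finset.smul_sum,
      add_assoc, ← Finset.sum_add_distrib, Finset.sum_eq_zero, add_zero]
    · rfl
    · intro k _
      rw [smul_smul, ← add_smul, show (1 / (m + 1) * (k.val + 1) + -((k.val + 1) / (m + 1)) : ℂ) = 0
        by ring, zero_smul]
  · intro e y hy
    rwa [add_sub_cancel_right]

/-- Obtained by projecting the weight in two ways: its projection is the weight minus `(m + 2) / 2`
times the last root, and it is also the combination of the projections of the other roots, since the
last root projects to zero. -/
theorem last_α_eq (m : ℕ) : (simpleRoot (Fin.last m)).α = (2 / (m + 2) : ℂ) • wt m +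
    ∑ k : Fin m, (-(2 * (k.val + 1) / (m + 2)) : ℂ) •
      (simpleRoot (Fin.last m)).proj (inc (Pi.single k 1)) := by
  have hm : (m + 2 : ℂ) ≠ 0 := by exact_mod_cast (Nat.succ_ne_zero (m + 1))
  have h1 := (simpleRoot (Fin.last m)).proj_apply (wt m)
  rw [simpleRoot_c_wt, if_pos rfl, wt_eq, map_add, map_smul] at h1
  have h2 : (simpleRoot (Fin.last m)).proj (Pi.single (Fin.last m) 1) = 0 :=
    (simpleRoot (Fin.last m)).proj_α
  rw [h2, smul_zero, zero_add, ← wt_eq, map_sum] at h1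
  have h3 : ((m + 2) / 2 : ℂ) • (simpleRoot (Fin.last m)).α = wt m -
      ∑ k : Fin m, (k.val + 1 : ℂ) • (simpleRoot (Fin.last m)).proj (inc (Pi.single k 1)) := by
    simp only [map_smul] at h1
    rw [h1]; abel
  have h4 := congrArg (fun x => (2 / (m + 2) : ℂ) • x) h3
  rw [smul_smul, show (2 / (m + 2) * ((m + 2) / 2) : ℂ) = 1 by field_simp, one_smul, smul_sub,
    sub_eq_add_neg, Finset.smul_sum, ← Finset.sum_neg_distrib] at h4
  refine h4.trans (congrArg _ (Finset.sum_congr rfl fun k _ => ?_))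
  rw [smul_smul, ← neg_smul]
  congr 1
  ring

/-- Adding the cone of the last root to either family gives the same homology, and by centrality of
the weight each result is `f(i, e) + f(i - 1, e - 1)` for the respective dimensions `f`. As these
vanish for `i < 0`, induction on `i` cancels the second summand. -/
theorem hd_K_proj {m : ℕ} {N : Bim (Fin (m + 1) → ℂ)} (h : N.L (wt m) = N.R (wt m)) :
    (K (((roots m).map inc).map (simpleRoot (Fin.last m)).proj) N.toCx).hd =
    (K (roots m) (Bim.res inc N).toCx).hd := by
  have h1 : ∀ i e, (K ((simpleRoot (Fin.last m)).α ::
      ((roots m).map inc).map (simpleRoot (Fin.last m)).proj) N.toCx).hd i e = _ := fun i e =>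
    Bim.hd_K_cone_central N h _ _ _ (last_α_eq m) _
      (fun k => List.mem_map_of_mem (List.mem_map_of_mem (mem_roots k))) 1 LinearMap.id
      (fun e y hy => by rwa [add_sub_cancel_right]) (fun _ _ => rfl) i e
  have h2 := hd_K_last h
  rw [roots_succ] at h2
  have h3 := hd_K_cons_map ((roots m).map inc) (simpleRoot (Fin.last m)).α id
    (simpleRoot (Fin.last m)).proj N.toCx (fun u => -((simpleRoot (Fin.last m)).c u / 2))
    (fun u _ => by rw [Root.proj_apply]; simp only [map_sub, map_smul, id]; module)
  rw [List.map_id] at h3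
  obtain ⟨n, hn⟩ := N.hd_K_ne_zero
  obtain ⟨n', hn'⟩ := (Bim.res inc N).hd_K_ne_zero
  have h4 : ∀ k : ℕ, ∀ i e : ℤ, i < k →
      (K (((roots m).map inc).map (simpleRoot (Fin.last m)).proj) N.toCx).hd i e =
        (K (roots m) (Bim.res inc N).toCx).hd i e := by
    intro k
    induction k with
    | zero =>
      intro i e hi
      rw [not_not.1 (mt (hn _ i e) (by omega)), not_not.1 (mt (hn' _ i e) (by omega))]
    | succ k ih =>
      intro i e hi
      have h5 := h1 i e
      rw [← h3, h2, ih (i - 1) (e - 1) (by push_cast at hi; omega)] at h5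
      omega
  funext i e
  exact h4 (i.toNat + 1) i e (by omega)

/-- By `hd_K_theta` the homology is a cone of `α² ⊗ 1 - 1 ⊗ α² = (α ⊗ 1 + 1 ⊗ α)(α ⊗ 1 - 1 ⊗ α)`.
The last factor is a combination of commutators already coned off, so the cone splits. The map has
degree two, whence the shift by `2` in place of `1`. -/
theorem hh_theta_last {m : ℕ} {N : Bim (Fin (m + 1) → ℂ)} (h : N.L (wt m) = N.R (wt m))
    (i e : ℤ) : hh (Bim.theta (simpleRoot (Fin.last m)) N) i e =
    (K (roots m) (Bim.res inc N).toCx).hd i e +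
      (K (roots m) (Bim.res inc N).toCx).hd (i - 1) (e - 2) := by
  set ρ := simpleRoot (Fin.last m)
  rw [hh, roots_succ, Bim.hd_K_theta, ← hd_K_proj h]
  have h1 : N.L ρ.α ∘ₗ N.L ρ.α - N.R ρ.α ∘ₗ N.R ρ.α = (N.L ρ.α + N.R ρ.α) ∘ₗ N.toCx.op ρ.α := by
    refine LinearMap.ext fun x => ?_
    simp [N.L_R]
  rw [h1]
  exact Bim.hd_K_cone_central N h _ _ _ (last_α_eq m) _
    (fun k => List.mem_map_of_mem (List.mem_map_of_mem (mem_roots k))) 2 _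
    (fun e y hy => by
      rw [show e + 2 - 1 = e + 1 by ring]
      exact Submodule.add_mem _ (N.L_mem _ hy) (N.R_mem _ hy)) (N.op_comm _) i e

end KR

namespace KR

open OpComplex

/-! ## Restricting the polynomial ring -/

/-- The retraction of polynomial rings killing the weight `wt m`. -/
def retract (m : ℕ) : P (m + 1) →ₐ[ℂ] P m :=
  MvPolynomial.aeval (Fin.lastCases (-((1 / (m + 1) : ℂ) • ∑ k : Fin m, (k.val + 1 : ℂ) • α k)) α)

theorem retract_rename {m : ℕ} (q : P m) :
    retract m (MvPolynomial.rename Fin.castSucc q) = q := by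
  have : (retract m).comp (MvPolynomial.rename Fin.castSucc) = AlgHom.id ℂ (P m) := by
    apply MvPolynomial.algHom_ext
    intro k
    simp [retract]
  exact congrArg (fun f : P m →ₐ[ℂ] P m => f q) this

theorem lin_inc {m : ℕ} (u : Fin m → ℂ) : lin (inc u) = MvPolynomial.rename Fin.castSucc (lin u) := by
  have : lin ∘ₗ inc (m := m) =
      (MvPolynomial.rename (R := ℂ) Fin.castSucc).toLinearMap ∘ₗ lin := by
    refine LinearMap.pi_ext' fun j => LinearMap.ext_ring ?_
    simp [inc_single, lin_single]
  exact congrArg (fun f => f u) this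

theorem lin_wt (m : ℕ) : lin (wt m) = (m + 1 : ℂ) • (α (Fin.last m) : P (m + 1)) +
    ∑ k : Fin m, (k.val + 1 : ℂ) • α k.castSucc := by
  rw [wt_eq, map_add, map_smul, map_sum, lin_single]
  simp [inc_single, lin_single]

theorem retract_lin_wt (m : ℕ) : retract m (lin (wt m)) = 0 := by
  have hm : (m + 1 : ℂ) ≠ 0 := Nat.cast_add_one_ne_zero m
  rw [lin_wt]
  simp [retract, hm]

theorem lin_wt_ne_zero (m : ℕ) : lin (wt m) ≠ (0 : P (m + 1)) := by
  intro h
  have h1 := congrArg (MvPolynomial.coeff (Finsupp.single (Fin.last m) 1)) h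
  rw [lin_wt] at h1
  have hm : (m + 1 : ℂ) ≠ 0 := Nat.cast_add_one_ne_zero m
  simp [MvPolynomial.coeff_X, Finsupp.single_left_inj, Fin.castSucc_ne_last, hm,
    MvPolynomial.coeff_sum] at h1

theorem retract_mem {m : ℕ} {p : P (m + 1)} {e : ℤ} (hp : p ∈ Pgr (m + 1) e) :
    retract m p ∈ Pgr m e := by
  rw [Pgr] at hp ⊢
  split_ifs at hp ⊢
  · rw [← one_mul e.toNat]
    refine MvPolynomial.IsHomogeneous.aeval hp _ fun j => ?_
    induction j using Fin.lastCases with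
    | last =>
      rw [Fin.lastCases_last, ← MvPolynomial.mem_homogeneousSubmodule]
      exact Submodule.neg_mem _ (Submodule.smul_mem _ _ (Submodule.sum_mem _ fun k _ =>
        Submodule.smul_mem _ _ (MvPolynomial.isHomogeneous_X ℂ k)))
    | cast k => rw [Fin.lastCases_castSucc]; exact MvPolynomial.isHomogeneous_X ℂ k
  · rw [(Submodule.mem_bot ℂ).1 hp, map_zero]; exact Submodule.zero_mem _

theorem rename_mem {m : ℕ} {p : P m} {e : ℤ} (hp : p ∈ Pgr m e) :
    MvPolynomial.rename Fin.castSucc p ∈ Pgr (m + 1) e := by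
  rw [Pgr] at hp ⊢
  split_ifs at hp ⊢
  · exact MvPolynomial.IsHomogeneous.rename_isHomogeneous hp
  · rw [(Submodule.mem_bot ℂ).1 hp, map_zero]; exact Submodule.zero_mem _

/-- Modulo the weight, the last variable equals a combination of the others, so `retract` followed
by the inclusion is the identity there. -/
theorem exists_rename_add (m : ℕ) (p : P (m + 1)) :
    ∃ q, p = MvPolynomial.rename Fin.castSucc (retract m p) + lin (wt m) * q := by
  have h1 : ((Ideal.Quotient.mkₐ ℂ (Ideal.span {lin (wt m)})).comp
      (MvPolynomial.rename Fin.castSucc)).comp (retract m) =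
      Ideal.Quotient.mkₐ ℂ (Ideal.span {lin (wt m)}) := by
    apply MvPolynomial.algHom_ext
    intro j
    induction j using Fin.lastCases with
    | last =>
      simp only [AlgHom.comp_apply, Ideal.Quotient.mkₐ_eq_mk]
      rw [Ideal.Quotient.eq, Ideal.mem_span_singleton]
      refine ⟨MvPolynomial.C (-(1 / (m + 1))), ?_⟩
      have hm : (m + 1 : ℂ) ≠ 0 := Nat.cast_add_one_ne_zero m
      rw [mul_comm, ← MvPolynomial.smul_eq_C_mul, lin_wt, smul_add, smul_smul,
        show (-(1 / (m + 1)) * (m + 1) : ℂ) = -1 by field_simp]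
      simp only [retract, MvPolynomial.aeval_X, Fin.lastCases_last, map_neg, map_smul, map_sum,
        MvPolynomial.rename_X]
      module
    | cast k => simp [retract]
  have h2 : p - MvPolynomial.rename Fin.castSucc (retract m p) ∈ Ideal.span {lin (wt m)} := by
    rw [← Ideal.Quotient.eq_zero_iff_mem, map_sub, sub_eq_zero]
    exact (congrArg (fun f : P (m + 1) →ₐ[ℂ] _ => f p) h1).symm
  obtain ⟨q, hq⟩ := Ideal.mem_span_singleton.1 h2
  exact ⟨q, by rw [← hq]; ring⟩

/-- The linear isomorphism `P_m ⊕ wt P_{m+1} = P_{m+1}`. -/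
def renameEquiv (m : ℕ) : (P m × P (m + 1)) ≃ₗ[ℂ] P (m + 1) :=
  LinearEquiv.ofBijective
    ((MvPolynomial.rename (R := ℂ) Fin.castSucc).toLinearMap.coprod
      (LinearMap.mul ℂ (P (m + 1)) (lin (wt m)))) (by
    constructor
    · rw [← LinearMap.ker_eq_bot, Submodule.eq_bot_iff]
      rintro ⟨q, p⟩ h
      have h1 : MvPolynomial.rename Fin.castSucc q + lin (wt m) * p = 0 := h
      have h2 := congrArg (retract m) h1
      rw [map_add, map_mul, retract_lin_wt, zero_mul, add_zero, retract_rename, map_zero] at h2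
      rw [h2, map_zero, zero_add] at h1
      exact Prod.ext h2 ((mul_eq_zero.1 h1).resolve_left (lin_wt_ne_zero m))
    · intro p
      obtain ⟨q, hq⟩ := exists_rename_add m p
      exact ⟨(retract m p, q), hq.symm⟩)

theorem renameEquiv_symm {m : ℕ} {x q : P (m + 1)}
    (hq : x = MvPolynomial.rename Fin.castSucc (retract m x) + lin (wt m) * q) :
    (renameEquiv m).symm x = (retract m x, q) :=
  (LinearEquiv.symm_apply_eq _).2 hq

/-- The decomposition `P_{m+1} = P_m ⊕ wt P_{m+1}`. -/
def trivRes (m : ℕ) : Bim.Iso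
    (Bim.sum (triv m) (Bim.shift 1 (Bim.res inc (triv (m + 1))))) (Bim.res inc (triv (m + 1))) where
  e := renameEquiv m
  mem {k x} h := by
    have h1 := mul_mem_Pgr (lin_mem (wt m)) h.2
    rw [add_sub_cancel] at h1
    exact Submodule.add_mem _ (rename_mem h.1) h1
  mem' {k x} h := by
    obtain ⟨q, hq⟩ := exists_rename_add m x
    have h0 : x ∈ Pgr (m + 1) k := h
    have h1 : (renameEquiv m).symm x ∈ (Pgr m k).prod (Pgr (m + 1) (k - 1)) := by
      rw [renameEquiv_symm hq]
      refine ⟨retract_mem h0, mem_Pgr_of_mul_mem (lin_mem (wt m)) (lin_wt_ne_zero m) ?_⟩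
      rw [← sub_eq_iff_eq_add'.2 hq]
      exact Submodule.sub_mem _ h0 (rename_mem (retract_mem h0))
    exact h1
  e_L u x := by
    change MvPolynomial.rename Fin.castSucc (lin u * x.1) + lin (wt m) * (lin (inc u) * x.2) =
      lin (inc u) * (MvPolynomial.rename Fin.castSucc x.1 + lin (wt m) * x.2)
    rw [lin_inc, map_mul]; ring
  e_R u x := by
    change MvPolynomial.rename Fin.castSucc (lin u * x.1) + lin (wt m) * (lin (inc u) * x.2) =
      lin (inc u) * (MvPolynomial.rename Fin.castSucc x.1 + lin (wt m) * x.2)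
    rw [lin_inc, map_mul]; ring

/-! ## Generating series -/

/-- Bigraded dimensions with bounded first degree and second degree bounded below. -/
def Tame (f : ℤ → ℤ → ℕ) : Prop := ∃ n : ℤ, ∀ i e, f i e ≠ 0 → -n ≤ i ∧ i ≤ n ∧ -n ≤ e

theorem Tame.finite {f : ℤ → ℤ → ℕ} (hf : Tame f) (e : ℤ) : {i | f i e ≠ 0}.Finite := by
  obtain ⟨n, hn⟩ := hf
  exact (Set.finite_Icc (-n) n).subset fun i hi => ⟨(hn i e hi).1, (hn i e hi).2.1⟩

theorem Tame.add {f g : ℤ → ℤ → ℕ} (hf : Tame f) (hg : Tame g) : Tame (f + g) := by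
  obtain ⟨n, hn⟩ := hf
  obtain ⟨k, hk⟩ := hg
  refine ⟨max n k, fun i e h => ?_⟩
  by_cases h1 : f i e = 0
  · have : g i e ≠ 0 := fun h2 => h (by simp [h1, h2])
    have := hk i e this
    omega
  · have := hn i e h1
    omega

theorem Tame.shift {f : ℤ → ℤ → ℕ} (hf : Tame f) (k l : ℤ) :
    Tame fun i e => f (i - k) (e - l) := by
  obtain ⟨n, hn⟩ := hf
  refine ⟨n + |k| + |l|, fun i e h => ?_⟩
  have := hn _ _ h
  have := neg_abs_le k
  have := le_abs_self k
  have := neg_abs_le l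
  have := abs_nonneg l
  have := abs_nonneg k
  omega

/-- The Laurent polynomial `∑_i f(i) t_2^{-i}`. -/
def laurent (f : ℤ → ℕ) : GaussianInt[T;T⁻¹] :=
  ∑ᶠ i, (f i : GaussianInt[T;T⁻¹]) * LaurentPolynomial.T (-2 * i)

theorem laurent_zero : laurent 0 = 0 := by simp [laurent]

theorem finite_laurent {f : ℤ → ℕ} (hf : {i | f i ≠ 0}.Finite) :
    (Function.support fun i =>
      (f i : GaussianInt[T;T⁻¹]) * LaurentPolynomial.T (-2 * i)).Finite :=
  hf.subset fun i hi h => hi (by simp [h])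

theorem laurent_add {f g : ℤ → ℕ} (hf : {i | f i ≠ 0}.Finite) (hg : {i | g i ≠ 0}.Finite) :
    laurent (f + g) = laurent f + laurent g := by
  rw [laurent, laurent, laurent, ← finsum_add_distrib (finite_laurent hf) (finite_laurent hg)]
  exact finsum_congr fun i => by rw [Pi.add_apply, Nat.cast_add, add_mul]

theorem laurent_shift {f : ℤ → ℕ} (hf : {i | f i ≠ 0}.Finite) (k : ℤ) :
    laurent (fun i => f (i - k)) = LaurentPolynomial.T (-2 * k) * laurent f := by
  rw [laurent, laurent]
  refine ((finsum_comp_equiv (Equiv.subRight k).symm).symm.trans (finsum_congr fun i => ?_)).trans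
    (mul_finsum' _ _ (finite_laurent hf)).symm
  rw [Equiv.subRight_symm_apply, add_sub_cancel_right, mul_left_comm, ← LaurentPolynomial.T_add]
  congr 2
  ring

open Classical in
/-- The series `∑_{i,e} f(i,e) t_1^e t_2^{-i}`. -/
def ser (f : ℤ → ℤ → ℕ) : R :=
  if hf : Tame f then
    HahnSeries.ofSuppBddBelow (fun a : ℤ => if Even a then laurent fun i => f i (a / 2) else 0)
      (by
        obtain ⟨n, hn⟩ := hf
        refine ⟨-2 * n, fun a ha => ?_⟩
        by_contra h
        apply ha
        beta_reduce
        split_ifs with hev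
        · have : (fun i => f i (a / 2)) = 0 := funext fun i => by
            by_contra h1
            have := hn _ _ h1
            omega
          rw [this, laurent_zero]
        · rfl)
  else 0

theorem ser_coeff {f : ℤ → ℤ → ℕ} (hf : Tame f) (a : ℤ) :
    (ser f).coeff a = if Even a then laurent fun i => f i (a / 2) else 0 := by
  rw [ser, dif_pos hf]; rfl

theorem ser_add {f g : ℤ → ℤ → ℕ} (hf : Tame f) (hg : Tame g) : ser (f + g) = ser f + ser g := by
  ext1
  funext a
  rw [HahnSeries.coeff_add, ser_coeff hf, ser_coeff hg, ser_coeff (hf.add hg)]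
  split_ifs
  · exact laurent_add (hf.finite _) (hg.finite _)
  · rw [add_zero]

theorem ser_shift {f : ℤ → ℤ → ℕ} (hf : Tame f) (k l : ℤ) :
    ser (fun i e => f (i - k) (e - l)) = t₂half (-2 * k) * t₁half (2 * l) * ser f := by
  ext1
  funext a
  rw [ser_coeff (hf.shift k l), mul_assoc, t₂half, HahnSeries.C_mul_eq_smul, HahnSeries.coeff_smul,
    t₁half, HahnSeries.coeff_single_mul, one_mul, ser_coeff hf]
  have h1 : Even (a - 2 * l) ↔ Even a := by
    rw [Int.even_sub]; simp
  by_cases h : Even a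
  · rw [if_pos h, if_pos (h1.2 h), smul_eq_mul, ← laurent_shift (hf.finite _),
      show (a - 2 * l) / 2 = a / 2 - l by omega]
  · rw [if_neg h, if_neg (mt h1.1 h), smul_zero]

theorem tame_hd_K {U : Type} [AddCommGroup U] [Module ℂ U] (N : Bim U) (l : List U) :
    Tame (K l N.toCx).hd := by
  obtain ⟨n, hn⟩ := N.hd_K_ne_zero
  refine ⟨max l.length (-n), fun i e h => ?_⟩
  have := hn l i e h
  omega

theorem tame_hh {m : ℕ} (N : Bim (Fin m → ℂ)) : Tame (hh N) := tame_hd_K N _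

theorem ser_hh_sum {m : ℕ} (M N : Bim (Fin m → ℂ)) :
    ser (hh (Bim.sum M N)) = ser (hh M) + ser (hh N) := by
  rw [← ser_add (tame_hh M) (tame_hh N)]
  exact congrArg ser (Bim.hd_K_sum M N _)

theorem t₂half_zero : t₂half 0 = 1 := by
  rw [t₂half, LaurentPolynomial.T_zero, map_one]

theorem ser_hh_shift {m : ℕ} (b : ℤ) (N : Bim (Fin m → ℂ)) :
    ser (hh (Bim.shift b N)) = t₁half (2 * b) * ser (hh N) := by
  have := ser_shift (tame_hh N) 0 b
  rw [mul_zero, t₂half_zero, one_mul] at this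
  rw [← this]
  congr 1
  funext i e
  rw [sub_zero]
  exact Bim.hd_K_shift b N _ i e

/-! ## Relations between the Hochschild homologies of Bott-Samelson bimodules -/

/-- The generating series of the Hochschild homology of a Bott-Samelson bimodule. -/
def bs {m : ℕ} (v : List (Fin m)) : R := ser (hh (thetas v (triv m)))

theorem bs_append_comm {m : ℕ} (v v' : List (Fin m)) : bs (v ++ v') = bs (v' ++ v) :=
  congrArg ser (hh_append_comm v v')

theorem bs_sq {m : ℕ} (r : Fin m) (v : List (Fin m)) :
    bs (r :: r :: v) = (1 + t₁half 2) * bs (r :: v) := by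
  rw [bs, thetas_cons, thetas_cons, hh_congr (Bim.thetaTheta _ _), ser_hh_sum, ser_hh_shift, bs,
    thetas_cons, add_mul, one_mul]
  rfl

theorem bs_comm {m : ℕ} {r s : Fin m} (h : r.val + 1 < s.val) (v : List (Fin m)) :
    bs (r :: s :: v) = bs (s :: r :: v) := by
  refine congrArg ser (hh_congr (Bim.thetaComm _ _ ?_ ?_ _))
  · refine (simpleRoot_c_single _ _).trans ?_
    rw [cartan, if_neg (by rintro rfl; omega), if_neg (by omega)]
  · refine (simpleRoot_c_single _ _).trans ?_
    rw [cartan, if_neg (by rintro rfl; omega), if_neg (by omega)]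

theorem bs_braid {m : ℕ} {r s : Fin m} (h : r.val + 1 = s.val) (v : List (Fin m)) :
    bs (r :: s :: r :: v) + t₁half 2 * bs (s :: v) =
      bs (s :: r :: s :: v) + t₁half 2 * bs (r :: v) := by
  have h1 : (simpleRoot r).c (simpleRoot s).α = -1 := by
    refine (simpleRoot_c_single _ _).trans ?_
    rw [cartan, if_neg (by rintro rfl; omega), if_pos (by omega)]
  have h2 : (simpleRoot s).c (simpleRoot r).α = -1 := by
    refine (simpleRoot_c_single _ _).trans ?_
    rw [cartan, if_neg (by rintro rfl; omega), if_pos (by omega)]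
  have h3 := congrArg ser (hh_congr (Bim.thetaBraid (thetas v (triv m)) h1 h2))
  rw [ser_hh_sum, ser_hh_sum, ser_hh_shift, ser_hh_shift] at h3
  exact h3

/-- Here `g` is the series of the restriction to the first `m` variables. Since `P_{m+1} = P_m ⊕ wt
P_{m+1}` over `P_m`, this restriction is the `m`-variable bimodule plus its own shift by one, so `g
= bs v + t_1 g`. The other two equations are `hd_K_last` and `hh_theta_last`. -/
theorem bs_castSucc {m : ℕ} (v : List (Fin m)) : ∃ g : R, (1 - t₁half 2) * g = bs v ∧
    bs (v.map Fin.castSucc) = (1 + t₂half (-2) * t₁half 2) * g ∧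
    bs (Fin.last m :: v.map Fin.castSucc) = (1 + t₂half (-2) * t₁half 4) * g := by
  have hN : (thetas (v.map Fin.castSucc) (triv (m + 1))).L (wt m) =
      (thetas (v.map Fin.castSucc) (triv (m + 1))).R (wt m) := thetas_L_wt _ rfl v
  set N := thetas (v.map Fin.castSucc) (triv (m + 1)) with hNdef
  have h0 := tame_hh (Bim.res inc N)
  refine ⟨ser (hh (Bim.res inc N)), ?_, ?_, ?_⟩
  · have h1 : ser (hh (Bim.res inc N)) = bs v + t₁half 2 * ser (hh (Bim.res inc N)) := by
      have h2 : hh (Bim.res inc N) = hh (thetas v (Bim.res inc (triv (m + 1)))) :=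
        (hh_congr (resThetas (triv (m + 1)) v)).symm
      have h3 := congrArg ser (hh_congr ((thetasIso (trivRes m) v).symm.trans (thetasSum _ _ v)))
      rw [ser_hh_sum, hh_congr (thetasShift _ _ v), ser_hh_shift, ← h2] at h3
      exact h3
    linear_combination h1
  · have h1 : hh N = hh (Bim.res inc N) + fun i e => hh (Bim.res inc N) (i - 1) (e - 1) :=
      funext fun i => funext fun e => hd_K_last hN i e
    rw [bs, ← hNdef, h1, ser_add h0 (h0.shift 1 1), ser_shift h0, add_mul, one_mul]
    rfl
  · have h1 : hh (Bim.theta (simpleRoot (Fin.last m)) N) =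
        hh (Bim.res inc N) + fun i e => hh (Bim.res inc N) (i - 1) (e - 2) :=
      funext fun i => funext fun e => hh_theta_last hN i e
    rw [bs, thetas_cons, ← hNdef, h1, ser_add h0 (h0.shift 1 2), ser_shift h0, add_mul, one_mul]
    rfl

theorem hh_triv_zero (i e : ℤ) : hh (triv 0) i e = if i = 0 ∧ e = 0 then 1 else 0 := by
  have h0 : hh (triv 0) = (triv 0).toCx.hd := rfl
  rw [h0]
  split_ifs with h
  · obtain ⟨rfl, rfl⟩ := h
    have h1 : (triv 0).toCx.cycles 0 0 = ⊤ := by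
      rw [cycles, LinearMap.ker_zero, inf_top_eq]
      change (if (0 : ℤ) = 0 then Pgr 0 0 else ⊥) = ⊤
      rw [if_pos rfl]
      refine Submodule.eq_top_iff'.2 fun x => ?_
      obtain ⟨c, rfl⟩ := MvPolynomial.C_surjective (Fin 0) x
      exact MvPolynomial.isHomogeneous_C _ c
    have h2 : (triv 0).toCx.boundaries 0 0 = ⊥ := Submodule.map_zero _
    have h3 : Module.finrank ℂ (P 0) = 1 := by
      rw [(MvPolynomial.isEmptyAlgEquiv ℂ (Fin 0)).toLinearEquiv.finrank_eq, Module.finrank_self]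
    refine (finrank_quotient_congr h1 h2).trans ?_
    rw [← h3]
    have h4 : (⊥ : Submodule ℂ (P 0)).submoduleOf ⊤ = ⊥ := by
      rw [Submodule.submoduleOf, Submodule.comap_bot, Submodule.ker_subtype]
    exact ((Submodule.quotEquivOfEqBot _ h4).trans Submodule.topEquiv).finrank_eq
  · refine hd_eq_zero_of_gr_eq_bot ?_
    by_cases hi : i = 0
    · refine (if_pos hi).trans ?_
      rw [Submodule.eq_bot_iff]
      intro x hx
      change x ∈ Pgr 0 e at hx
      rw [Pgr] at hx
      split_ifs at hx with he
      · obtain ⟨c, rfl⟩ := MvPolynomial.C_surjective (Fin 0) x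
        by_contra hc
        have h5 := MvPolynomial.IsHomogeneous.inj_right hx (MvPolynomial.isHomogeneous_C _ c) hc
        omega
      · exact hx
    · exact if_neg hi

theorem bs_nil_zero : bs ([] : List (Fin 0)) = 1 := by
  have h : hh (triv 0) = fun i e => if i = 0 ∧ e = 0 then 1 else 0 :=
    funext fun i => funext fun e => hh_triv_zero i e
  have h0 := tame_hh (triv 0)
  ext1
  funext a
  change (ser (hh (triv 0))).coeff a = _
  rw [ser_coeff h0, h, HahnSeries.coeff_one]
  by_cases ha : a = 0
  · subst ha
    rw [if_pos (by simp), if_pos rfl, laurent, finsum_eq_single _ 0]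
    · simp
    · intro i hi
      simp [hi]
  · rw [if_neg ha]
    split_ifs with hev
    · have : a / 2 ≠ 0 := by
        obtain ⟨b, rfl⟩ := hev
        omega
      simp [this, laurent]
    · rfl

end KR

namespace KR

open OpComplex

/-! ## Finiteness -/

theorem hh_eq_zero {m : ℕ} {N : Bim (Fin m → ℂ)} (h : ∀ e, N.gr e = ⊥) (i e : ℤ) : hh N i e = 0 := by
  refine hd_eq_zero_of_gr_eq_bot ?_
  by_contra h1
  -- The complex vanishes, so any bounds are admissible; the lower bound `i + 1` contradicts
  -- nonvanishing in degree `i`.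
  have := K_gr_ne_bot (roots m) N.toCx (i + 1) 0 0 (fun i e h2 => absurd (by
    change (if i = 0 then N.gr e else ⊥) = ⊥
    rw [h, ite_self]) h2) i e h1
  omega

/-- Each letter widens the range of cohomological degrees by at most one. -/
theorem gr_eq_bot_of_length {m : ℕ} (w : Word m) :
    ∀ j e : ℤ, (w.length : ℤ) < |j| → (F w).gr j e = ⊥ := by
  have key : ∀ (r : Fin m) (M : BimodComplex m) (j e : ℤ), (∀ e, M.gr j e = ⊥) →
      thetaGr r M j e = ⊥ := by
    intro r M j e h
    rw [thetaGr, Submodule.span_eq_bot]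
    rintro z ⟨f, g, a, x, -, -, hx, rfl⟩
    rw [h, Submodule.mem_bot] at hx
    rw [hx, TensorProduct.tmul_zero]
  induction w with
  | nil =>
    intro j e hj
    refine if_neg ?_
    rintro rfl
    simp at hj
  | cons a w ih =>
    obtain ⟨r, b⟩ := a
    intro j e hj
    rw [List.length_cons] at hj
    push_cast at hj
    have h0 : (w.length : ℤ) < |j| := by omega
    have h1 := abs_sub_abs_le_abs_sub j 1
    have h2 := abs_sub_abs_le_abs_sub j (-1)
    rw [abs_neg, sub_neg_eq_add] at h2
    rw [abs_one] at h1 h2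
    cases b with
    | true =>
      change (thetaGr r (F w) j (e + 1)).prod ((F w).gr (j - 1) (e + 1)) = ⊥
      rw [key r (F w) j _ fun e => ih j e h0, ih _ _ (by omega), Submodule.prod_bot]
    | false =>
      change ((F w).gr (j + 1) (e - 1)).prod (thetaGr r (F w) j e) = ⊥
      rw [key r (F w) j _ fun e => ih j e h0, ih _ _ (by omega), Submodule.prod_bot]

theorem thetas_gr_eq_bot {m : ℕ} (v : List (Fin m)) {N : Bim (Fin m → ℂ)} (h : ∀ e, N.gr e = ⊥) :
    ∀ e, (thetas v N).gr e = ⊥ := by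
  induction v with
  | nil => exact h
  | cons r v ih =>
    intro e
    change ((thetas v N).gr e).prod ((thetas v N).gr (e - 1)) = ⊥
    rw [ih, ih, Submodule.prod_bot]

theorem hh_thetas_Fterm {m : ℕ} (v : List (Fin m)) (w : Word m) {j : ℤ}
    (hj : (w.length : ℤ) < |j|) : hh (thetas v (Fterm w j)) = 0 :=
  funext fun i => funext fun e =>
    hh_eq_zero (thetas_gr_eq_bot v fun e => gr_eq_bot_of_length w j e hj) i e

theorem hh_ne_zero {m : ℕ} {N : Bim (Fin m → ℂ)} {i e : ℤ} (h : hh N i e ≠ 0) : 0 ≤ i ∧ i ≤ m := by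
  obtain ⟨n, hn⟩ := N.hd_K_ne_zero
  have := hn (roots m) i e h
  rw [roots, List.length_reverse, List.length_ofFn] at this
  omega

/-! ## The Euler characteristic -/

section Euler

variable {m : ℕ} (M : BimodComplex m)

theorem hhDiff_hhDiff (i : ℕ) (e : ℤ) {j j' j'' : ℤ} (h : j + 1 = j') (h' : j' + 1 = j'')
    (x : HH M i j e) : hhDiff M i e h' (hhDiff M i e h x) = 0 := by
  obtain ⟨x, rfl⟩ := Submodule.mkQ_surjective _ x
  have h1 : extDiff M (extDiff M x.1) = 0 := funext fun I => M.d_d _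
  refine (Submodule.Quotient.mk_eq_zero _).2 ?_
  change extDiff M (extDiff M x.1) ∈ hhBoundaries M i j'' e
  rw [h1]
  exact Submodule.zero_mem _

/-- The rank of the differential on Hochschild homology. -/
def rk (i : ℕ) (j e : ℤ) : ℕ :=
  Module.finrank ℂ (LinearMap.range (hhDiff M i e (rfl : j + 1 = j + 1)))

theorem rk_eq (i : ℕ) (e : ℤ) {j j' : ℤ} (h : j + 1 = j') :
    Module.finrank ℂ (LinearMap.range (hhDiff M i e h)) = rk M i j e := by
  subst h; rfl

/-- Rank-nullity for the outgoing differential, together with the dimension of the quotient of its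
kernel by the incoming image. -/
theorem finrank_HHH_add (i : ℕ) (j e : ℤ) [FiniteDimensional ℂ (HH M i j e)] :
    Module.finrank ℂ (HHH M i j e) + rk M i (j - 1) e + rk M i j e =
      Module.finrank ℂ (HH M i j e) := by
  have h1 : LinearMap.range (hhDiff M i e (sub_add_cancel j 1)) ≤
      LinearMap.ker (hhDiff M i e (rfl : j + 1 = j + 1)) := by
    rintro _ ⟨x, rfl⟩
    exact hhDiff_hhDiff M i e _ _ x
  rw [← LinearMap.finrank_range_add_finrank_ker (hhDiff M i e (rfl : j + 1 = j + 1)),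
    ← rk_eq M i e (sub_add_cancel j 1), ← rk_eq M i e (rfl : j + 1 = j + 1), ← (Submodule.submoduleOfEquivOfLe h1).finrank_eq,
    Submodule.finrank_quotient_add_finrank, add_comm]

end Euler

theorem dimH_le {m : ℕ} (w : Word m) (i : ℕ) (j e : ℤ) :
    dimH w i j e ≤ hh (Fterm w j) i e := by
  have := finrank_HHH_add (F w) i j e
  rw [finrank_HH] at this
  rw [dimH]
  omega

theorem dimH_ne_zero {m : ℕ} {w : Word m} {i : ℕ} {j e : ℤ} (h : dimH w i j e ≠ 0) :
    (i, j) ∈ Finset.range (m + 1) ×ˢ Finset.Icc (-(w.length : ℤ)) w.length := by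
  have h1 : hh (Fterm w j) i e ≠ 0 := fun h2 => h (by have := dimH_le w i j e; omega)
  have h2 := hh_ne_zero h1
  have h3 : |j| ≤ w.length := not_lt.1 fun h4 =>
    h1 (congrFun (congrFun (hh_thetas_Fterm [] w h4) i) e)
  rw [Finset.mem_product, Finset.mem_range, Finset.mem_Icc]
  exact ⟨by dsimp only; omega, abs_le.1 h3⟩

theorem hilb_coeff {m : ℕ} (w : Word m) (i : ℕ) (j a : ℤ) :
    (hilb w i j).coeff a = if Even a then (dimH w i j (a / 2) : Coeff) else 0 := rfl

theorem hilb_support {m : ℕ} (w : Word m) : {p : ℕ × ℤ | hilb w p.1 p.2 ≠ 0} ⊆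
    (Finset.range (m + 1) ×ˢ Finset.Icc (-(w.length : ℤ)) w.length : Finset (ℕ × ℤ)) := by
  rintro ⟨i, j⟩ hp
  by_contra h
  apply hp
  ext1
  funext a
  rw [hilb_coeff, HahnSeries.coeff_zero]
  have : dimH w i j (a / 2) = 0 := by
    by_contra h1
    exact h (dimH_ne_zero h1)
  rw [this, Nat.cast_zero, ite_self]

/-- The Euler-Poincaré principle, for each Hochschild and internal degree separately. -/
theorem sum_negOnePow_dimH {m : ℕ} (w : Word m) (i : ℕ) (e : ℤ) :
    ∑ j ∈ Finset.Icc (-(w.length : ℤ)) w.length, (j.negOnePow : ℤ) * dimH w i j e =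
      ∑ j ∈ Finset.Icc (-(w.length : ℤ)) w.length, (j.negOnePow : ℤ) * hh (Fterm w j) i e := by
  have h1 : ∀ j, (hh (Fterm w j) i e : ℤ) =
      dimH w i j e + rk (F w) i (j - 1) e + rk (F w) i j e := fun j => by
    rw [← finrank_HH, ← finrank_HHH_add (F w) i j e]; push_cast; rfl
  have h2 : ∀ j : ℤ, (w.length : ℤ) < |j| → hh (Fterm w j) i e = 0 := fun j hj =>
    congrFun (congrFun (hh_thetas_Fterm [] w hj) i) e
  -- The two boundary ranks of the telescoping sum vanish, because the Hochschild homology is zero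
  -- just outside the range of summation.
  have h3 : rk (F w) i w.length e = 0 := by
    have := h1 (w.length + 1)
    rw [h2 _ (by rw [abs_of_nonneg] <;> omega), add_sub_cancel_right] at this
    omega
  have h4 : rk (F w) i (-(w.length : ℤ) - 1) e = 0 := by
    have := h1 (-(w.length : ℤ) - 1)
    rw [h2 _ (by rw [abs_of_neg] <;> omega)] at this
    omega
  have h5 : ∀ j : ℤ, (j.negOnePow : ℤ) * hh (Fterm w j) i e = (j.negOnePow : ℤ) * dimH w i j e +
      ((j.negOnePow : ℤ) * rk (F w) i j e -
        ((j - 1).negOnePow : ℤ) * rk (F w) i (j - 1) e) := fun j => by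
    rw [h1, Int.negOnePow_sub, Int.negOnePow_one]; push_cast; ring
  rw [Finset.sum_congr rfl fun j _ => h5 j, Finset.sum_add_distrib, eq_comm, add_eq_left]
  have h6 : ∀ (f : ℤ → ℤ) (a : ℤ) (n : ℕ),
      ∑ j ∈ Finset.Ico a (a + n), (f j - f (j - 1)) = f (a + n - 1) - f (a - 1) := by
    intro f a n
    induction n with
    | zero => simp
    | succ n ih =>
      have : Finset.Ico a (a + (n + 1 : ℕ)) = insert (a + n) (Finset.Ico a (a + n)) := by
        ext x; simp only [Finset.mem_Ico, Finset.mem_insert]; push_cast; omega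
      rw [this, Finset.sum_insert (by simp), ih]
      push_cast
      ring_nf
  have h7 : Finset.Icc (-(w.length : ℤ)) w.length =
      Finset.Ico (-(w.length : ℤ)) (-(w.length : ℤ) + (2 * w.length + 1 : ℕ)) := by
    ext x; simp only [Finset.mem_Icc, Finset.mem_Ico]; push_cast; omega
  rw [h7, h6 fun j => (j.negOnePow : ℤ) * rk (F w) i j e, h4,
    show (-(w.length : ℤ) + (2 * w.length + 1 : ℕ) - 1) = w.length by push_cast; ring, h3]
  simp

/-! ## The specialization -/

theorem unit_T_zpow (n : ℤ) : ((LaurentPolynomial.isUnit_T 1).unit ^ n :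
    GaussianInt[T;T⁻¹]ˣ).val = LaurentPolynomial.T n := by
  have h1 : ∀ n : ℕ, ((LaurentPolynomial.isUnit_T 1).unit ^ n :
      GaussianInt[T;T⁻¹]ˣ).val = LaurentPolynomial.T n := fun n => by
    rw [Units.val_pow_eq_pow_val, IsUnit.unit_spec, LaurentPolynomial.T_pow, mul_one]
  obtain ⟨k, rfl | rfl⟩ := n.eq_nat_or_neg
  · rw [zpow_natCast, h1]
  · rw [zpow_neg, zpow_natCast, ← Units.mul_eq_one_iff_inv_eq, h1, ← LaurentPolynomial.T_add,
      add_neg_cancel, LaurentPolynomial.T_zero]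

theorem unitI_sq : unitI ^ (2 : ℤ) = -1 := by
  rw [show (2 : ℤ) = (2 : ℕ) from rfl, zpow_natCast, pow_two]
  refine Units.ext ?_
  change LaurentPolynomial.C I * LaurentPolynomial.C I = -1
  rw [← map_mul, show I * I = -1 from rfl, map_neg, map_one]

/-- `-√-1 t_2^{1/2}` as a unit. -/
def cUnit : GaussianInt[T;T⁻¹]ˣ := unitI⁻¹ * (LaurentPolynomial.isUnit_T 1).unit

theorem spec_mono (a b : ℤ) :
    spec (mono a b) = LaurentPolynomial.T a *
      ((unitI ^ b : GaussianInt[T;T⁻¹]ˣ) : GaussianInt[T;T⁻¹]) := by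
  rw [mono, spec, LaurentPolynomial.eval₂_C_mul_T, LaurentPolynomial.eval₂_T, unit_T_zpow]

/-- The normalizing factor `(t_2 t_3⁻¹)^{n/2}` becomes the `n`-th power of `-√-1 t_2^{1/2}`. -/
theorem spec_mono_neg (n : ℤ) : spec (mono n (-n)) = (cUnit ^ n : GaussianInt[T;T⁻¹]ˣ) := by
  rw [spec_mono, cUnit, mul_zpow, inv_zpow', Units.val_mul, unit_T_zpow, mul_comm]

theorem spec_mono_even (i j : ℤ) :
    spec (mono (-2 * i) (2 * j)) = ((j.negOnePow : ℤ) : GaussianInt[T;T⁻¹]) *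
      LaurentPolynomial.T (-2 * i) := by
  rw [spec_mono, zpow_mul, unitI_sq, mul_comm]
  congr 1
  have := congrArg Units.val (map_zpow (Units.map (Int.castRingHom GaussianInt[T;T⁻¹]).toMonoidHom)
    (-1) j)
  rw [← Int.negOnePow_def] at this
  have h1 : Units.map (Int.castRingHom GaussianInt[T;T⁻¹]).toMonoidHom (-1) = -1 :=
    Units.ext (by simp)
  rw [h1] at this
  exact this.symm

/-- The unit `-√-1 t_2^{1/2}`. -/
def cR : Rˣ := Units.map (HahnSeries.C : GaussianInt[T;T⁻¹] →+* R).toMonoidHom cUnit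

/-- The Euler characteristic of the Hochschild homology of `θ_u ⊗_P F_w`. -/
def chi {m : ℕ} (u : List (Fin m)) (w : Word m) : R :=
  ∑ᶠ j : ℤ, ((j.negOnePow : ℤ) : R) * ser (hh (thetas u (Fterm w j)))

theorem ser_zero : ser 0 = 0 := by
  have h : Tame 0 := ⟨0, fun i e h => absurd rfl h⟩
  have := ser_add h h
  rwa [add_zero, left_eq_add] at this

theorem chi_support {m : ℕ} (u : List (Fin m)) (w : Word m) :
    (Function.support fun j : ℤ => ((j.negOnePow : ℤ) : R) * ser (hh (thetas u (Fterm w j)))) ⊆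
      (Finset.Icc (-(w.length : ℤ)) w.length : Finset ℤ) := by
  intro j hj
  rw [Finset.mem_coe, Finset.mem_Icc, ← abs_le]
  by_contra h
  exact hj (by dsimp only; rw [hh_thetas_Fterm u w (not_le.1 h), ser_zero, mul_zero])

theorem laurent_eq_sum {f : ℤ → ℕ} {m : ℕ} (hf : ∀ i, f i ≠ 0 → 0 ≤ i ∧ i ≤ m) :
    laurent f = ∑ i ∈ Finset.range (m + 1), (f i : GaussianInt[T;T⁻¹]) *
      LaurentPolynomial.T (-2 * i) := by
  rw [laurent, finsum_eq_sum_of_support_subset (s := (Finset.range (m + 1)).map Nat.castEmbedding),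
    Finset.sum_map]
  · rfl
  · intro i hi
    have := hf i (fun h => hi (by simp [h]))
    rw [Finset.mem_coe, Finset.mem_map]
    exact ⟨i.toNat, Finset.mem_range.2 (by omega), Int.toNat_of_nonneg this.1⟩

/-- The factor `t_3^j` specializes to `(-1)^j`, so for each `i` and each power of `t_1` the sum over
`j` is an Euler characteristic, and the homology may be replaced by the terms. -/
theorem Yword_eq {m : ℕ} (w : Word m) : Yword w = (cR ^ (m + len w) : Rˣ) * chi [] w := by
  have h1 : ((cR ^ (m + len w) : Rˣ) : R) = HahnSeries.C ((cUnit ^ (m + len w) :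
      GaussianInt[T;T⁻¹]ˣ) : GaussianInt[T;T⁻¹]) := by
    rw [cR, ← map_zpow]; rfl
  ext1
  funext a
  rw [h1, HahnSeries.C_mul_eq_smul, HahnSeries.coeff_smul, smul_eq_mul]
  change spec ((X w).coeff a) = _
  rw [X, HahnSeries.C_mul_eq_smul, HahnSeries.coeff_smul, smul_eq_mul, map_mul, spec_mono_neg]
  congr 1
  rw [chi, finsum_eq_sum_of_support_subset _ (chi_support [] w), finsum_eq_sum_of_support_subset
    (s := Finset.range (m + 1) ×ˢ Finset.Icc (-(w.length : ℤ)) w.length) _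
    (fun p hp => hilb_support w fun h => hp (by rw [h, mul_zero])),
    HahnSeries.coeff_sum, HahnSeries.coeff_sum, map_sum]
  have h2 : ∀ j : ℤ, (((j.negOnePow : ℤ) : R) * ser (hh (thetas [] (Fterm w j)))).coeff a =
      ((j.negOnePow : ℤ) : GaussianInt[T;T⁻¹]) * (ser (hh (Fterm w j))).coeff a := fun j => by
    rw [← map_intCast (HahnSeries.C : GaussianInt[T;T⁻¹] →+* R), HahnSeries.C_mul_eq_smul,
      HahnSeries.coeff_smul, smul_eq_mul]; rfl
  have h3 : ∀ p : ℕ × ℤ, spec ((HahnSeries.C (mono (-2 * p.1) (2 * p.2)) *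
      hilb w p.1 p.2).coeff a) = if Even a then LaurentPolynomial.T (-2 * p.1) *
        (((p.2.negOnePow : ℤ) * (dimH w p.1 p.2 (a / 2)) : ℤ) : GaussianInt[T;T⁻¹]) else 0 :=
    fun p => by
      rw [HahnSeries.C_mul_eq_smul, HahnSeries.coeff_smul, smul_eq_mul, map_mul, spec_mono_even,
        hilb_coeff]
      split_ifs
      · rw [map_natCast]; push_cast; ring
      · rw [map_zero, mul_zero]
  rw [Finset.sum_congr rfl fun j _ => h2 j, Finset.sum_congr rfl fun p _ => h3 p]
  by_cases ha : Even a
  · simp only [if_pos ha, ser_coeff (tame_hh _)]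
    rw [Finset.sum_product]
    simp only [← Finset.mul_sum, ← Int.cast_sum, sum_negOnePow_dimH]
    simp only [Int.cast_sum, Finset.mul_sum]
    rw [Finset.sum_comm]
    refine Finset.sum_congr rfl fun j _ => ?_
    rw [laurent_eq_sum fun i hi => hh_ne_zero hi, Finset.mul_sum]
    refine Finset.sum_congr rfl fun i _ => ?_
    push_cast
    ring
  · simp only [if_neg ha, ser_coeff (tame_hh _), mul_zero, Finset.sum_const_zero]

/-- The regular bimodule is the only nonzero term of the complex of the empty word. -/
def FtermNil (m : ℕ) : Bim.Iso (Fterm ([] : Word m) 0) (triv m) where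
  e := LinearEquiv.refl ℂ (P m)
  mem h := h
  mem' h := h
  e_L _ _ := rfl
  e_R _ _ := rfl

theorem chi_nil {m : ℕ} (u : List (Fin m)) : chi u [] = bs u := by
  rw [chi, finsum_eq_sum_of_support_subset _ (chi_support u [])]
  simp only [List.length_nil, Nat.cast_zero, neg_zero, Finset.Icc_self, Finset.sum_singleton,
    Int.negOnePow_zero, Units.val_one, Int.cast_one, one_mul]
  rw [hh_congr (thetasIso (FtermNil m) u), bs]

theorem finite_const_mul {f : ℤ → R} (hf : (Function.support f).Finite) (a : R) :
    (Function.support fun j => a * f j).Finite :=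
  hf.subset fun j hj h => hj (by dsimp only; rw [h, mul_zero])

theorem finite_chi {m : ℕ} (u : List (Fin m)) (w : Word m) : (Function.support fun j : ℤ =>
    ((j.negOnePow : ℤ) : R) * ser (hh (thetas u (Fterm w j)))).Finite :=
  (Finset.finite_toSet _).subset (chi_support u w)

theorem chi_shift {m : ℕ} (u : List (Fin m)) (w : Word m) (k : ℤ) : ∑ᶠ j : ℤ,
    ((j.negOnePow : ℤ) : R) * ser (hh (thetas u (Fterm w (j + k)))) =
      ((k.negOnePow : ℤ) : R) * chi u w := by
  rw [chi]
  refine (finsum_comp_equiv (Equiv.addRight k).symm).symm.trans ?_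
  rw [mul_finsum' _ _ (finite_chi u w)]
  refine finsum_congr fun j => ?_
  simp only [Equiv.addRight_symm]
  simp only [Equiv.coe_addRight]
  rw [neg_add_cancel_right, ← sub_eq_add_neg, Int.negOnePow_sub]
  push_cast
  ring

theorem finite_chi_shift {m : ℕ} (u : List (Fin m)) (w : Word m) (k : ℤ) :
    (Function.support fun j : ℤ =>
      ((j.negOnePow : ℤ) : R) * ser (hh (thetas u (Fterm w (j + k))))).Finite := by
  refine ((finite_chi u w).preimage (f := fun j => j + k)
    (add_left_injective k).injOn).subset fun j hj h => hj ?_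
  have h1 : (((j + k).negOnePow : ℤ) : R) * ser (hh (thetas u (Fterm w (j + k)))) = 0 := h
  dsimp only
  rw [Int.negOnePow_add] at h1
  have h2 : ((k.negOnePow : ℤ) : R) * ((k.negOnePow : ℤ) : R) = 1 := by
    rw [← Int.cast_mul, ← Units.val_mul, Int.units_mul_self, Units.val_one, Int.cast_one]
  push_cast at h1
  linear_combination ((k.negOnePow : ℤ) : R) * h1 -
    ((j.negOnePow : ℤ) : R) * ser (hh (thetas u (Fterm w (j + k)))) * h2

/-- The terms of `F_σ F_w` are those of `θ F_w⟨1⟩` and, one cohomological degree higher, of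
`F_w⟨1⟩`. The shift gives `t_1⁻¹` and the change of degree gives the sign. The new `θ` stands
between `θ_u` and `F_w`, so it is appended to `u`. -/
theorem chi_pos {m : ℕ} (u : List (Fin m)) (r : Fin m) (w : Word m) :
    chi u ((r, true) :: w) = t₁half (-2) * (chi (u ++ [r]) w - chi u w) := by
  have h1 : ∀ j : ℤ, ((j.negOnePow : ℤ) : R) * ser (hh (thetas u (Fterm ((r, true) :: w) j))) =
      t₁half (-2) * (((j.negOnePow : ℤ) : R) * ser (hh (thetas (u ++ [r]) (Fterm w j)))) +
        t₁half (-2) * (((j.negOnePow : ℤ) : R) * ser (hh (thetas u (Fterm w (j + -1))))) := by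
    intro j
    rw [← hh_congr ((thetasSum _ _ u).symm.trans (thetasIso (FtermPos r w j) u)), ser_hh_sum,
      hh_congr (thetasShift _ _ u), hh_congr (thetasShift _ _ u), ser_hh_shift, ser_hh_shift,
      thetas_append, thetas_cons, ← sub_eq_add_neg]
    rw [show (2 * -1 : ℤ) = -2 by norm_num]
    change _ = t₁half (-2) * (_ * ser (hh (thetas u (Bim.theta (simpleRoot r) (Fterm w j))))) + _
    ring
  rw [chi, finsum_congr h1, finsum_add_distrib, ← mul_finsum' _ _ (finite_chi _ _),
    ← mul_finsum' _ _ (finite_chi_shift _ _ _), chi_shift, ← chi]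
  · rw [Int.negOnePow_neg, Int.negOnePow_one]; push_cast; ring
  · exact finite_const_mul (finite_chi _ _) _
  · exact finite_const_mul (finite_chi_shift _ _ _) _

theorem chi_neg {m : ℕ} (u : List (Fin m)) (r : Fin m) (w : Word m) :
    chi u ((r, false) :: w) = chi (u ++ [r]) w - t₁half 2 * chi u w := by
  have h1 : ∀ j : ℤ, ((j.negOnePow : ℤ) : R) * ser (hh (thetas u (Fterm ((r, false) :: w) j))) =
      t₁half 2 * (((j.negOnePow : ℤ) : R) * ser (hh (thetas u (Fterm w (j + 1))))) +
        ((j.negOnePow : ℤ) : R) * ser (hh (thetas (u ++ [r]) (Fterm w j))) := by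
    intro j
    rw [← hh_congr ((thetasSum _ _ u).symm.trans (thetasIso (FtermNeg r w j) u)), ser_hh_sum,
      hh_congr (thetasShift _ _ u), ser_hh_shift, thetas_append, thetas_cons]
    change _ * (_ + ser (hh (thetas u (Bim.theta (simpleRoot r) (Fterm w j))))) = _ +
      _ * ser (hh (thetas u (Bim.theta (simpleRoot r) (Fterm w j))))
    rw [show (2 * 1 : ℤ) = 2 by norm_num]
    ring
  rw [chi, finsum_congr h1, finsum_add_distrib, ← mul_finsum' _ _ (finite_chi_shift _ _ _),
    chi_shift, ← chi]
  · rw [Int.negOnePow_one]; push_cast; ring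
  · exact finite_const_mul (finite_chi_shift _ _ _) _
  · exact finite_chi _ _

end KR

namespace KR

/-! ## Quotients by the radical of a trace -/

section Radical

variable {S A T : Type} [CommRing S] [Ring A] [Algebra S A] [AddCommGroup T] [Module S T]
  (τ : A →ₗ[S] T) (hτ : ∀ x y, τ (x * y) = τ (y * x))

/-- The radical of a trace. -/
def radical : RingCon A where
  r x y := ∀ z, τ (x * z) = τ (y * z)
  iseqv := ⟨fun _ _ => rfl, fun h z => (h z).symm, fun h h' z => (h z).trans (h' z)⟩
  add' h h' z := by rw [add_mul, add_mul, map_add, map_add, h, h']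
  mul' {w x y z} h h' a := by
    -- Compatibility with right factors is where the trace property enters: the factor is moved
    -- cyclically before the second relation is applied.
    rw [mul_assoc, mul_assoc, h, hτ x, mul_assoc, h', ← mul_assoc, ← hτ x]

/-- The quotient of an algebra by the radical of a trace. -/
abbrev RadQuot : Type := (radical τ hτ).Quotient

/-- The quotient map. -/
def radMk : A →ₐ[S] RadQuot τ hτ := RingCon.mkₐ S (radical τ hτ)

/-- Relations need only be tested under the trace after multiplication by an arbitrary element; for
Bott-Samelson bimodules this is what isomorphisms provide. -/
theorem radMk_eq {x y : A} (h : ∀ z, τ (x * z) = τ (y * z)) : radMk τ hτ x = radMk τ hτ y :=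
  (radical τ hτ).eq.2 h

theorem radMk_surjective : Function.Surjective (radMk τ hτ) := (radical τ hτ).mk'_surjective

/-- The trace on the quotient. -/
def radTrace : RadQuot τ hτ →ₗ[S] T where
  toFun x := Quotient.liftOn' x τ fun x y h => by
    have := h 1
    rwa [mul_one, mul_one] at this
  map_add' x y := by
    obtain ⟨x, rfl⟩ := radMk_surjective τ hτ x
    obtain ⟨y, rfl⟩ := radMk_surjective τ hτ y
    exact map_add τ x y
  map_smul' c x := by
    obtain ⟨x, rfl⟩ := radMk_surjective τ hτ x
    exact map_smul τ c x

theorem radTrace_mk (x : A) : radTrace τ hτ (radMk τ hτ x) = τ x := rfl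

theorem radTrace_comm (x y : RadQuot τ hτ) :
    radTrace τ hτ (x * y) = radTrace τ hτ (y * x) := by
  obtain ⟨x, rfl⟩ := radMk_surjective τ hτ x
  obtain ⟨y, rfl⟩ := radMk_surjective τ hτ y
  rw [← map_mul, ← map_mul, radTrace_mk, radTrace_mk, hτ]

end Radical

/-! ## Relations in Hecke algebras -/

section Hecke

variable {S A : Type} [CommRing S] [Ring A] [Algebra S A] {x y : A} {t : S}

/-- The quadratic relation says that `(x - 1)(x - t) = t`. -/
theorem hecke_mul_inv (h : x * x = (1 + t) • x) {a b : S} (hab : a * b * t = 1) :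
    (a • (x - 1)) * (b • (x - t • 1)) = 1 := by
  have h1 : (x - 1) * (x - t • 1) = t • 1 := by
    simp only [sub_mul, mul_sub, one_mul, mul_one, mul_smul_comm]
    linear_combination (norm := module) h
  rw [smul_mul_smul_comm, h1, smul_smul, hab, one_smul]

theorem hecke_inv_mul (h : x * x = (1 + t) • x) {a b : S} (hab : a * b * t = 1) :
    (b • (x - t • 1)) * (a • (x - 1)) = 1 := by
  have h1 : (x - t • 1) * (x - 1) = t • 1 := by
    simp only [sub_mul, mul_sub, one_mul, mul_one, smul_mul_assoc]
    linear_combination (norm := module) h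
  rw [smul_mul_smul_comm, h1, smul_smul, mul_comm b a, hab, one_smul]

theorem hecke_skein (x : A) (a t : S) :
    a • (x - t • 1) + -a • (x - 1) = (a * (1 - t)) • (1 : A) := by
  module

theorem hecke_comm (h : x * y = y * x) (a : S) :
    (a • (x - 1)) * (a • (y - 1)) = (a • (y - 1)) * (a • (x - 1)) := by
  rw [smul_mul_smul_comm, smul_mul_smul_comm]
  congr 1
  simp only [sub_mul, mul_sub, one_mul, mul_one, h]
  abel

/-- Expanding `(x - 1)(y - 1)(x - 1)` and its mirror image, the mixed terms agree; the squares turn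
the difference into `x y x + t y - (y x y + t x)`. -/
theorem hecke_braid (hx : x * x = (1 + t) • x) (hy : y * y = (1 + t) • y)
    (h : x * y * x + t • y = y * x * y + t • x) (a : S) :
    (a • (x - 1)) * (a • (y - 1)) * (a • (x - 1)) =
      (a • (y - 1)) * (a • (x - 1)) * (a • (y - 1)) := by
  simp only [smul_mul_smul_comm]
  congr 1
  simp only [sub_mul, mul_sub, one_mul, mul_one]
  linear_combination (norm := module) h - hx + hy

end Hecke

/-! ## The trace on words -/

/-- The free algebra on the symbols `θ_1, …, θ_m`. -/
abbrev Free (m : ℕ) : Type := MonoidAlgebra R (FreeMonoid (Fin m))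

/-- The monomial of a word. -/
abbrev monom {m : ℕ} (v : List (Fin m)) : Free m := MonoidAlgebra.of R _ (FreeMonoid.ofList v)

theorem monom_mul {m : ℕ} (v v' : List (Fin m)) : monom v * monom v' = monom (v ++ v') :=
  (map_mul (MonoidAlgebra.of R (FreeMonoid (Fin m))) _ _).symm

theorem monom_nil {m : ℕ} : (monom [] : Free m) = 1 := map_one (MonoidAlgebra.of R _)

/-- The Hochschild homology, as a functional. -/
def tau (m : ℕ) : Free m →ₗ[R] R :=
  Finsupp.linearCombination R (fun v : FreeMonoid (Fin m) => bs v.toList) ∘ₗ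
    (MonoidAlgebra.coeffLinearEquiv R).toLinearMap

theorem tau_monom {m : ℕ} (v : List (Fin m)) : tau m (monom v) = bs v := by
  refine (Finsupp.linearCombination_single R (1 : R) (FreeMonoid.ofList v)).trans ?_
  rw [one_smul]; rfl

theorem free_induction {m : ℕ} {p : Free m → Prop} (x : Free m) (h1 : ∀ v, p (monom v))
    (h2 : ∀ x y, p x → p y → p (x + y)) (h3 : ∀ (c : R) x, p x → p (c • x)) : p x :=
  MonoidAlgebra.induction_on x h1 h2 h3

theorem tau_comm {m : ℕ} (x y : Free m) : tau m (x * y) = tau m (y * x) := by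
  induction x using free_induction with
  | h1 v =>
    induction y using free_induction with
    | h1 v' => rw [monom_mul, monom_mul, tau_monom, tau_monom, bs_append_comm]
    | h2 x y hx hy => rw [mul_add, add_mul, map_add, map_add, hx, hy]
    | h3 c x hx => rw [mul_smul_comm, smul_mul_assoc, map_smul, map_smul, hx]
  | h2 x y hx hy => rw [mul_add, add_mul, map_add, map_add, hx, hy]
  | h3 c x hx => rw [mul_smul_comm, smul_mul_assoc, map_smul, map_smul, hx]

/-- The image of the Hecke algebra. -/
abbrev Hecke (m : ℕ) : Type := RadQuot (S := R) (A := Free m) (T := R) (tau m) tau_comm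

/-- The quotient map. -/
abbrev toHecke (m : ℕ) : Free m →ₐ[R] Hecke m := radMk (S := R) (A := Free m) (T := R) (tau m) tau_comm

theorem toHecke_eq {m : ℕ} {x y : Free m}
    (h : ∀ v, tau m (x * monom v) = tau m (y * monom v)) : toHecke m x = toHecke m y := by
  refine radMk_eq _ _ fun z => ?_
  induction z using free_induction with
  | h1 v => exact h v
  | h2 x y hx hy => rw [mul_add, mul_add, map_add, map_add, hx, hy]
  | h3 c x hx => rw [mul_smul_comm, mul_smul_comm, map_smul, map_smul, hx]

/-- The Kazhdan-Lusztig generators. -/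
def kl {m : ℕ} (r : Fin m) : Hecke m := toHecke m (monom [r])

theorem kl_sq {m : ℕ} (r : Fin m) : kl r * kl r = (1 + t₁half 2) • kl r := by
  rw [kl, ← map_mul, ← map_smul]
  refine toHecke_eq fun v => ?_
  rw [smul_mul_assoc, map_smul, monom_mul, monom_mul, monom_mul, tau_monom, tau_monom]
  exact bs_sq r v

theorem kl_comm {m : ℕ} {r s : Fin m} (h : r.val + 1 < s.val) : kl r * kl s = kl s * kl r := by
  refine (map_mul (toHecke m) _ _).symm.trans (.trans ?_ (map_mul (toHecke m) _ _))
  refine toHecke_eq fun v => ?_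
  rw [monom_mul, monom_mul, monom_mul, monom_mul, tau_monom, tau_monom]
  exact bs_comm h v

theorem kl_braid {m : ℕ} {r s : Fin m} (h : r.val + 1 = s.val) :
    kl r * kl s * kl r + t₁half 2 • kl s = kl s * kl r * kl s + t₁half 2 • kl r := by
  suffices h1 : toHecke m (monom [r] * monom [s] * monom [r] + t₁half 2 • monom [s]) =
      toHecke m (monom [s] * monom [r] * monom [s] + t₁half 2 • monom [r]) by
    rwa [map_add, map_add, map_mul, map_mul, map_mul, map_mul, map_smul, map_smul] at h1
  refine toHecke_eq fun v => ?_
  simp only [add_mul, smul_mul_assoc, map_add, map_smul, monom_mul, tau_monom]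
  exact bs_braid h v

theorem t₁half_mul (a b : ℤ) : t₁half a * t₁half b = t₁half (a + b) := by
  rw [t₁half, t₁half, HahnSeries.single_mul_single, one_mul]; rfl

theorem t₁half_zero : t₁half 0 = 1 := rfl

theorem t₂half_mul (a b : ℤ) : t₂half a * t₂half b = t₂half (a + b) := by
  rw [t₂half, t₂half, ← map_mul, ← LaurentPolynomial.T_add]; rfl

theorem iR_mul : iR * iR = -1 := by
  rw [iR, ← map_mul, ← map_mul, show I * I = -1 from rfl, map_neg, map_neg, map_one, map_one]

theorem cR_val : (cR : R) = -iR * t₂half 1 := by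
  change HahnSeries.C (LaurentPolynomial.C (-I) * LaurentPolynomial.T 1) = _
  rw [map_mul, map_neg, map_neg]; rfl

theorem cR_inv : ((cR⁻¹ : Rˣ) : R) = iR * t₂half (-1) := by
  rw [← Units.mul_eq_one_iff_inv_eq, cR_val]
  have := t₂half_mul 1 (-1)
  rw [add_neg_cancel, t₂half_zero] at this
  linear_combination (-1 : R) * iR * iR * this - iR_mul

/-- The elements of the free algebra giving the images of the braid generators. -/
def letter {m : ℕ} (a : Fin m × Bool) : Free m :=
  if a.2 then (cR * t₁half (-2)) • (monom [a.1] - 1)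
  else ((cR⁻¹ : Rˣ) : R) • (monom [a.1] - t₁half 2 • 1)

/-- Each letter absorbs one factor `c^{±1}`. The statement carries a general `u` because the
recursion on `w` moves a `θ` from the word into `u`. -/
theorem chi_eq {m : ℕ} (u : List (Fin m)) (w : Word m) :
    ((cR ^ len w : Rˣ) : R) * chi u w = tau m (monom u * (w.map letter).prod) := by
  induction w generalizing u with
  | nil =>
    rw [List.map_nil, List.prod_nil, mul_one, tau_monom, chi_nil, len, List.map_nil, List.sum_nil,
      zpow_zero, Units.val_one, one_mul]
  | cons a w ih =>
    obtain ⟨r, b⟩ := a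
    have h1 : ∀ z : Free m, monom u * (monom [r] * z) = monom (u ++ [r]) * z := fun z => by
      rw [← mul_assoc, monom_mul]
    rw [List.map_cons, List.prod_cons]
    cases b with
    | true =>
      have h2 : len ((r, true) :: w) = 1 + len w := by simp [len]
      have h3 : letter (r, true) = (cR * t₁half (-2)) • (monom [r] - 1) := if_pos rfl
      rw [h2, chi_pos, zpow_one_add, Units.val_mul, h3, smul_mul_assoc,
        mul_smul_comm, map_smul, sub_mul (monom [r]), mul_sub (monom u), h1, one_mul, map_sub, ← ih, ← ih,
        smul_eq_mul]
      ring
    | false =>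
      have h2 : len ((r, false) :: w) = -1 + len w := by simp [len]
      have h3 : letter (r, false) = ((cR⁻¹ : Rˣ) : R) • (monom [r] - t₁half 2 • 1) :=
        if_neg (by simp)
      rw [h2, chi_neg, zpow_add, zpow_neg_one, Units.val_mul, h3,
        smul_mul_assoc, mul_smul_comm, map_smul, sub_mul (monom [r]), mul_sub (monom u), h1, smul_mul_assoc, one_mul,
        mul_smul_comm, map_sub, map_smul, ← ih, ← ih, smul_eq_mul, smul_eq_mul]
      ring

theorem tau_letter_pos {m : ℕ} (r : Fin m) (x : Free m) :
    tau m (letter (r, true) * x) = cR * t₁half (-2) * (tau m (monom [r] * x) - tau m x) := by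
  have h3 : letter (r, true) = (cR * t₁half (-2)) • (monom [r] - 1) := if_pos rfl
  rw [h3, smul_mul_assoc, map_smul, sub_mul (monom [r]), one_mul, map_sub, smul_eq_mul]

theorem tau_letter_neg {m : ℕ} (r : Fin m) (x : Free m) :
    tau m (letter (r, false) * x) =
      ((cR⁻¹ : Rˣ) : R) * (tau m (monom [r] * x) - t₁half 2 * tau m x) := by
  have h3 : letter (r, false) = ((cR⁻¹ : Rˣ) : R) • (monom [r] - t₁half 2 • 1) :=
    if_neg (by simp)
  rw [h3, smul_mul_assoc, map_smul, sub_mul (monom [r]), smul_mul_assoc, one_mul, map_sub, map_smul,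
    smul_eq_mul, smul_eq_mul]

theorem cR_mul_mul : (cR * t₁half (-2)) * ((cR⁻¹ : Rˣ) : R) * t₁half 2 = 1 := by
  have h1 : (cR : R) * ((cR⁻¹ : Rˣ) : R) = 1 := cR.mul_inv
  have h2 := t₁half_mul (-2) 2
  rw [neg_add_cancel, t₁half_zero] at h2
  linear_combination t₁half (-2) * t₁half 2 * h1 + h2

theorem toHecke_letter_pos {m : ℕ} (r : Fin m) :
    toHecke m (letter (r, true)) = (cR * t₁half (-2)) • (kl r - 1) := by
  rw [letter, if_pos rfl, map_smul, map_sub, map_one]; rfl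

theorem toHecke_letter_neg {m : ℕ} (r : Fin m) :
    toHecke m (letter (r, false)) = ((cR⁻¹ : Rˣ) : R) • (kl r - t₁half 2 • 1) := by
  rw [letter, if_neg (by simp), map_smul, map_sub, map_smul, map_one]; rfl

/-- The images of the braid generators. -/
def braidUnit {m : ℕ} (r : Fin m) : (Hecke m)ˣ where
  val := toHecke m (letter (r, true))
  inv := toHecke m (letter (r, false))
  val_inv := by
    rw [toHecke_letter_pos, toHecke_letter_neg]
    exact hecke_mul_inv (kl_sq r) cR_mul_mul
  inv_val := by
    rw [toHecke_letter_pos, toHecke_letter_neg]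
    exact hecke_inv_mul (kl_sq r) cR_mul_mul

/-- The map from the braid group to the Hecke algebra. -/
def braidHecke (m : ℕ) : Braid m →* (Hecke m)ˣ :=
  PresentedGroup.toGroup (f := braidUnit) (by
    rintro x (⟨i, j, h, rfl⟩ | ⟨i, j, h, rfl⟩)
    · rw [map_mul, map_inv, mul_inv_eq_one]
      simp only [map_mul, FreeGroup.lift_apply_of]
      refine Units.ext ?_
      simp only [Units.val_mul, braidUnit, toHecke_letter_pos]
      exact hecke_comm (S := R) (kl_comm h) _
    · rw [map_mul, map_inv, mul_inv_eq_one]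
      simp only [map_mul, FreeGroup.lift_apply_of]
      refine Units.ext ?_
      simp only [Units.val_mul, braidUnit, toHecke_letter_pos]
      exact hecke_braid (kl_sq i) (kl_sq j) (kl_braid h) _)

theorem braidHecke_σ {m : ℕ} (r : Fin m) : braidHecke m (σ r) = braidUnit r :=
  PresentedGroup.toGroup.of _

theorem braidHecke_braidOf {m : ℕ} (w : Word m) :
    (braidHecke m (braidOf w) : Hecke m) = toHecke m (w.map letter).prod := by
  have h1 : braidHecke m (braidOf w) =
      (w.map fun x => cond x.2 (braidUnit x.1) (braidUnit x.1)⁻¹).prod := rfl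
  rw [h1, ← Units.coeHom_apply, map_list_prod, map_list_prod, List.map_map, List.map_map]
  congr 1
  refine List.map_congr_left fun a _ => ?_
  obtain ⟨r, b⟩ := a
  cases b <;> rfl

/-- The trace of a braid. -/
def braidTrace {m : ℕ} (b : Braid m) : R := radTrace (S := R) (A := Free m) (T := R) (tau m) tau_comm (braidHecke m b : Hecke m)

/-- The right side sees only the braid, so this is the independence of the word; invariance under
conjugation is then the trace property. -/
theorem Yword_eq_trace {m : ℕ} (w : Word m) :
    Yword w = (cR : R) ^ m * braidTrace (braidOf w) := by
  rw [Yword_eq, braidTrace, braidHecke_braidOf, radTrace_mk, ← one_mul (w.map letter).prod,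
    ← monom_nil, ← chi_eq, zpow_add, Units.val_mul, mul_assoc, zpow_natCast, Units.val_pow_eq_pow_val]

theorem Y_eq_trace {m : ℕ} (b : Braid m) : Y b = (cR : R) ^ m * braidTrace b := by
  rw [Y, Yword_eq_trace, braidOf_wordOf]

theorem Yword_eq_Y {m : ℕ} (w : Word m) : Yword w = Y (braidOf w) := by
  rw [Yword_eq_trace, Y_eq_trace]

theorem Y_mul_comm {m : ℕ} (b b' : Braid m) : Y (b * b') = Y (b' * b) := by
  rw [Y_eq_trace, Y_eq_trace, braidTrace, braidTrace, map_mul, map_mul, Units.val_mul,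
    Units.val_mul, radTrace_comm]

/-- The coefficients of the two crossings become `√-1 t_1^{-1/2}` and its negative. In `(θ - t_1) -
(θ - 1)` the generator cancels and `1 - t_1` remains. -/
theorem Y_skein {m : ℕ} (r : Fin m) (b b' : Braid m) :
    t₁half (-1) * t₂half 1 * Y (b * (σ r)⁻¹ * b') + t₁half 1 * t₂half (-1) * Y (b * σ r * b') =
      iR * (t₁half (-1) - t₁half 1) * Y (b * b') := by
  have h1 : (t₁half (-1) * t₂half 1) • toHecke m (letter (r, false)) +
      (t₁half 1 * t₂half (-1)) • toHecke m (letter (r, true)) =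
        (iR * (t₁half (-1) - t₁half 1)) • (1 : Hecke m) := by
    rw [toHecke_letter_pos, toHecke_letter_neg, smul_smul, smul_smul, cR_val, cR_inv]
    have e1 := t₂half_mul 1 (-1)
    rw [add_neg_cancel, t₂half_zero] at e1
    have e2 : t₁half 1 * t₁half (-2) = t₁half (-1) := t₁half_mul 1 (-2)
    have e3 : t₁half (-1) * t₁half 2 = t₁half 1 := t₁half_mul (-1) 2
    have h2 : t₁half (-1) * t₂half 1 * (iR * t₂half (-1)) = iR * t₁half (-1) := by
      linear_combination t₁half (-1) * iR * e1
    have h3 : t₁half 1 * t₂half (-1) * (-iR * t₂half 1 * t₁half (-2)) = -(iR * t₁half (-1)) := by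
      linear_combination (-iR * t₁half 1 * t₁half (-2)) * e1 - iR * e2
    rw [h2, h3]
    refine (hecke_skein (S := R) (kl r) _ (t₁half 2)).trans (congrArg (· • (1 : Hecke m)) ?_)
    linear_combination -iR * e3
  have h2 := congrArg (fun z => radTrace (S := R) (A := Free m) (T := R) (tau m) tau_comm
    ((braidHecke m b : Hecke m) * z * (braidHecke m b' : Hecke m))) h1
  simp only [mul_add, add_mul, mul_smul_comm, smul_mul_assoc, map_add, map_smul, mul_one,
    smul_eq_mul] at h2
  have h3 : ∀ b : Braid m, Y b = (cR : R) ^ m *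
    radTrace (S := R) (A := Free m) (T := R) (tau m) tau_comm (braidHecke m b : Hecke m) := Y_eq_trace
  have h4 : ((braidHecke m (σ r) : (Hecke m)ˣ) : Hecke m) = toHecke m (letter (r, true)) := by
    rw [braidHecke_σ]; rfl
  have h5 : (((braidHecke m (σ r))⁻¹ : (Hecke m)ˣ) : Hecke m) =
      toHecke m (letter (r, false)) := by
    rw [braidHecke_σ]; rfl
  rw [h3, h3, h3, map_mul, map_mul, map_mul, map_mul, map_mul, map_inv, Units.val_mul,
    Units.val_mul, Units.val_mul, Units.val_mul, Units.val_mul, h4, h5]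
  linear_combination (cR : R) ^ m * h2

/-! ## Stabilization -/

/-- The inclusion of free algebras. -/
def freeInc (m : ℕ) : Free m →ₐ[R] Free (m + 1) :=
  MonoidAlgebra.mapDomainAlgHom R R (FreeMonoid.map Fin.castSucc)

theorem freeInc_monom {m : ℕ} (v : List (Fin m)) :
    freeInc m (monom v) = monom (v.map Fin.castSucc) := by
  refine (MonoidAlgebra.mapDomain_single ..).trans ?_
  rfl

theorem freeInc_letter {m : ℕ} (r : Fin m) (b : Bool) :
    freeInc m (letter (r, b)) = letter (r.castSucc, b) := by
  cases b
  · rw [letter, letter, if_neg (by simp), if_neg (by simp), map_smul, map_sub, map_smul, map_one,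
      freeInc_monom]
    rfl
  · rw [letter, letter, if_pos rfl, if_pos rfl, map_smul, map_sub, map_one, freeInc_monom]
    rfl

/-- The linear extension of `bs_castSucc`, with `g` eliminated by clearing the denominator `1 -
t_1`. -/
theorem tau_freeInc {m : ℕ} (x : Free m) :
    (1 - t₁half 2) * tau (m + 1) (freeInc m x) = (1 + t₂half (-2) * t₁half 2) * tau m x ∧
    (1 - t₁half 2) * tau (m + 1) (monom [Fin.last m] * freeInc m x) =
      (1 + t₂half (-2) * t₁half 4) * tau m x := by
  induction x using free_induction with
  | h1 v =>
    obtain ⟨g, h1, h2, h3⟩ := bs_castSucc v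
    rw [freeInc_monom, monom_mul, List.singleton_append, tau_monom, tau_monom, tau_monom, h2, h3,
      ← h1]
    constructor <;> ring
  | h2 x y hx hy =>
    rw [map_add, mul_add, map_add, map_add, map_add, mul_add, mul_add, mul_add, mul_add, hx.1, hx.2,
      hy.1, hy.2]
    exact ⟨rfl, rfl⟩
  | h3 c x hx =>
    rw [map_smul, mul_smul_comm, map_smul, map_smul, map_smul, smul_eq_mul, smul_eq_mul,
      smul_eq_mul]
    exact ⟨by linear_combination c * hx.1, by linear_combination c * hx.2⟩

theorem ι_braidOf {m : ℕ} (w : Word m) :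
    ι m (braidOf w) = braidOf (w.map fun a => (a.1.castSucc, a.2)) := by
  have h1 : ∀ {k : ℕ} (w : Word k), braidOf w = (w.map fun x => cond x.2 (σ x.1) (σ x.1)⁻¹).prod := by
    intro k w
    have : PresentedGroup.mk (braidRels k) = FreeGroup.lift σ := by
      ext x; rw [FreeGroup.lift_apply_of]; rfl
    rw [braidOf, this]; rfl
  rw [h1, h1, map_list_prod, List.map_map, List.map_map]
  congr 1
  refine List.map_congr_left fun a _ => ?_
  obtain ⟨r, b⟩ := a
  have h2 : ι m (σ r) = σ r.castSucc := PresentedGroup.toGroup.of _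
  cases b
  · exact (map_inv _ _).trans (congrArg _ h2)
  · exact h2

theorem one_sub_ne_zero : (1 - t₁half 2 : R) ≠ 0 := by
  intro h
  have h1 := congrArg (HahnSeries.coeff · 0) h
  have h2 : (1 - t₁half 2 : R).coeff 0 = 1 := by
    rw [HahnSeries.coeff_sub, HahnSeries.coeff_one, if_pos rfl, t₁half,
      HahnSeries.coeff_single_of_ne (by norm_num), sub_zero]
  beta_reduce at h1
  rw [h2, HahnSeries.coeff_zero] at h1
  exact one_ne_zero h1

theorem cR_sq : (cR : R) * cR * t₂half (-2) = -1 := by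
  have h1 := t₂half_mul 1 1
  have h2 := t₂half_mul (1 + 1) (-2)
  rw [← h1, show (1 + 1 + -2 : ℤ) = 0 by norm_num, t₂half_zero] at h2
  rw [cR_val]
  linear_combination iR * iR * h2 + iR_mul

theorem exists_braidOf {m : ℕ} (b : Braid m) : ∃ w, braidOf w = b := ⟨_, braidOf_wordOf b⟩

theorem braidTrace_stab {m : ℕ} (w : Word m) (s : Bool) :
    braidTrace (braidOf (w.map (fun a => (a.1.castSucc, a.2)) ++ [(Fin.last m, s)])) =
      tau (m + 1) (letter (Fin.last m, s) * freeInc m (w.map letter).prod) := by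
  rw [braidTrace, braidHecke_braidOf, radTrace_mk, List.map_append, List.prod_append,
    List.map_singleton, List.prod_singleton, tau_comm, map_list_prod, List.map_map, List.map_map]
  congr 4
  exact funext fun a => (freeInc_letter a.1 a.2).symm

theorem braidOf_append {m : ℕ} (w w' : Word m) : braidOf (w ++ w') = braidOf w * braidOf w' := by
  rw [braidOf, ← FreeGroup.mul_mk, map_mul]; rfl

/-- The new strand contributes `c · c t_1⁻¹ ((1 + t_2⁻¹ t_1²) - (1 + t_2⁻¹ t_1)) / (1 - t_1) = -c²
t_2⁻¹`, which is `1` by `cR_sq`. -/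
theorem Y_stab_pos {m : ℕ} (b : Braid m) : Y (ι m b * σ (Fin.last m)) = Y b := by
  obtain ⟨w, rfl⟩ := exists_braidOf b
  have h1 : σ (Fin.last m) = braidOf [(Fin.last m, true)] := rfl
  rw [ι_braidOf, h1, ← braidOf_append, Y_eq_trace, braidTrace_stab, Y_eq_trace, braidTrace,
    braidHecke_braidOf, radTrace_mk]
  obtain ⟨h2, h3⟩ := tau_freeInc (w.map letter).prod
  refine mul_left_cancel₀ one_sub_ne_zero ?_
  rw [tau_letter_pos]
  have h4 := t₁half_mul (-2) 2
  rw [neg_add_cancel, t₁half_zero] at h4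
  have h5 : t₁half (-2) * t₁half 4 = t₁half 2 := t₁half_mul (-2) 4
  have h6 := cR_sq
  generalize tau m (w.map letter).prod = x at *
  rw [pow_succ]
  linear_combination (cR : R) ^ m * cR * cR * t₁half (-2) * (h3 - h2) +
    (cR : R) ^ m * cR * cR * t₂half (-2) * x * (h5 - h4) -
    (cR : R) ^ m * x * (1 - t₁half 2) * h6

/-- The new strand contributes `c c⁻¹ ((1 + t_2⁻¹ t_1²) - t_1 (1 + t_2⁻¹ t_1)) / (1 - t_1) = 1`. -/
theorem Y_stab_neg {m : ℕ} (b : Braid m) : Y (ι m b * (σ (Fin.last m))⁻¹) = Y b := by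
  obtain ⟨w, rfl⟩ := exists_braidOf b
  have h1 : (σ (Fin.last m))⁻¹ = braidOf [(Fin.last m, false)] := rfl
  rw [ι_braidOf, h1, ← braidOf_append, Y_eq_trace, braidTrace_stab, Y_eq_trace, braidTrace,
    braidHecke_braidOf, radTrace_mk]
  obtain ⟨h2, h3⟩ := tau_freeInc (w.map letter).prod
  refine mul_left_cancel₀ one_sub_ne_zero ?_
  rw [tau_letter_neg]
  have h4 : t₁half 2 * t₁half 2 = t₁half 4 := t₁half_mul 2 2
  have h5 : (cR : R) * ((cR⁻¹ : Rˣ) : R) = 1 := cR.mul_inv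
  generalize tau m (w.map letter).prod = x at *
  rw [pow_succ]
  linear_combination (cR : R) ^ m * cR * ((cR⁻¹ : Rˣ) : R) * (h3 - t₁half 2 * h2) +
    (cR : R) ^ m * x * (1 - t₁half 2) * h5 -
    (cR : R) ^ m * cR * ((cR⁻¹ : Rˣ) : R) * x * t₂half (-2) * h4

theorem Y_unknot : Y (1 : Braid 0) = 1 := by
  have h1 : (1 : Braid 0) = braidOf [] := (map_one _).symm
  rw [h1, Y_eq_trace, braidTrace, braidHecke_braidOf, radTrace_mk, List.map_nil, List.prod_nil,
    ← monom_nil, tau_monom, bs_nil_zero, pow_zero, one_mul]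

theorem isLinkInvariant_Y : IsLinkInvariant fun m (b : Braid m) => Y b where
  conj _ := Y_mul_comm
  stab_pos _ := Y_stab_pos
  stab_neg _ := Y_stab_neg

end KR

namespace KR

/-! ## Uniqueness of the HOMFLYPT polynomial -/

theorem braid_induction {m : ℕ} {p : Braid m → Prop} (b : Braid m) (one : p 1)
    (pos : ∀ r b, p b → p (σ r * b)) (neg : ∀ r b, p b → p ((σ r)⁻¹ * b)) : p b := by
  obtain ⟨w, rfl⟩ := exists_braidOf b
  induction w with
  | nil => exact one
  | cons a w ih =>
    rw [← List.singleton_append, braidOf_append]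
    obtain ⟨r, b⟩ := a
    cases b
    · exact neg r _ ih
    · exact pos r _ ih

theorem σ_comm {m : ℕ} {r s : Fin m} (h : r.val + 1 < s.val) :
    (σ r * σ s : Braid m) = σ s * σ r := by
  have h1 : PresentedGroup.mk (braidRels m) _ = 1 :=
    PresentedGroup.one_of_mem (Or.inl ⟨r, s, h, rfl⟩)
  rwa [map_mul, map_inv, mul_inv_eq_one, map_mul, map_mul] at h1

theorem σ_braid {m : ℕ} {r s : Fin m} (h : r.val + 1 = s.val) :
    (σ r * σ s * σ r : Braid m) = σ s * σ r * σ s := by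
  have h1 : PresentedGroup.mk (braidRels m) _ = 1 :=
    PresentedGroup.one_of_mem (Or.inr ⟨r, s, h, rfl⟩)
  rwa [map_mul, map_inv, mul_inv_eq_one, map_mul, map_mul, map_mul, map_mul] at h1

theorem ι_σ {m : ℕ} (r : Fin m) : ι m (σ r) = σ r.castSucc := PresentedGroup.toGroup.of _

theorem σ_last_comm {m : ℕ} (c : Braid m) :
    σ (Fin.last (m + 1)) * ι (m + 1) (ι m c) = ι (m + 1) (ι m c) * σ (Fin.last (m + 1)) := by
  induction c using braid_induction with
  | one => rw [map_one, map_one, mul_one, one_mul]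
  | pos r b h =>
    have h1 : (σ r.castSucc.castSucc * σ (Fin.last (m + 1)) : Braid (m + 2)) = _ :=
      σ_comm (by simp)
    rw [map_mul, map_mul, ← mul_assoc, ι_σ, ι_σ, ← h1, mul_assoc, h, mul_assoc]
  | neg r b h =>
    have h1 : (σ r.castSucc.castSucc * σ (Fin.last (m + 1)) : Braid (m + 2)) = _ :=
      σ_comm (by simp)
    have h2 : σ (Fin.last (m + 1)) * (σ r.castSucc.castSucc)⁻¹ =
        (σ r.castSucc.castSucc : Braid (m + 2))⁻¹ * σ (Fin.last (m + 1)) := by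
      rw [eq_inv_mul_iff_mul_eq, ← mul_assoc, h1, mul_inv_cancel_right]
    rw [map_mul, map_mul, map_inv, map_inv, ← mul_assoc, ι_σ, ι_σ, h2, mul_assoc, h, mul_assoc]

/-- Reduces two occurrences of the last generator `t` to one, when everything between them but `s`
commutes with `t`. -/
theorem mul_braid_mul {G : Type} [Group G] {s t x y : G} (hx : t * x = x * t)
    (hy : t * y = y * t) (h : s * t * s = t * s * t) :
    t * (x * s * y * t) = x * s * t * (s * y) := by
  calc t * (x * s * y * t) = t * x * s * (y * t) := by simp only [mul_assoc]
    _ = x * (t * s * t) * y := by rw [hx, ← hy]; simp only [mul_assoc]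
    _ = x * s * t * (s * y) := by rw [← h]; simp only [mul_assoc]

section Span

variable {S H : Type} [CommRing S] [Ring H] [Algebra S H] {u v w : S}

/-- The span of the images of `B_{m+1}` and of `B_{m+1} σ_{m+1} B_{m+1}`. -/
def markovSpan {m : ℕ} (g : Braid (m + 1) →* H) : Submodule S H :=
  Submodule.span S (Set.range (fun a => g (ι m a)) ∪
    Set.range fun p : Braid m × Braid m => g (ι m p.1 * σ (Fin.last m) * ι m p.2))

variable {m : ℕ} (g : Braid (m + 1) →* H)

theorem mem_markovSpan_ι (a : Braid m) : g (ι m a) ∈ markovSpan (S := S) g :=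
  Submodule.subset_span (Or.inl ⟨a, rfl⟩)

theorem mem_markovSpan_σ (a a' : Braid m) :
    g (ι m a * σ (Fin.last m) * ι m a') ∈ markovSpan (S := S) g :=
  Submodule.subset_span (Or.inr ⟨(a, a'), rfl⟩)

variable {g}

theorem markovSpan_induction {p : (x : H) → x ∈ markovSpan (S := S) g → Prop} {x : H}
    (hx : x ∈ markovSpan g) (inc : ∀ a, p (g (ι m a)) (mem_markovSpan_ι g a))
    (bim : ∀ a a', p (g (ι m a * σ (Fin.last m) * ι m a')) (mem_markovSpan_σ g a a'))
    (zero : p 0 (Submodule.zero_mem _))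
    (add : ∀ x y hx hy, p x hx → p y hy → p (x + y) (Submodule.add_mem _ hx hy))
    (smul : ∀ (c : S) x hx, p x hx → p (c • x) (Submodule.smul_mem _ c hx)) : p x hx := by
  refine Submodule.span_induction (p := p) ?_ zero add smul hx
  rintro x (⟨a, rfl⟩ | ⟨⟨a, a'⟩, rfl⟩)
  · exact inc a
  · exact bim a a'

theorem ι_mul_mem (a : Braid m) {x : H} (hx : x ∈ markovSpan (S := S) g) :
    g (ι m a) * x ∈ markovSpan (S := S) g := by
  induction hx using markovSpan_induction with
  | inc b => rw [← map_mul, ← map_mul]; exact mem_markovSpan_ι g _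
  | bim b b' =>
    rw [← map_mul, ← mul_assoc, ← mul_assoc, ← map_mul]
    exact mem_markovSpan_σ g _ _
  | zero => rw [mul_zero]; exact Submodule.zero_mem _
  | add x y _ _ hx hy => rw [mul_add]; exact Submodule.add_mem _ hx hy
  | smul c x _ hx => rw [mul_smul_comm]; exact Submodule.smul_mem _ c hx

theorem mul_ι_mem (a : Braid m) {x : H} (hx : x ∈ markovSpan (S := S) g) :
    x * g (ι m a) ∈ markovSpan (S := S) g := by
  induction hx using markovSpan_induction with
  | inc b => rw [← map_mul, ← map_mul]; exact mem_markovSpan_ι g _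
  | bim b b' =>
    rw [← map_mul, mul_assoc, ← map_mul]
    exact mem_markovSpan_σ g _ _
  | zero => rw [zero_mul]; exact Submodule.zero_mem _
  | add x y _ _ hx hy => rw [add_mul]; exact Submodule.add_mem _ hx hy
  | smul c x _ hx => rw [smul_mul_assoc]; exact Submodule.smul_mem _ c hx

theorem σ_mem : g (σ (Fin.last m)) ∈ markovSpan (S := S) g := by
  simpa using mem_markovSpan_σ (S := S) g 1 1

/-- Multiplying the skein relation by `σ` expresses `u σ²` through `σ` and `1`, and `u` is
invertible. -/
theorem σσ_mem (hu : IsUnit u) {r : Fin (m + 1)} (hr : r = Fin.last m)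
    (hg : u • g (σ r) + v • g (σ r)⁻¹ + w • (1 : H) = 0) :
    g (σ (Fin.last m)) * g (σ (Fin.last m)) ∈ markovSpan (S := S) g := by
  subst hr
  obtain ⟨u, rfl⟩ := hu
  have h1 : g (σ (Fin.last m)) * g (σ (Fin.last m))⁻¹ = 1 := by
    rw [← map_mul, mul_inv_cancel, map_one]
  have h2 := congrArg (g (σ (Fin.last m)) * ·) hg
  simp only [mul_add, mul_smul_comm, h1, mul_one, mul_zero] at h2
  rw [← Submodule.smul_mem_iff_of_isUnit _ u.isUnit]
  have h3 : (u : S) • (g (σ (Fin.last m)) * g (σ (Fin.last m))) =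
      -(v • (1 : H)) - w • g (σ (Fin.last m)) := by
    linear_combination (norm := module) h2
  rw [h3]
  refine Submodule.sub_mem _ (Submodule.neg_mem _ (Submodule.smul_mem _ _ ?_))
    (Submodule.smul_mem _ _ σ_mem)
  simpa using mem_markovSpan_ι (S := S) g 1

/-- The skein relation expresses `v σ⁻¹ x` through `σ x` and `x`, so only positive generators need
to be checked afterwards. -/
theorem σ_inv_mem (hv : IsUnit v) {r : Fin (m + 1)} {x : H}
    (hg : u • g (σ r) + v • g (σ r)⁻¹ + w • (1 : H) = 0) {W : Submodule S H} (hx : x ∈ W)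
    (h : g (σ r) * x ∈ W) : g (σ r)⁻¹ * x ∈ W := by
  obtain ⟨v, rfl⟩ := hv
  rw [← Submodule.smul_mem_iff_of_isUnit _ v.isUnit]
  have h2 := congrArg (· * x) hg
  simp only [add_mul, smul_mul_assoc, one_mul, zero_mul] at h2
  have h3 : (v : S) • (g (σ r)⁻¹ * x) = -(u • (g (σ r) * x)) - w • x := by
    linear_combination (norm := module) h2
  rw [h3]
  exact Submodule.sub_mem _ (Submodule.neg_mem _ (Submodule.smul_mem _ _ h))
    (Submodule.smul_mem _ _ hx)

theorem braid_zero_eq (b : Braid 0) : b = 1 := by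
  induction b using braid_induction with
  | one => rfl
  | pos r => exact r.elim0
  | neg r => exact r.elim0

/-- The span contains `1`; it remains to see that it is stable under left multiplication by
generators. Only the last generator is at issue, and there products `σ a σ a'` with `a` on fewer
strands. -/
theorem mem_markovSpan (hu : IsUnit u) (hv : IsUnit v) (m : ℕ) (g : Braid (m + 1) →* H)
    (hg : ∀ r, u • g (σ r) + v • g (σ r)⁻¹ + w • (1 : H) = 0) (b : Braid (m + 1)) :
    g b ∈ markovSpan (S := S) g := by
  induction m with
  | zero =>
    have h0 : ∀ x ∈ markovSpan (S := S) g, g (σ (Fin.last 0)) * x ∈ markovSpan (S := S) g := by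
      intro x hx
      induction hx using markovSpan_induction with
      | inc a => rw [braid_zero_eq a, map_one, map_one, mul_one]; exact σ_mem
      | bim a a' =>
        rw [braid_zero_eq a, braid_zero_eq a', map_one, mul_one, one_mul]
        exact σσ_mem hu rfl (hg _)
      | zero => rw [mul_zero]; exact Submodule.zero_mem _
      | add x y _ _ hx hy => rw [mul_add]; exact Submodule.add_mem _ hx hy
      | smul c x _ hx => rw [mul_smul_comm]; exact Submodule.smul_mem _ c hx
    induction b using braid_induction with
    | one => simpa using mem_markovSpan_ι (S := S) g 1
    | pos r b h =>
      rw [map_mul, show r = Fin.last 0 from Subsingleton.elim (α := Fin 1) _ _]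
      exact h0 _ h
    | neg r b h =>
      rw [map_mul]
      refine σ_inv_mem hv (hg r) h ?_
      rw [show r = Fin.last 0 from Subsingleton.elim (α := Fin 1) _ _]
      exact h0 _ h
  | succ m ih =>
    have h0 : ∀ x ∈ markovSpan (S := S) g,
        g (σ (Fin.last (m + 1))) * x ∈ markovSpan (S := S) g := by
      intro x hx
      induction hx using markovSpan_induction with
      | inc a => simpa using mem_markovSpan_σ (S := S) g 1 a
      | bim a a' =>
        rw [map_mul, ← mul_assoc]
        refine mul_ι_mem _ ?_
        -- By induction the image of `a` is a combination of images of `c` and `c σ_{m+1} c'`, with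
        -- `c, c'` on two strands fewer than the whole braid, so that the last generator commutes
        -- with them. The first kind leads to the square of the last generator, the second to the
        -- braid relation.
        have h1 := ih (g.comp (ι (m + 1))) (fun r => by
          have := hg r.castSucc
          rwa [← ι_σ, ← map_inv] at this) a
        rw [MonoidHom.comp_apply] at h1
        rw [map_mul]
        generalize g (ι (m + 1) a) = y at h1
        induction h1 using markovSpan_induction with
        | inc c =>
          rw [MonoidHom.comp_apply, ← mul_assoc, ← map_mul, σ_last_comm, map_mul, mul_assoc]
          exact ι_mul_mem _ (σσ_mem hu rfl (hg _))
        | bim c c' =>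
          rw [MonoidHom.comp_apply, ← map_mul, ← map_mul, map_mul (ι (m + 1)), map_mul (ι (m + 1)),
            ι_σ]
          have h2 : (σ (Fin.last m).castSucc * σ (Fin.last (m + 1)) * σ (Fin.last m).castSucc :
            Braid (m + 2)) = _ := σ_braid (by simp)
          have h3 : σ (Fin.last (m + 1)) * (ι (m + 1) (ι m c) * σ (Fin.last m).castSucc *
              ι (m + 1) (ι m c') * σ (Fin.last (m + 1))) =
              ι (m + 1) (ι m c * σ (Fin.last m)) * σ (Fin.last (m + 1)) *
                ι (m + 1) (σ (Fin.last m) * ι m c') := by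
            rw [map_mul, map_mul, ι_σ]
            exact mul_braid_mul (σ_last_comm c) (σ_last_comm c') h2
          rw [h3]
          exact mem_markovSpan_σ g _ _
        | zero => rw [zero_mul, mul_zero]; exact Submodule.zero_mem _
        | add x y _ _ hx hy => rw [add_mul, mul_add]; exact Submodule.add_mem _ hx hy
        | smul c x _ hx => rw [smul_mul_assoc, mul_smul_comm]; exact Submodule.smul_mem _ c hx
      | zero => rw [mul_zero]; exact Submodule.zero_mem _
      | add x y _ _ hx hy => rw [mul_add]; exact Submodule.add_mem _ hx hy
      | smul c x _ hx => rw [mul_smul_comm]; exact Submodule.smul_mem _ c hx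
    have h1 : ∀ r, ∀ x ∈ markovSpan (S := S) g, g (σ r) * x ∈ markovSpan (S := S) g := by
      intro r x hx
      induction r using Fin.lastCases with
      | last => exact h0 x hx
      | cast r => rw [← ι_σ]; exact ι_mul_mem _ hx
    induction b using braid_induction with
    | one => simpa using mem_markovSpan_ι (S := S) g 1
    | pos r b h => rw [map_mul]; exact h1 r _ h
    | neg r b h => rw [map_mul]; exact σ_inv_mem hv (hg r) h (h1 r _ h)

end Span

/-! ### Link invariants vanishing on the unknot -/

section Vanishing

variable {S T : Type} [CommRing S] [AddCommGroup T] [Module S T] {u v w : S}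
  {D : (m : ℕ) → Braid m → T}

/-- The linear extension of a function on a group to the group algebra. -/
def linExt {G : Type} [Group G] (S : Type) [CommRing S] {T : Type} [AddCommGroup T] [Module S T]
    (f : G → T) : MonoidAlgebra S G →ₗ[S] T :=
  Finsupp.linearCombination S f ∘ₗ (MonoidAlgebra.coeffLinearEquiv S).toLinearMap

theorem linExt_of {G : Type} [Group G] (f : G → T) (b : G) :
    linExt S f (MonoidAlgebra.of S G b) = f b :=
  (Finsupp.linearCombination_single S (1 : S) b).trans (one_smul S (f b))

theorem linExt_comm {G : Type} [Group G] {f : G → T} (hf : ∀ a b, f (a * b) = f (b * a))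
    (x y : MonoidAlgebra S G) : linExt S f (x * y) = linExt S f (y * x) := by
  induction x using MonoidAlgebra.induction_on with
  | of a =>
    induction y using MonoidAlgebra.induction_on with
    | of b => rw [← map_mul, ← map_mul, linExt_of, linExt_of, hf]
    | add x y hx hy => rw [mul_add, add_mul, map_add, map_add, hx, hy]
    | smul c x hx => rw [mul_smul_comm, smul_mul_assoc, map_smul, map_smul, hx]
  | add x y hx hy => rw [mul_add, add_mul, map_add, map_add, hx, hy]
  | smul c x hx => rw [mul_smul_comm, smul_mul_assoc, map_smul, map_smul, hx]

/-- Conjugation invariance makes the linear extension of `D` a trace; modulo its radical the skein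
relation is a quadratic relation, so `mem_markovSpan` leaves two kinds of braids. Values in an
arbitrary module are allowed so that the result also applies to a quotient. -/
theorem isLinkInvariant_eq_zero (hD : IsLinkInvariant D) (hu : IsUnit u) (hv : IsUnit v)
    (hw : IsUnit w) (h1 : D 0 1 = 0)
    (h : ∀ m (r : Fin m) (b b' : Braid m),
      u • D m (b * σ r * b') + v • D m (b * (σ r)⁻¹ * b') + w • D m (b * b') = 0)
    (m : ℕ) (b : Braid m) : D m b = 0 := by
  induction m with
  | zero => rw [braid_zero_eq b, h1]
  | succ m ih =>
    let τ := linExt S (D (m + 1))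
    have hτ : ∀ x y, τ (x * y) = τ (y * x) := linExt_comm (hD.conj (m + 1))
    let q : MonoidAlgebra S (Braid (m + 1)) →ₐ[S] RadQuot τ hτ := radMk τ hτ
    let g : Braid (m + 1) →* RadQuot τ hτ := q.toMonoidHom.comp (MonoidAlgebra.of S _)
    have hg : ∀ r, u • g (σ r) + v • g (σ r)⁻¹ + w • (1 : RadQuot τ hτ) = 0 := by
      intro r
      have h2 : q (u • MonoidAlgebra.of S _ (σ r) + v • MonoidAlgebra.of S _ (σ r)⁻¹ + w • 1) =
          q 0 := by
        refine radMk_eq τ hτ fun z => ?_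
        induction z using MonoidAlgebra.induction_on with
        | of b =>
          rw [add_mul, add_mul, smul_mul_assoc, smul_mul_assoc, smul_mul_assoc, one_mul, zero_mul,
            ← map_mul, ← map_mul, map_add, map_add, map_smul, map_smul, map_smul, map_zero]
          change u • linExt S _ _ + v • linExt S _ _ + w • linExt S _ _ = 0
          rw [linExt_of, linExt_of, linExt_of]
          simpa using h (m + 1) r 1 b
        | add x y hx hy => rw [mul_add, mul_add, map_add, map_add, hx, hy]
        | smul c x hx => rw [mul_smul_comm, mul_smul_comm, map_smul, map_smul, hx]
      rwa [map_add, map_add, map_smul, map_smul, map_smul, map_one, map_zero] at h2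
    have hb : ∀ b, radTrace τ hτ (g b) = D (m + 1) b := fun b => linExt_of _ b
    rw [← hb]
    have hgb := mem_markovSpan hu hv m g hg b
    generalize g b = x at hgb
    induction hgb using markovSpan_induction with
    | inc a =>
      rw [hb]
      -- The two crossings stabilize to `a`, where `D` vanishes by induction; what is left is `w • D
      -- (ι a) = 0`.
      have h2 := h (m + 1) (Fin.last m) (ι m a) 1
      rw [mul_one, mul_one, mul_one, hD.stab_pos, hD.stab_neg, ih, smul_zero, smul_zero, zero_add,
        zero_add] at h2
      exact hw.smul_eq_zero.1 h2
    | bim a a' =>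
      -- Conjugation turns `a σ a'` into `(a' a) σ`, a stabilization.
      rw [hb, hD.conj, ← mul_assoc, ← map_mul, hD.stab_pos, ih]
    | zero => rw [map_zero]
    | add x y _ _ hx hy => rw [map_add, hx, hy, add_zero]
    | smul c x _ hx => rw [map_smul, hx, smul_zero]

end Vanishing

end KR

namespace KR

/-! ## The specialization of the HOMFLYPT polynomial -/

/-- The inclusion of `ℤ[√-1][[t_1^{1/2}]]`. -/
def powR : PowerSeries GaussianInt →+* R :=
  (HahnSeries.ofPowerSeries ℤ GaussianInt[T;T⁻¹]).comp (PowerSeries.map LaurentPolynomial.C)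

theorem coeff_powR (f : PowerSeries GaussianInt) (a : ℤ) : (powR f).coeff a =
    if a < 0 then 0 else LaurentPolynomial.C (PowerSeries.coeff a.natAbs f) := by
  refine (PowerSeries.coeff_coe _ a).trans ?_
  rw [PowerSeries.coeff_map]

/-- `t_1^{a/2}` as a unit. -/
def t₁unit : Rˣ where
  val := t₁half 1
  inv := t₁half (-1)
  val_inv := by rw [t₁half_mul]; exact t₁half_zero
  inv_val := by rw [t₁half_mul]; exact t₁half_zero

theorem t₁unit_zpow (a : ℤ) : ((t₁unit ^ a : Rˣ) : R) = t₁half a := by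
  induction a using Int.induction_on with
  | zero => rw [zpow_zero]; exact t₁half_zero.symm
  | succ n ih => rw [zpow_add_one, Units.val_mul, ih]; exact t₁half_mul _ _
  | pred n ih => rw [zpow_sub_one, Units.val_mul, ih]; exact t₁half_mul _ _

/-- `t_2^{a/2}` as a unit. -/
def t₂unit : Rˣ where
  val := t₂half 1
  inv := t₂half (-1)
  val_inv := by rw [t₂half_mul]; exact t₂half_zero
  inv_val := by rw [t₂half_mul]; exact t₂half_zero

theorem t₂unit_zpow (a : ℤ) : ((t₂unit ^ a : Rˣ) : R) = t₂half a := by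
  induction a using Int.induction_on with
  | zero => rw [zpow_zero]; exact t₂half_zero.symm
  | succ n ih => rw [zpow_add_one, Units.val_mul, ih]; exact t₂half_mul _ _
  | pred n ih => rw [zpow_sub_one, Units.val_mul, ih]; exact t₂half_mul _ _

/-- The variable is `t_1^{1/2}`, so `X ^ 2` is `t_1`; the constant term `-√-1` is a unit of the
Gaussian integers. Thus `z` maps to a unit, as a map from `ℤ[l^{±1}, z^{±1}]` requires. -/
theorem isUnit_powerSeries :
    IsUnit (PowerSeries.C (-I) * (1 - PowerSeries.X ^ 2) : PowerSeries GaussianInt) := by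
  rw [PowerSeries.isUnit_iff_constantCoeff]
  have h1 : PowerSeries.constantCoeff (PowerSeries.C (-I) * (1 - PowerSeries.X ^ 2)) = -I := by
    simp
  rw [h1]
  exact IsUnit.of_mul_eq_one I (by rfl)

/-- The power series `-√-1 (1 - t_1)`. -/
def zSeries : (PowerSeries GaussianInt)ˣ := isUnit_powerSeries.unit

/-- The image of `l`. -/
def lUnit : Rˣ := t₁unit * t₂unit⁻¹

/-- The image of `z`. -/
def zUnit : Rˣ := Units.map powR.toMonoidHom zSeries * t₁unit⁻¹

theorem lUnit_val : (lUnit : R) = t₁half 1 * t₂half (-1) := rfl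

theorem zUnit_val : (zUnit : R) = -(iR * (t₁half (-1) - t₁half 1)) := by
  have h1 : (zUnit : R) = powR (PowerSeries.C (-I) * (1 - PowerSeries.X ^ 2)) * t₁half (-1) := rfl
  have h2 : powR PowerSeries.X = t₁half 1 := by
    rw [powR, RingHom.comp_apply, PowerSeries.map_X, HahnSeries.ofPowerSeries_X]; rfl
  have h3 : powR (PowerSeries.C (-I)) = -iR := by
    rw [powR, RingHom.comp_apply, PowerSeries.map_C, HahnSeries.ofPowerSeries_C, map_neg, map_neg]
    rfl
  have h4 : t₁half 1 * t₁half (-1) = 1 := t₁half_mul 1 (-1)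
  rw [h1, map_mul, map_sub, map_one, map_pow, h2, h3]
  linear_combination iR * t₁half 1 * h4

/-- The specialization of `ℤ[l^{±1}, z^{±1}]`. -/
def specH : HRing →+* R :=
  LaurentPolynomial.eval₂ (LaurentPolynomial.eval₂ (Int.castRingHom R) lUnit) zUnit

theorem specH_lPow (a : ℤ) : specH (lPow a) = ((lUnit ^ a : Rˣ) : R) := by
  rw [specH, lPow, LaurentPolynomial.eval₂_C, LaurentPolynomial.eval₂_T]

theorem specH_zVar : specH zVar = zUnit := by
  rw [specH, zVar, LaurentPolynomial.eval₂_T, zpow_one]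

/-- The coefficient of `t_1^{a/2} t_2^{b/2}`. -/
def coeffR (a b : ℤ) : R →+ GaussianInt where
  toFun x := (x.coeff a).coeff b
  map_zero' := rfl
  map_add' x y := by rw [HahnSeries.coeff_add]; rfl

theorem coeffR_mul (a b c d : ℤ) (f : PowerSeries GaussianInt) :
    coeffR a b (t₁half c * t₂half d * powR f) =
      if d = b ∧ c ≤ a then PowerSeries.coeff (a - c).natAbs f else 0 := by
  have h1 : (t₁half c * t₂half d * powR f).coeff a =
      LaurentPolynomial.T d * (powR f).coeff (a - c) := by
    have h2 : t₁half c * t₂half d = HahnSeries.single c (LaurentPolynomial.T d) := by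
      rw [t₁half, t₂half, HahnSeries.C_apply, HahnSeries.single_mul_single, add_zero, one_mul]
    rw [h2, HahnSeries.coeff_single_mul]
  change ((t₁half c * t₂half d * powR f).coeff a).coeff b = _
  rw [h1, coeff_powR]
  by_cases h3 : c ≤ a
  · rw [if_neg (by omega), mul_comm, ← LaurentPolynomial.single_eq_C_mul_T]
    by_cases h4 : d = b
    · rw [if_pos ⟨h4, h3⟩, h4]
      exact Finsupp.single_eq_same
    · rw [if_neg (fun h => h4 h.1)]
      exact Finsupp.single_eq_of_ne (Ne.symm h4)
  · rw [if_pos (by omega), mul_zero, if_neg (fun h => h3 h.2)]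
    rfl

theorem units_mul_zpow {A : Type} [CommRing A] (a b : Aˣ) (n : ℤ) :
    (a * b) ^ n = a ^ n * b ^ n := mul_zpow a b n

theorem lUnit_zpow (k : ℤ) : ((lUnit ^ k : Rˣ) : R) = t₁half k * t₂half (-k) := by
  rw [lUnit, units_mul_zpow, inv_zpow, ← zpow_neg, Units.val_mul, t₁unit_zpow, t₂unit_zpow]

theorem zUnit_zpow (n : ℤ) : ((zUnit ^ n : Rˣ) : R) =
    t₁half (-n) * powR ((zSeries ^ n : (PowerSeries GaussianInt)ˣ) : PowerSeries GaussianInt) := by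
  rw [zUnit, units_mul_zpow, inv_zpow, ← zpow_neg, Units.val_mul, t₁unit_zpow, ← map_zpow, mul_comm]
  rfl

/-- The lowest coefficients of the images of monomials. -/
theorem coeffR_specH (k n : ℤ) (q : ℤ[T;T⁻¹]) (n' : ℤ) :
    coeffR (k - n) (-k) (specH (LaurentPolynomial.C q * LaurentPolynomial.T n')) =
      (q.coeff k : GaussianInt) * if n ≤ n' then PowerSeries.coeff (n' - n).natAbs
        ((zSeries ^ n' : (PowerSeries GaussianInt)ˣ) : PowerSeries GaussianInt) else 0 := by
  rw [specH, LaurentPolynomial.eval₂_C_mul_T]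
  induction q using LaurentPolynomial.induction_on' with
  | add p q hp hq =>
    rw [map_add, add_mul, map_add, hp, hq, ← add_mul, ← Int.cast_add]; rfl
  | C_mul_T k' a =>
    rw [LaurentPolynomial.eval₂_C_mul_T, lUnit_zpow, zUnit_zpow, eq_intCast, ← zsmul_eq_mul,
      smul_mul_assoc, map_zsmul]
    -- The monomial `l^{k'} z^{n'}` goes to `t_1^{(k'-n')/2} t_2^{-k'/2}` times a power series in
    -- `t_1^{1/2}` with unit constant term.
    have h1 : t₁half k' * t₂half (-k') * (t₁half (-n') * powR
        ((zSeries ^ n' : (PowerSeries GaussianInt)ˣ) : PowerSeries GaussianInt)) =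
        t₁half (k' - n') * t₂half (-k') * powR
        ((zSeries ^ n' : (PowerSeries GaussianInt)ˣ) : PowerSeries GaussianInt) := by
      rw [sub_eq_add_neg, ← t₁half_mul]; ring
    rw [h1, coeffR_mul, ← LaurentPolynomial.single_eq_C_mul_T, zsmul_eq_mul]
    by_cases h2 : k' = k
    · subst h2
      rw [show ((AddMonoidAlgebra.single k' a : ℤ[T;T⁻¹]).coeff k') = a from
        Finsupp.single_eq_same]
      congr 1
      refine if_congr ⟨fun h => by omega, fun h => ⟨rfl, by omega⟩⟩ ?_ rfl
      congr 2
      omega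
    · rw [show ((AddMonoidAlgebra.single k' a : ℤ[T;T⁻¹]).coeff k) = 0 from
        Finsupp.single_eq_of_ne (Ne.symm h2), if_neg (fun h => h2 (by omega)), mul_zero,
        Int.cast_zero, zero_mul]

/-- Take the highest power `z^n` occurring and a monomial `l^k z^n` in it. The power of `t_2`
isolates `k`, and at `t_1^{(k-n)/2}` a monomial `l^k z^{n'}` contributes only if `n' ≥ n`, hence
only if `n' = n`. So the coefficient there is that of `l^k z^n` times a unit. -/
theorem specH_injective : Function.Injective specH := by
  rw [injective_iff_map_eq_zero]
  intro p hp
  by_contra hne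
  have hs : p.coeff.support.Nonempty := by
    rw [Finsupp.support_nonempty_iff]
    exact fun h => hne (LaurentPolynomial.ext fun a => by rw [h]; rfl)
  let n := p.coeff.support.max' hs
  have hn : p.coeff n ≠ 0 := Finsupp.mem_support_iff.1 (p.coeff.support.max'_mem hs)
  have hk : ∃ k, (p.coeff n).coeff k ≠ 0 := by
    by_contra! h
    exact hn (LaurentPolynomial.ext h)
  obtain ⟨k, hk⟩ := hk
  have hsum : p = ∑ n' ∈ p.coeff.support, LaurentPolynomial.C (p.coeff n') *
      LaurentPolynomial.T n' := by
    refine (AddMonoidAlgebra.sum_coeff_single p).symm.trans (Finset.sum_congr rfl fun a _ => ?_)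
    exact LaurentPolynomial.single_eq_C_mul_T _ _
  have h1 := congrArg (coeffR (k - n) (-k)) hp
  rw [hsum, map_sum, map_sum, map_zero, Finset.sum_eq_single n] at h1
  · rw [coeffR_specH, if_pos le_rfl, sub_self, Int.natAbs_zero,
      PowerSeries.coeff_zero_eq_constantCoeff_apply] at h1
    have h2 := (Units.isUnit (zSeries ^ n)).map PowerSeries.constantCoeff
    have h3 := (mul_eq_zero.1 h1).resolve_right h2.ne_zero
    exact hk (Int.cast_injective (α := GaussianInt) (h3.trans Int.cast_zero.symm))
  · intro n' hn' hne'
    rw [coeffR_specH, if_neg, mul_zero]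
    have := p.coeff.support.le_max' n' hn'
    exact fun h => hne' (le_antisymm this h)
  · exact fun h => absurd (p.coeff.support.max'_mem hs) h

theorem Y_skein_lz {m : ℕ} (r : Fin m) (b b' : Braid m) :
    (lUnit : R) * Y (b * σ r * b') + ((lUnit⁻¹ : Rˣ) : R) * Y (b * (σ r)⁻¹ * b') +
      zUnit * Y (b * b') = 0 := by
  have h1 := lUnit_zpow (-1)
  rw [zpow_neg_one, neg_neg] at h1
  rw [lUnit_val, h1, zUnit_val]
  linear_combination Y_skein r b b'

theorem isUnit_lPow (a : ℤ) : IsUnit (lPow a) :=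
  (LaurentPolynomial.isUnit_T a).map LaurentPolynomial.C

theorem isUnit_zVar : IsUnit zVar := LaurentPolynomial.isUnit_T 1

/-- The class of `Y` modulo the image is a link invariant with the skein relation, and it vanishes
on the unknot because `1` lies in the image. -/
theorem Y_mem_range {m : ℕ} (b : Braid m) : Y b ∈ specH.range := by
  let _ : Algebra HRing R := specH.toAlgebra
  let W : Submodule HRing R := LinearMap.range (Algebra.linearMap HRing R)
  have h1 : W.mkQ (Y b) = 0 := by
    refine isLinkInvariant_eq_zero (S := HRing) (T := R ⧸ W) (D := fun m b => W.mkQ (Y b))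
      (u := lPow 1) (v := lPow (-1)) (w := zVar) ⟨?_, ?_, ?_⟩ (isUnit_lPow _) (isUnit_lPow _)
      isUnit_zVar ?_ ?_ m b
    · exact fun m b b' => congrArg W.mkQ (isLinkInvariant_Y.conj m b b')
    · exact fun m b => congrArg W.mkQ (isLinkInvariant_Y.stab_pos m b)
    · exact fun m b => congrArg W.mkQ (isLinkInvariant_Y.stab_neg m b)
    · rw [Y_unknot]
      exact (Submodule.Quotient.mk_eq_zero W).2 ⟨1, map_one specH⟩
    · intro m r b b'
      have h2 : (lPow 1 • Y (b * σ r * b') + lPow (-1) • Y (b * (σ r)⁻¹ * b') +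
          zVar • Y (b * b') : R) = 0 := by
        have h3 := Y_skein_lz r b b'
        rwa [← zpow_neg_one, ← zpow_one lUnit, ← zpow_mul, one_mul, ← specH_lPow, ← specH_lPow,
          ← specH_zVar] at h3
      rw [← map_smul, ← map_smul, ← map_smul, ← map_add, ← map_add, h2, map_zero]
  exact (Submodule.Quotient.mk_eq_zero W).1 h1

/-- The HOMFLYPT polynomial. -/
def homfly (m : ℕ) (b : Braid m) : HRing := Classical.choose (Y_mem_range b)

theorem specH_homfly {m : ℕ} (b : Braid m) : specH (homfly m b) = Y b :=
  Classical.choose_spec (Y_mem_range b)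

/-- All the required identities hold for `Y` and are pulled back along the injective specialization.
-/
theorem isHOMFLYPT_homfly : IsHOMFLYPT homfly where
  inv :=
    { conj := fun m b b' => specH_injective (by
        rw [specH_homfly, specH_homfly]; exact isLinkInvariant_Y.conj m b b')
      stab_pos := fun m b => specH_injective (by
        rw [specH_homfly, specH_homfly]; exact isLinkInvariant_Y.stab_pos m b)
      stab_neg := fun m b => specH_injective (by
        rw [specH_homfly, specH_homfly]; exact isLinkInvariant_Y.stab_neg m b) }
  unknot := specH_injective (by rw [specH_homfly, map_one]; exact Y_unknot)
  skein m r b b' := specH_injective (by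
    rw [map_add, map_add, map_mul, map_mul, map_mul, specH_homfly, specH_homfly, specH_homfly,
      specH_lPow, specH_lPow, specH_zVar, map_zero, zpow_one, zpow_neg_one]
    exact Y_skein_lz r b b')

theorem isHOMFLYPT_unique {Q Q' : (m : ℕ) → Braid m → HRing} (h : IsHOMFLYPT Q)
    (h' : IsHOMFLYPT Q') : Q' = Q := by
  funext m b
  rw [← sub_eq_zero]
  refine isLinkInvariant_eq_zero (S := HRing) (D := fun m b => Q' m b - Q m b)
    (u := lPow 1) (v := lPow (-1)) (w := zVar) ⟨?_, ?_, ?_⟩ (isUnit_lPow _) (isUnit_lPow _)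
    isUnit_zVar ?_ ?_ m b
  · intro m b b'
    rw [h.inv.conj, h'.inv.conj]
  · intro m b
    rw [h.inv.stab_pos, h'.inv.stab_pos]
  · intro m b
    rw [h.inv.stab_neg, h'.inv.stab_neg]
  · rw [h.unknot, h'.unknot, sub_self]
  · intro m r b b'
    simp only [smul_eq_mul]
    linear_combination h'.skein m r b b' - h.skein m r b b'

end KR

end

theorem mainTheorem8 :
    -- the invariants `X` are given by finite dimensions and finite sums of Laurent series
    (∀ (m : ℕ) (w : KR.Word m),
      (∀ (i : ℕ) (j e : ℤ), FiniteDimensional ℂ (KR.HHH (KR.F w) i j e)) ∧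
      {p : ℕ × ℤ | KR.hilb w p.1 p.2 ≠ 0}.Finite) ∧
    -- `Y` depends only on the braid
    (∀ (m : ℕ) (w : KR.Word m), KR.Yword w = KR.Y (KR.braidOf w)) ∧
    -- the skein relation
    (∀ (m : ℕ) (r : Fin m) (b b' : KR.Braid m),
      KR.t₁half (-1) * KR.t₂half 1 * KR.Y (b * (KR.σ r)⁻¹ * b') +
          KR.t₁half 1 * KR.t₂half (-1) * KR.Y (b * KR.σ r * b') =
        KR.iR * (KR.t₁half (-1) - KR.t₁half 1) * KR.Y (b * b')) ∧
    -- `Y` is an invariant of oriented links, equal to `1` on the unknot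
    KR.IsLinkInvariant (fun m (b : KR.Braid m) => KR.Y b) ∧
    KR.Y (1 : KR.Braid 0) = 1 ∧
    -- `Y` is the HOMFLYPT polynomial, at `l = t₁^{1/2} t₂^{-1/2}`,
    -- `z = -√-1 (t₁^{-1/2} - t₁^{1/2})`
    ∃ Q : (m : ℕ) → KR.Braid m → KR.HRing, KR.IsHOMFLYPT Q ∧
      (∀ Q' : (m : ℕ) → KR.Braid m → KR.HRing, KR.IsHOMFLYPT Q' → Q' = Q) ∧
      ∃ φ : KR.HRing →+* KR.R,
        φ (KR.lPow 1) = KR.t₁half 1 * KR.t₂half (-1) ∧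
        φ KR.zVar = -(KR.iR * (KR.t₁half (-1) - KR.t₁half 1)) ∧
        ∀ (m : ℕ) (b : KR.Braid m), KR.Y b = φ (Q m b) := by
  refine ⟨fun m w => ⟨fun i j e => inferInstance, ?_⟩, fun m w => KR.Yword_eq_Y w,
    fun m r b b' => KR.Y_skein r b b', KR.isLinkInvariant_Y, KR.Y_unknot, KR.homfly,
    KR.isHOMFLYPT_homfly, fun Q' hQ' => KR.isHOMFLYPT_unique KR.isHOMFLYPT_homfly hQ',
    KR.specH, ?_, ?_, fun m b => (KR.specH_homfly b).symm⟩
  · exact (Finset.finite_toSet _).subset (KR.hilb_support w)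
  · rw [KR.specH_lPow, zpow_one, KR.lUnit_val]
  · rw [KR.specH_zVar, KR.zUnit_val]
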